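/- For a graph $H$ and an integer $k\ge 1$, let $gr_k(K_3:H)$ denote the minimum integer $m$ such that every coloring of the edges of the complete graph $K_m$ with $k$ available colors (not all of which need to be used) contains either a rainbow triangle (a triangle whose three edges have pairwise different colors) or a monochromatic copy of $H$, that is, a not necessarily induced subgraph isomorphic to $H$ all of whose edges have the same color. For $t\ge 3$, let $P_t^+$ denote the graph obtained from the path $v_1v_2\cdots v_t$ on $t$ vertices by adding the edge $v_1v_3$. Then for all integers $t\ge 4$ and $k\ge 1$, $$ gr_k(K_3:P_t^+)=\begin{cases} 2(t-1)\cdot 5^{\frac{k-2}{2}}+1 & \text{if } k \text{ is even},\\ (t-1)\cdot 5^{\frac{k-1}{2}}+1 & \text{if } k \text{ is odd}. \end{cases} $$ -/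

import Mathlib

/-- The path on the `t` vertices `0, 1, …, t - 1` (in this order) together with the edge joining
the end `0` to the vertex `2` at distance two along the path. Meaningful for `3 ≤ t`. -/
def pathPlus (t : ℕ) : SimpleGraph (Fin t) :=
  SimpleGraph.pathGraph t ⊔ SimpleGraph.fromRel (fun i j => i.val = 0 ∧ j.val = 2)

/-- The edge-coloured complete graph `C` contains a (not necessarily induced) copy of `G` whose
edges receive pairwise distinct colours. -/
def HasRainbowCopy {V K W : Type*} (C : SimpleGraph.TopEdgeLabeling V K)
    (G : SimpleGraph W) : Prop :=
  ∃ f : SimpleGraph.Copy G (⊤ : SimpleGraph V),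
    Function.Injective (fun e : G.edgeSet => C (f.toHom.mapEdgeSet e))

/-- The edge-coloured complete graph `C` contains a (not necessarily induced) copy of `H` whose
edges all have the same colour. -/
def HasMonochromaticCopy {V K W : Type*} (C : SimpleGraph.TopEdgeLabeling V K)
    (H : SimpleGraph W) : Prop :=
  ∃ c : K, SimpleGraph.IsContained H (C.labelGraph c)

/-- `m` is the Gallai-Ramsey number `gr_k(G : H)`: the least number of vertices such that every
edge colouring of the complete graph with colours from a `k`-element set contains a rainbow copy
of `G` or a monochromatic copy of `H`. -/
def IsGallaiRamseyNumber {U W : Type*} (k : ℕ) (G : SimpleGraph U) (H : SimpleGraph W)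
    (m : ℕ) : Prop :=
  IsLeast {n : ℕ | ∀ C : SimpleGraph.TopEdgeLabeling (Fin n) (Fin k),
    HasRainbowCopy C G ∨ HasMonochromaticCopy C H} m

/-! Put `u = t - 1` and `s = ⌊u / 2⌋`. A copy of $P_t^+$ is a triangle with a path hanging from one
of its vertices, `u + 1` vertices in all. The theorem says that the largest colouring with `k`
colours that avoids both configurations has `maxOrder u k` vertices: `u` for one colour, `2 * u` for
two, and five times as many for every two further colours.

Lower bound: a monochromatic complete graph on `u` vertices is too small to contain $P_t^+$. Two
copies joined by one new colour, or five copies joined by the two-pentagon colouring in two new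
colours, create no rainbow triangle, since at most two colours run between copies, and no triangle
in a new colour (`Good.blowUp`).

Upper bound: strong induction on the number of colours. Long tails come from two sources. A triangle
connected in its colour to a complete bipartite graph of that colour with sides at least `s + 1` has
a tail on `2 * s + 2 ≥ u + 1` vertices (`triTail_of_complete_of_triangle`); a triangle in a graph of
minimum degree `u` grows a tail greedily (`triTail_of_degree`). Conversely, depth-first search from
a triangle of colour `r` keeps at most `u` vertices on its stack, so finished and unvisited vertices
make up nearly everything and send no colour `r` to each other; this yields a large bipartite graph
of the other colour. These facts settle two colours, and also Gallai partitions whose parts all have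
at most `s` vertices.

With three or more colours, take a smallest module `A` of the vertex set `W` having at most `s`
outside neighbours in each colour (`SmallCut`), and a Gallai partition of `A`. If parts larger than
`s` exist, then either a single such part contradicts minimality, or some colour between parts lies
in no triangle meeting `A`. That colour is then absent inside large pieces, to which the induction
hypothesis applies with fewer colours. The leftover vertices outside `A` would spoil the exact
count; they are absorbed into one piece by a recolouring that creates no forbidden subgraph
(`Absorbing.good`). -/

noncomputable section
open scoped Classical

variable {V κ : Type}

/-! ### Coloured paths and triangles with tails -/

/-- A path of colour `c` inside `A`, as the list of its vertices. -/
def ColorPath (C : V → V → κ) (c : κ) (A : Finset V) (l : List V) : Prop :=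
  l.Nodup ∧ (∀ v ∈ l, v ∈ A) ∧ l.IsChain (fun a b => C a b = c)

/-- A triangle `x y z` of colour `c` inside `A` with a path of colour `c` attached at `z`,
on at least `m` vertices altogether. -/
def TriTail (C : V → V → κ) (c : κ) (A : Finset V) (m : ℕ) : Prop :=
  ∃ x y z l, ColorPath C c A (z :: l) ∧ x ∈ A ∧ y ∈ A ∧ x ≠ y ∧ x ∉ z :: l ∧ y ∉ z :: l ∧
    C x y = c ∧ C x z = c ∧ C y z = c ∧ m ≤ l.length + 3

/-- All pairs between `X` and `Y` have colour `c`. -/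
def Complete (C : V → V → κ) (c : κ) (X Y : Finset V) : Prop :=
  ∀ x ∈ X, ∀ y ∈ Y, C x y = c

/-- Adjacency in colour `c` inside `A`. -/
def ColorAdj (C : V → V → κ) (c : κ) (A : Finset V) (x y : V) : Prop :=
  x ∈ A ∧ y ∈ A ∧ x ≠ y ∧ C x y = c

/-- A symmetric colouring of the pairs in `A` by colours from `K`, without rainbow triangles and
without monochromatic triangles with a tail on `t` vertices. -/
structure Good (C : V → V → κ) (K : Finset κ) (A : Finset V) (t : ℕ) : Prop where
  symm : ∀ x y, C x y = C y x
  mem : ∀ x ∈ A, ∀ y ∈ A, x ≠ y → C x y ∈ K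
  gallai : ∀ x ∈ A, ∀ y ∈ A, ∀ z ∈ A, x ≠ y → y ≠ z → x ≠ z →
    C x y = C y z ∨ C x y = C x z ∨ C y z = C x z
  free : ∀ c, ¬ TriTail C c A t

variable {C : V → V → κ} {c : κ} {A : Finset V}

theorem colorPath_singleton {a : V} : ColorPath C c A [a] ↔ a ∈ A := by
  simp [ColorPath]

theorem colorPath_cons_cons {a b : V} {l : List V} :
    ColorPath C c A (a :: b :: l) ↔ a ∈ A ∧ a ∉ b :: l ∧ C a b = c ∧ ColorPath C c A (b :: l) := by
  simp only [ColorPath, List.nodup_cons, List.isChain_cons_cons, List.forall_mem_cons]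
  tauto

theorem ColorPath.mono {B : Finset V} {l : List V} (h : ColorPath C c A l) (hB : ∀ v ∈ l, v ∈ B) :
    ColorPath C c B l := ⟨h.1, hB, h.2.2⟩

theorem ColorPath.mem {l : List V} (h : ColorPath C c A l) : ∀ v ∈ l, v ∈ A := h.2.1

theorem TriTail.mono {B : Finset V} {m n : ℕ} (h : TriTail C c A m) (hB : A ⊆ B) (hn : n ≤ m) :
    TriTail C c B n := by
  obtain ⟨x, y, z, l, hp, hx, hy, h⟩ := h
  refine ⟨x, y, z, l, hp.mono fun v hv => hB (hp.mem v hv), hB hx, hB hy, ?_⟩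
  refine ⟨h.1, h.2.1, h.2.2.1, h.2.2.2.1, h.2.2.2.2.1, h.2.2.2.2.2.1, ?_⟩
  have := h.2.2.2.2.2.2
  omega

theorem Good.mono {K : Finset κ} {B : Finset V} {t : ℕ} (h : Good C K A t) (hB : B ⊆ A) :
    Good C K B t where
  symm := h.symm
  mem x hx y hy := h.mem x (hB hx) y (hB hy)
  gallai x hx y hy z hz := h.gallai x (hB hx) y (hB hy) z (hB hz)
  free c hc := h.free c (hc.mono hB le_rfl)

theorem Complete.symm {X Y : Finset V} (hC : ∀ x y, C x y = C y x) (h : Complete C c X Y) :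
    Complete C c Y X := fun x hx y hy => by rw [hC, h y hy x hx]

theorem Complete.mono {X Y X' Y' : Finset V} (h : Complete C c X Y) (hX : X' ⊆ X) (hY : Y' ⊆ Y) :
    Complete C c X' Y' := fun x hx y hy => h x (hX hx) y (hY hy)

/-! ### Long tails from complete bipartite graphs -/

theorem exists_alternating_path (hC : ∀ x y, C x y = C y x) (n : ℕ) :
    ∀ X Y : Finset V, Disjoint X Y → Complete C c X Y → ∀ a ∈ X, n + 1 ≤ X.card → n + 1 ≤ Y.card →
      ∃ l, ColorPath C c (X ∪ Y) (a :: l) ∧ l.length + 1 = 2 * (n + 1) := by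
  induction n with
  | zero =>
    intro X Y hd hXY a ha _ hY
    obtain ⟨b, hb⟩ := Finset.card_pos.mp hY
    have hab : a ≠ b := fun e => Finset.disjoint_left.mp hd ha (e ▸ hb)
    refine ⟨[b], ?_, rfl⟩
    rw [colorPath_cons_cons, colorPath_singleton]
    simp [ha, hb, hab, hXY a ha b hb]
  | succ n ih =>
    intro X Y hd hXY a ha hX hY
    obtain ⟨b, hb⟩ := Finset.card_pos.mp (show 0 < Y.card by omega)
    have hab : a ≠ b := fun e => Finset.disjoint_left.mp hd ha (e ▸ hb)
    have hX' := Finset.card_erase_of_mem ha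
    have hY' := Finset.card_erase_of_mem hb
    obtain ⟨a', ha'⟩ := Finset.card_pos.mp (show 0 < (X.erase a).card by omega)
    have hsX := Finset.erase_subset a X
    have hsY := Finset.erase_subset b Y
    obtain ⟨l, hl, hlen⟩ := ih (X.erase a) (Y.erase b) (Finset.disjoint_of_subset_left hsX
      (Finset.disjoint_of_subset_right hsY hd)) (hXY.mono hsX hsY) a' ha' (by omega) (by omega)
    have hmem := hl.mem
    refine ⟨b :: a' :: l, ?_, by simp only [List.length_cons]; omega⟩
    have hdl : ∀ v ∈ X, v ∉ Y := fun v hv => Finset.disjoint_left.mp hd hv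
    rw [colorPath_cons_cons, colorPath_cons_cons]
    refine ⟨by simp [ha], ?_, hXY a ha b hb, by simp [hb], ?_, ?_, hl.mono ?_⟩
    · intro h
      rcases List.mem_cons.mp h with h | h
      · exact hab h
      · have := hmem a h
        simp only [Finset.mem_union, Finset.mem_erase] at this
        grind
    · intro h
      have := hmem b h
      simp only [Finset.mem_union, Finset.mem_erase] at this
      grind
    · rw [hC]; exact hXY a' (hsX ha') b hb
    · intro v hv
      have := hmem v hv
      simp only [Finset.mem_union, Finset.mem_erase] at this ⊢
      grind

/-- An edge inside one side of a large monochromatic complete bipartite graph. -/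
theorem triTail_of_edge_in_side {s : ℕ} (hC : ∀ x y, C x y = C y x) {X Y : Finset V}
    (hd : Disjoint X Y) (hXY : Complete C c X Y) (hXA : X ⊆ A) (hYA : Y ⊆ A) (hs : 1 ≤ s)
    (hX : s + 1 ≤ X.card) (hY : s + 1 ≤ Y.card) {x y : V} (hx : x ∈ X) (hy : y ∈ X) (hxy : x ≠ y)
    (hc : C x y = c) : TriTail C c A (2 * s + 2) := by
  obtain ⟨b, hb⟩ := Finset.card_pos.mp (show 0 < Y.card by omega)
  have hX' := Finset.card_erase_of_mem hx
  have hY' := Finset.card_erase_of_mem hb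
  have hsX := Finset.erase_subset x X
  have hsY := Finset.erase_subset b Y
  -- With `x` and `b` reserved for the triangle `x b y`, each side keeps at least `s` vertices,
  -- enough for an alternating path on `2 * s` vertices from `y`.
  obtain ⟨l, hl, hlen⟩ := exists_alternating_path hC (s - 1) (X.erase x) (Y.erase b)
    (Finset.disjoint_of_subset_left hsX (Finset.disjoint_of_subset_right hsY hd))
    (hXY.mono hsX hsY) y (by simp [hxy.symm, hy]) (by omega) (by omega)
  have hmem := hl.mem
  have hdl : ∀ v ∈ X, v ∉ Y := fun v hv => Finset.disjoint_left.mp hd hv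
  refine ⟨x, b, y, l, hl.mono ?_, hXA hx, hYA hb, ?_, ?_, ?_, hXY x hx b hb, hc, ?_, by omega⟩
  · intro v hv
    have := hmem v hv
    simp only [Finset.mem_union, Finset.mem_erase] at this
    grind
  · grind
  · intro h
    have := hmem _ h
    simp only [Finset.mem_union, Finset.mem_erase] at this
    grind
  · intro h
    have := hmem _ h
    simp only [Finset.mem_union, Finset.mem_erase] at this
    grind
  · rw [hC]; exact hXY y hy b hb

/-- A path of colour `c` starting at the head, avoiding `T`, and meeting `S` exactly in its last
vertex, given by its vertices after the first. -/
inductive PathTo (C : V → V → κ) (c : κ) (A S T : Finset V) : V → List V → Prop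
  | here {w : V} : w ∈ S → w ∈ A → PathTo C c A S T w []
  | step {w w' : V} {l : List V} : w ∉ S → w ∈ A → w' ∉ T → C w w' = c → w ∉ w' :: l →
      PathTo C c A S T w' l → PathTo C c A S T w (w' :: l)

theorem PathTo.suffix {S T : Finset V} {w : V} {l : List V} (h : PathTo C c A S T w l) :
    ∀ v ∈ w :: l, ∃ l', PathTo C c A S T v l' := by
  induction h with
  | here h1 h2 =>
    intro v hv
    rw [List.mem_singleton] at hv
    exact ⟨[], .here (hv ▸ h1) (hv ▸ h2)⟩
  | step h1 h2 h3 h4 h5 h6 ih =>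
    intro v hv
    rcases List.mem_cons.mp hv with rfl | hv
    · exact ⟨_, .step h1 h2 h3 h4 h5 h6⟩
    · exact ih v hv

theorem PathTo.notMem {S T : Finset V} {w : V} {l : List V} (h : PathTo C c A S T w l) :
    ∀ v ∈ l, v ∉ T := by
  induction h with
  | here => simp
  | step h1 h2 h3 h4 h5 h6 ih =>
    intro v hv
    rcases List.mem_cons.mp hv with rfl | hv
    · exact h3
    · exact ih v hv

/-- The path meets `S` only in its last vertex `e`, so any path from `e` inside `S` can be appended
without repetition. -/
theorem PathTo.extend {S T : Finset V} {w : V} {l : List V} (h : PathTo C c A S T w l) :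
    ∃ e ∈ S, (e = w ∨ e ∉ T) ∧ ∀ m, (∀ v ∈ m, v ∈ S) → ColorPath C c A (e :: m) →
      ∃ l', ColorPath C c A (w :: l') ∧ m.length ≤ l'.length ∧ ∀ v ∈ l', v ∈ l ∨ v ∈ m := by
  induction h with
  | @here w h1 h2 => exact ⟨w, h1, Or.inl rfl, fun m hm hp => ⟨m, hp, le_rfl, fun v hv => .inr hv⟩⟩
  | @step w w' l h1 h2 h3 h4 h5 h6 ih =>
    obtain ⟨e, he, he', H⟩ := ih
    refine ⟨e, he, Or.inr (by rcases he' with rfl | h <;> assumption), fun m hm hp => ?_⟩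
    obtain ⟨l', hl', hlen, hsub⟩ := H m hm hp
    refine ⟨w' :: l', ?_, by simp only [List.length_cons]; omega, ?_⟩
    · rw [colorPath_cons_cons]
      refine ⟨h2, ?_, h4, hl'⟩
      intro hw
      rcases List.mem_cons.mp hw with hw | hw
      · exact h5 (hw ▸ List.mem_cons_self)
      · rcases hsub w hw with h | h
        · exact h5 (List.mem_cons_of_mem _ h)
        · exact h1 (hm w h)
    · intro v hv
      rcases List.mem_cons.mp hv with rfl | hv
      · simp
      · rcases hsub v hv with h | h
        · exact .inl (List.mem_cons_of_mem _ h)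
        · exact .inr h

/-- Reading a walk from its end in `S` backwards, a path is built up; once a vertex of `T` is
reached the path stays fixed, so that it meets `T` at most in its first vertex. -/
theorem exists_pathTo {S T : Finset V} {w k : V} (hk : k ∈ S) (hkA : k ∈ A)
    (h : Relation.ReflTransGen (ColorAdj C c A) w k) :
    (w ∉ T ∧ ∃ l, PathTo C c A S T w l) ∨ ∃ v ∈ T, ∃ l, PathTo C c A S T v l := by
  induction h using Relation.ReflTransGen.head_induction_on with
  | refl =>
    by_cases hT : k ∈ T
    · exact .inr ⟨k, hT, [], .here hk hkA⟩
    · exact .inl ⟨hT, [], .here hk hkA⟩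
  | @head w w' hww' _ ih =>
    rcases ih with ⟨hw', l, hl⟩ | ih
    · have key : ∃ l, PathTo C c A S T w l := by
        by_cases hS : w ∈ S
        · exact ⟨[], .here hS hww'.1⟩
        · by_cases hmem : w ∈ w' :: l
          · exact hl.suffix w hmem
          · exact ⟨_, .step hS hww'.1 hw' hww'.2.2.2 hmem hl⟩
      by_cases hT : w ∈ T
      · exact .inr ⟨w, hT, key⟩
      · exact .inl ⟨hT, key⟩
    · exact .inr ih

/-- A shortest-type connection leads from some vertex of the triangle to `X ∪ Y`, avoiding the other
two vertices, and is continued by an alternating path. If a side contains an edge of colour `c`, the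
previous construction already applies. Otherwise the two remaining triangle vertices cannot lie on
the same side, so removing them costs each side at most one vertex. -/
theorem triTail_of_complete_of_triangle {s : ℕ} (hC : ∀ x y, C x y = C y x) {X Y : Finset V}
    (hd : Disjoint X Y) (hXY : Complete C c X Y) (hXA : X ⊆ A) (hYA : Y ⊆ A) (hs : 1 ≤ s)
    (hX : s + 1 ≤ X.card) (hY : s + 1 ≤ Y.card) {x y z k : V} (hx : x ∈ A) (hy : y ∈ A)
    (hxy : x ≠ y) (hxz : x ≠ z) (hyz : y ≠ z) (cxy : C x y = c) (cxz : C x z = c) (cyz : C y z = c)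
    (hk : k ∈ X ∪ Y) (hr : Relation.ReflTransGen (ColorAdj C c A) z k) :
    TriTail C c A (2 * s + 2) := by
  have hYX := hXY.symm hC
  have hdl : ∀ v ∈ X, v ∉ Y := fun v hv => Finset.disjoint_left.mp hd hv
  by_cases hX1 : ∃ a ∈ X, ∃ b ∈ X, a ≠ b ∧ C a b = c
  · obtain ⟨a, ha, b, hb, hab, h⟩ := hX1
    exact triTail_of_edge_in_side hC hd hXY hXA hYA hs hX hY ha hb hab h
  by_cases hY1 : ∃ a ∈ Y, ∃ b ∈ Y, a ≠ b ∧ C a b = c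
  · obtain ⟨a, ha, b, hb, hab, h⟩ := hY1
    exact triTail_of_edge_in_side hC hd.symm hYX hYA hXA hs hY hX ha hb hab h
  push Not at hX1 hY1
  -- The triangle is symmetric, so it may be relabelled so that the connecting path starts at `z`.
  have key : ∀ x y z : V, x ∈ A → y ∈ A → x ≠ y → x ≠ z → y ≠ z → C x y = c → C x z = c →
      C y z = c → (∃ l, PathTo C c A (X ∪ Y) {x, y, z} z l) → TriTail C c A (2 * s + 2) := by
    rintro x y z hx hy hxy hxz hyz cxy cxz cyz ⟨l, hl⟩
    have hT := hl.notMem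
    obtain ⟨e, he, heT, H⟩ := hl.extend
    have hex : e ≠ x ∧ e ≠ y := by
      simp only [Finset.mem_insert, Finset.mem_singleton] at heT
      grind
    have key2 : ∀ X' Y' : Finset V, Disjoint X' Y' → Complete C c X' Y' → X' ⊆ X ∪ Y →
        Y' ⊆ X ∪ Y → s ≤ X'.card → s ≤ Y'.card → e ∈ X' → x ∉ X' → y ∉ X' → x ∉ Y' → y ∉ Y' →
        TriTail C c A (2 * s + 2) := by
      intro X' Y' hd' hXY' hX' hY' cX cY heX h1 h2 h3 h4
      obtain ⟨m, hm, hmlen⟩ := exists_alternating_path hC (s - 1) X' Y' hd' hXY' e heX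
        (by omega) (by omega)
      have hmem := hm.mem
      have hsub : ∀ v ∈ e :: m, v ∈ X ∪ Y := fun v hv =>
        (Finset.mem_union.mp (hmem v hv)).elim (fun h => hX' h) (fun h => hY' h)
      obtain ⟨l', hl', hlen, hl'sub⟩ := H m (fun v hv => hsub v (List.mem_cons_of_mem _ hv))
        (hm.mono fun v hv => Finset.union_subset hXA hYA (hsub v hv))
      refine ⟨x, y, z, l', hl', hx, hy, hxy, ?_, ?_, cxy, cxz, cyz, by omega⟩
      · intro h
        rcases List.mem_cons.mp h with h | h
        · exact hxz h
        rcases hl'sub _ h with h | h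
        · exact hT _ h (by simp)
        · rcases Finset.mem_union.mp (hmem _ (List.mem_cons_of_mem _ h)) with h | h <;> tauto
      · intro h
        rcases List.mem_cons.mp h with h | h
        · exact hyz h
        rcases hl'sub _ h with h | h
        · exact hT _ h (by simp)
        · rcases Finset.mem_union.mp (hmem _ (List.mem_cons_of_mem _ h)) with h | h <;> tauto
    have hcard : ∀ Z : Finset V, s + 1 ≤ Z.card → (x ∉ Z ∨ y ∉ Z) →
        s ≤ ((Z.erase x).erase y).card := by
      intro Z hZ h
      have h1 := Finset.pred_card_le_card_erase (s := Z) (a := x)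
      have h2 := Finset.pred_card_le_card_erase (s := Z.erase x) (a := y)
      rcases h with h | h
      · rw [Finset.erase_eq_of_notMem h] at h2 ⊢; omega
      · rw [Finset.erase_eq_of_notMem (a := y) (fun h' => h (Finset.mem_of_mem_erase h'))]; omega
    have hXc := hcard X hX (by by_contra h; push Not at h; exact hX1 x h.1 y h.2 hxy cxy)
    have hYc := hcard Y hY (by by_contra h; push Not at h; exact hY1 x h.1 y h.2 hxy cxy)
    have sX : (X.erase x).erase y ⊆ X := (Finset.erase_subset _ _).trans (Finset.erase_subset _ _)
    have sY : (Y.erase x).erase y ⊆ Y := (Finset.erase_subset _ _).trans (Finset.erase_subset _ _)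
    have hd' := Finset.disjoint_of_subset_left sX (Finset.disjoint_of_subset_right sY hd)
    rcases Finset.mem_union.mp he with he | he
    · exact key2 _ _ hd' (hXY.mono sX sY) (sX.trans Finset.subset_union_left)
        (sY.trans Finset.subset_union_right) hXc hYc (by simp [he, hex]) (by simp) (by simp)
        (by simp) (by simp)
    · exact key2 _ _ hd'.symm (hYX.mono sY sX) (sY.trans Finset.subset_union_right)
        (sX.trans Finset.subset_union_left) hYc hXc (by simp [he, hex]) (by simp) (by simp)
        (by simp) (by simp)
  have hkA : k ∈ A := Finset.union_subset hXA hYA hk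
  rcases exists_pathTo (T := {x, y, z}) hk hkA hr with ⟨h, -⟩ | ⟨v, hv, hl⟩
  · simp at h
  · have hzA : z ∈ A := by
      rcases Relation.ReflTransGen.cases_head hr with rfl | ⟨w, hw, -⟩
      · exact hkA
      · exact hw.1
    simp only [Finset.mem_insert, Finset.mem_singleton] at hv
    rcases hv with rfl | rfl | rfl
    · refine key z y v hzA hy hyz.symm hxz.symm hxy.symm (by rw [hC]; exact cyz)
        (by rw [hC]; exact cxz) (by rw [hC]; exact cxy) ?_
      have : ({v, y, z} : Finset V) = {z, y, v} := by ext; simp; tauto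
      rwa [← this]
    · refine key x z v hx hzA hxz hxy hyz.symm cxz cxy (by rw [hC]; exact cyz) ?_
      have : ({x, v, z} : Finset V) = {x, z, v} := by ext; simp; tauto
      rwa [← this]
    · exact key x y v hx hy hxy hxz hyz cxy cxz cyz hl

/-! ### Growing a tail from its free end -/

/-- A triangle with a tail of colour `c` inside `A`, listed from the free end of the tail to the
triangle. -/
inductive TailList (C : V → V → κ) (c : κ) (A : Finset V) : List V → Prop
  | tri {x y z : V} : x ∈ A → y ∈ A → z ∈ A → x ≠ y → x ≠ z → y ≠ z → C x y = c → C x z = c →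
      C y z = c → TailList C c A [z, y, x]
  | cons {w w' : V} {l : List V} : TailList C c A (w :: l) → w' ∈ A → w' ∉ w :: l → C w' w = c →
      TailList C c A (w' :: w :: l)

theorem TailList.nodup {l : List V} (h : TailList C c A l) : l.Nodup := by
  induction h with
  | tri => simp; grind
  | cons _ _ h _ ih => exact List.nodup_cons.mpr ⟨h, ih⟩

theorem TailList.mem {l : List V} (h : TailList C c A l) : ∀ v ∈ l, v ∈ A := by
  induction h with
  | tri => simp; grind
  | cons _ h _ _ ih => exact List.forall_mem_cons.mpr ⟨h, ih⟩

theorem TailList.three_le {l : List V} (h : TailList C c A l) : 3 ≤ l.length := by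
  induction h with
  | tri => simp
  | cons _ _ _ _ ih => simp only [List.length_cons] at ih ⊢; omega

theorem TailList.eq_append {l : List V} (h : TailList C c A l) :
    ∃ x y z r, l = r ++ [z, y, x] ∧ ColorPath C c A (r ++ [z]) ∧ C x y = c ∧ C x z = c ∧
      C y z = c := by
  induction h with
  | @tri x y z hx hy hz hxy hxz hyz cxy cxz cyz =>
    exact ⟨x, y, z, [], rfl, colorPath_singleton.mpr hz, cxy, cxz, cyz⟩
  | @cons w w' l h hw' hmem hc ih =>
    obtain ⟨x, y, z, r, hl, hp, h⟩ := ih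
    refine ⟨x, y, z, w' :: r, by rw [hl, List.cons_append], ?_, h⟩
    rw [hl] at hmem
    rcases r with _ | ⟨a, r⟩
    · simp only [List.nil_append, List.cons.injEq, List.cons_append] at *
      rw [colorPath_cons_cons]
      exact ⟨hw', by simp_all, by rw [← hl.1]; exact hc, hp⟩
    · simp only [List.cons.injEq, List.cons_append] at *
      rw [colorPath_cons_cons]
      refine ⟨hw', ?_, by rw [← hl.1]; exact hc, hp⟩
      simp only [List.mem_cons, List.mem_append] at hmem ⊢
      tauto

theorem TailList.triTail {l : List V} (hC : ∀ x y, C x y = C y x) (h : TailList C c A l) :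
    TriTail C c A l.length := by
  have hnd := h.nodup
  have hmem := h.mem
  obtain ⟨x, y, z, r, rfl, hp, cxy, cxz, cyz⟩ := h.eq_append
  refine ⟨x, y, z, r.reverse, ⟨?_, ?_, ?_⟩, hmem x (by simp), hmem y (by simp), ?_, ?_, ?_, cxy, cxz,
    cyz, by simp⟩
  · have := hp.1
    simp only [List.nodup_append] at this
    simp_all
    grind
  · intro v hv
    exact hp.mem v (by simp at hv ⊢; tauto)
  · have h : (r ++ [z]).IsChain (fun a b => C b a = c) :=
      hp.2.2.imp fun a b hab => by rw [hC]; exact hab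
    simpa using List.isChain_reverse.mpr h
  all_goals
    simp only [List.nodup_append, List.nodup_cons, List.mem_cons] at hnd ⊢
    grind

/-- As long as the configuration has at most `u` vertices, the free end has at most `u - 1`
neighbours in it, hence a neighbour outside, by which the tail is prolonged. -/
theorem triTail_of_degree {u : ℕ} {x y z : V} (hx : x ∈ A) (hy : y ∈ A) (hz : z ∈ A)
    (hxy : x ≠ y) (hxz : x ≠ z) (hyz : y ≠ z) (cxy : C x y = c) (cxz : C x z = c) (cyz : C y z = c)
    (hC : ∀ x y, C x y = C y x) (hu : 2 ≤ u)
    (hdeg : ∀ v ∈ A, u ≤ (A.filter fun w => w ≠ v ∧ C v w = c).card) :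
    TriTail C c A (u + 1) := by
  have key : ∀ m, m + 2 ≤ u → ∃ l, TailList C c A l ∧ l.length = m + 3 := by
    intro m hm
    induction m with
    | zero => exact ⟨_, .tri hx hy hz hxy hxz hyz cxy cxz cyz, rfl⟩
    | succ m ih =>
      obtain ⟨l, hl, hlen⟩ := ih (by omega)
      obtain _ | ⟨w, l⟩ := l
      · simp at hlen
      have hw := hl.mem w (by simp)
      have : ¬ (A.filter fun v => v ≠ w ∧ C w v = c) ⊆ l.toFinset := by
        intro h
        have h1 := (hdeg w hw).trans ((Finset.card_le_card h).trans l.toFinset_card_le)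
        simp only [List.length_cons] at hlen
        omega
      obtain ⟨v, hv, hvl⟩ := Finset.not_subset.mp this
      simp only [Finset.mem_filter, List.mem_toFinset] at hv hvl
      exact ⟨v :: w :: l, .cons hl hv.1 (by simp [hv.2.1, hvl]) (by rw [hC]; exact hv.2.2),
        by simp only [List.length_cons] at hlen ⊢; omega⟩
  obtain ⟨l, hl, hlen⟩ := key (u - 2) (by omega)
  exact (hl.triTail hC).mono subset_rfl (by omega)

end

/-! ### Gallai's structure theorem -/

noncomputable section
open scoped Classical

variable {V κ : Type} {C : V → V → κ} {c : κ} {A : Finset V}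

/-- There is no rainbow triangle inside `A`. -/
def NoRainbow (C : V → V → κ) (A : Finset V) : Prop :=
  ∀ x ∈ A, ∀ y ∈ A, ∀ z ∈ A, x ≠ y → y ≠ z → x ≠ z → C x y = C y z ∨ C x y = C x z ∨ C y z = C x z

/-- The graph of colour `c` on `A` is connected. -/
def ColorConnected (C : V → V → κ) (c : κ) (A : Finset V) : Prop :=
  ∀ x ∈ A, ∀ y ∈ A, Relation.ReflTransGen (ColorAdj C c A) x y

/-- The fibres of `f` are modules of the coloured complete graph on `A`. -/
def ModulePartition (C : V → V → κ) (A : Finset V) (f : V → V) : Prop :=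
  ∀ x ∈ A, ∀ x' ∈ A, ∀ y ∈ A, f x = f x' → f x ≠ f y → C x y = C x' y

theorem NoRainbow.mono {B : Finset V} (h : NoRainbow C A) (hB : B ⊆ A) : NoRainbow C B :=
  fun x hx y hy z hz => h x (hB hx) y (hB hy) z (hB hz)

theorem reflTransGen_symm {r : V → V → Prop} (hr : ∀ x y, r x y → r y x) {x y : V}
    (h : Relation.ReflTransGen r x y) : Relation.ReflTransGen r y x := by
  induction h with
  | refl => exact .refl
  | tail _ h ih => exact ih.head (hr _ _ h)

theorem colorAdj_symm (hC : ∀ x y, C x y = C y x) : ∀ x y, ColorAdj C c A x y → ColorAdj C c A y x :=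
  fun x y h => ⟨h.2.1, h.1, h.2.2.1.symm, by rw [hC]; exact h.2.2.2⟩

theorem ColorConnected.exists_adj (h : ColorConnected C c A) {v w : V} (hv : v ∈ A) (hw : w ∈ A)
    (hvw : v ≠ w) : ∃ x ∈ A, x ≠ v ∧ C v x = c := by
  rcases Relation.ReflTransGen.cases_head (h v hv w hw) with h | ⟨x, hx, -⟩
  · exact absurd h hvw
  · exact ⟨x, hx.2.1, hx.2.2.1.symm, hx.2.2.2⟩

theorem color_eq_of_not_connected_erase (hC : ∀ x y, C x y = C y x) (hG : NoRainbow C A)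
    (hA : ColorConnected C c A) {v : V} (hv : v ∈ A) (hn : ¬ ColorConnected C c (A.erase v))
    {x x' : V} (hx : x ∈ A) (hx' : x' ∈ A) (hxv : x ≠ v) (hxv' : x' ≠ v) (h1 : C v x ≠ c)
    (h2 : C v x' ≠ c) : C v x = C v x' := by
  set R := Relation.ReflTransGen (ColorAdj C c (A.erase v)) with hR
  have Rsymm : ∀ {x y}, R x y → R y x := reflTransGen_symm (colorAdj_symm hC)
  have noedge : ∀ a b, a ∈ A → b ∈ A → a ≠ v → b ≠ v → ¬ R a b → C a b ≠ c := by
    intro a b ha hb hav hbv hab hc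
    refine hab (.single ⟨by simp [*], by simp [*], ?_, hc⟩)
    rintro rfl
    exact hab .refl
  -- Along a `c`-edge of the component the colour seen from `y` cannot change: neither edge to `y`
  -- has colour `c`, so a change would be a rainbow triangle.
  have fact1 : ∀ a a' y, R a a' → y ∈ A → y ≠ v → a ∈ A → a ≠ v → ¬ R a y → C y a = C y a' := by
    intro a a' y haa' hy hyv ha hav hay
    induction haa' with
    | refl => rfl
    | @tail p q hap hpq ih =>
      have hp := Finset.mem_erase.mp hpq.1
      have hq := Finset.mem_erase.mp hpq.2.1
      have hyp : ¬ R y p := fun h => hay (hap.trans (Rsymm h))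
      have hyq : ¬ R y q := fun h => hay ((hap.tail hpq).trans (Rsymm h))
      have e1 := noedge y p hy hp.2 hyv hp.1 hyp
      have e2 := noedge y q hy hq.2 hyv hq.1 hyq
      have n1 : y ≠ p := by rintro rfl; exact hyp .refl
      have n2 : y ≠ q := by rintro rfl; exact hyq .refl
      have := hG y hy p hp.2 q hq.2 n1 hpq.2.2.1 n2
      have e3 := hpq.2.2.2
      grind
  have fact2 : ∀ a ∈ A, a ≠ v → ∃ a0 ∈ A, a0 ≠ v ∧ R a a0 ∧ C v a0 = c := by
    intro a ha hav
    have := hA a ha v hv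
    induction this using Relation.ReflTransGen.head_induction_on with
    | refl => exact absurd rfl hav
    | @head p q hpq _ ih =>
      by_cases hqv : q = v
      · exact ⟨p, ha, hav, .refl, by rw [hC, ← hqv]; exact hpq.2.2.2⟩
      · obtain ⟨a0, h0, h0v, hR0, hc0⟩ := ih hpq.2.1 hqv
        refine ⟨a0, h0, h0v, hR0.head ⟨?_, ?_, hpq.2.2⟩, hc0⟩
        · simp [ha, hav]
        · simp [hpq.2.1, hqv]
  have fact3 : ∀ a y, a ∈ A → y ∈ A → a ≠ v → y ≠ v → ¬ R a y → C v a ≠ c → C v y = c →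
      C a y = C v a := by
    intro a y ha hy hav hyv hay hva hvy
    have e := noedge a y ha hy hav hyv hay
    have n : a ≠ y := by rintro rfl; exact hay .refl
    have := hG v hv a ha y hy hav.symm n hyv.symm
    grind
  by_cases hxx : R x x'
  · have : ∃ y ∈ A, y ≠ v ∧ ¬ R x y := by
      by_contra hcon
      push Not at hcon
      refine hn fun p hp q hq => ?_
      have hp := Finset.mem_erase.mp hp
      have hq := Finset.mem_erase.mp hq
      exact (Rsymm (hcon p hp.2 hp.1)).trans (hcon q hq.2 hq.1)
    obtain ⟨y, hy, hyv, hxy⟩ := this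
    obtain ⟨y0, hy0, hy0v, hR0, hc0⟩ := fact2 y hy hyv
    have n1 : ¬ R x y0 := fun h => hxy (h.trans (Rsymm hR0))
    have n2 : ¬ R x' y0 := fun h => n1 (hxx.trans h)
    rw [← fact3 x y0 hx hy0 hxv hy0v n1 h1 hc0, ← fact3 x' y0 hx' hy0 hxv' hy0v n2 h2 hc0, hC x,
      hC x']
    exact fact1 x x' y0 hxx hy0 hy0v hx hxv n1
  · have hxx' : ¬ R x' x := fun h => hxx (Rsymm h)
    obtain ⟨a, ha, hav, hRa, hca⟩ := fact2 x hx hxv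
    obtain ⟨b, hb, hbv, hRb, hcb⟩ := fact2 x' hx' hxv'
    have n1 : ¬ R x b := fun h => hxx (h.trans (Rsymm hRb))
    have n2 : ¬ R x' a := fun h => hxx' (h.trans (Rsymm hRa))
    rw [← fact3 x b hx hb hxv hbv n1 h1 hcb, ← fact3 x' a hx' ha hxv' hav n2 h2 hca,
      ← fact1 x' b x hRb hx hxv hx' hxv' hxx', ← fact1 x a x' hRa hx' hxv' hx hxv hxx, hC]

/-- In a colouring without rainbow triangles at most two colours are connected. -/
theorem not_three_connected (hC : ∀ x y, C x y = C y x) {a b d : κ} (hab : a ≠ b) (had : a ≠ d)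
    (hbd : b ≠ d) (n : ℕ) : ∀ A : Finset V, A.card = n + 2 → NoRainbow C A → ColorConnected C a A →
      ColorConnected C b A → ColorConnected C d A → False := by
  induction n with
  | zero =>
    intro A hn hG ha hb hd
    obtain ⟨v, w, hvw, rfl⟩ := Finset.card_eq_two.mp hn
    obtain ⟨x, hx, hxv, h⟩ := ha.exists_adj (v := v) (w := w) (by simp) (by simp) hvw
    obtain ⟨y, hy, hyv, h'⟩ := hb.exists_adj (v := v) (w := w) (by simp) (by simp) hvw
    simp only [Finset.mem_insert, Finset.mem_singleton] at hx hy
    grind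
  | succ n ih =>
    intro A hn hG ha hb hd
    obtain ⟨v, hv, w, hw, hvw⟩ := Finset.one_lt_card.mp (show 1 < A.card by omega)
    have hcard : (A.erase v).card = n + 2 := by rw [Finset.card_erase_of_mem hv]; omega
    obtain ⟨x, hx, hxv, cx⟩ := ha.exists_adj hv hw hvw
    obtain ⟨y, hy, hyv, cy⟩ := hb.exists_adj hv hw hvw
    obtain ⟨z, hz, hzv, cz⟩ := hd.exists_adj hv hw hvw
    -- If one of the three colours is disconnected by removing `v`, the edges at `v` of the other
    -- two colours would have to agree; otherwise all three survive in a smaller set.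
    by_cases na : ColorConnected C a (A.erase v)
    · by_cases nb : ColorConnected C b (A.erase v)
      · by_cases nd : ColorConnected C d (A.erase v)
        · exact ih _ hcard (hG.mono (Finset.erase_subset _ _)) na nb nd
        · have := color_eq_of_not_connected_erase hC hG hd hv nd hx hy hxv hyv (by grind) (by grind)
          grind
      · have := color_eq_of_not_connected_erase hC hG hb hv nb hx hz hxv hzv (by grind) (by grind)
        grind
    · have := color_eq_of_not_connected_erase hC hG ha hv na hy hz hyv hzv (by grind) (by grind)
      grind

/-- Two vertices of `A` lie in the same fibre of `f`, or in different ones and have colour `c`. -/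
def PartAdj (C : V → V → κ) (c : κ) (A : Finset V) (f : V → V) (x y : V) : Prop :=
  x ∈ A ∧ y ∈ A ∧ (f x = f y ∨ f x ≠ f y ∧ C x y = c)

theorem partAdj_symm (hC : ∀ x y, C x y = C y x) {f : V → V} :
    ∀ x y, PartAdj C c A f x y → PartAdj C c A f y x :=
  fun x y h => ⟨h.2.1, h.1, h.2.2.imp Eq.symm fun h => ⟨h.1.symm, by rw [hC]; exact h.2⟩⟩

theorem ModulePartition.color_eq (hC : ∀ x y, C x y = C y x) {f : V → V}
    (h : ModulePartition C A f) {x x' y y' : V} (hx : x ∈ A) (hx' : x' ∈ A) (hy : y ∈ A)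
    (hy' : y' ∈ A) (hxx : f x = f x') (hyy : f y = f y') (hxy : f x ≠ f y) : C x y = C x' y' := by
  rw [h x hx x' hx' y hy hxx hxy, hC, h y hy y' hy' x' hx' hyy (by rw [← hxx]; exact hxy.symm), hC]

/-- A module partition with the least possible number of parts (at least two): every colour
occurring between two parts is connected on the parts. -/
theorem exists_minimal_modulePartition (hC : ∀ x y, C x y = C y x) (hG : NoRainbow C A)
    (hA : 2 ≤ A.card) : ∃ f, ModulePartition C A f ∧ (∃ x ∈ A, ∃ y ∈ A, f x ≠ f y) ∧
      ∀ x ∈ A, ∀ y ∈ A, f x ≠ f y → ∀ p ∈ A, ∀ q ∈ A,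
        Relation.ReflTransGen (PartAdj C (C x y) A f) p q := by
  have hex : ∃ n, ∃ f : V → V, ModulePartition C A f ∧ (∃ x ∈ A, ∃ y ∈ A, f x ≠ f y) ∧
      (A.image f).card = n := by
    refine ⟨_, id, ?_, ?_, rfl⟩
    · rintro x hx x' hx' y hy rfl _
      rfl
    · obtain ⟨x, hx, y, hy, hxy⟩ := Finset.one_lt_card.mp (show 1 < A.card by omega)
      exact ⟨x, hx, y, hy, hxy⟩
  obtain ⟨f, hf, hf2, hfn⟩ := Nat.find_spec hex
  refine ⟨f, hf, hf2, fun x hx y hy hxy p hp q hq => ?_⟩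
  by_contra hpq
  set c := C x y with hc
  -- If the colour `c` were disconnected on the parts, merging the parts in each of its components
  -- would give a coarser module partition that still has two parts.
  let S : Setoid V := ⟨Relation.ReflTransGen (PartAdj C c A f),
    fun _ => .refl, reflTransGen_symm (partAdj_symm hC), fun h h' => h.trans h'⟩
  let g : V → V := fun v => (Quotient.mk S v).out
  have hg : ∀ v w, g v = g w ↔ Relation.ReflTransGen (PartAdj C c A f) v w := by
    intro v w
    constructor
    · intro h
      have : Quotient.mk S v = Quotient.mk S w := Quotient.out_injective h
      exact Quotient.exact this
    · intro h
      exact congrArg Quotient.out (Quotient.sound (s := S) h)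
  have hfg : ∀ v ∈ A, ∀ w ∈ A, f v = f w → g v = g w := fun v hv w hw h =>
    (hg v w).mpr (.single ⟨hv, hw, .inl h⟩)
  have hgm : ModulePartition C A g := by
    intro v hv v' hv' w hw hvv hvw
    have hvv := (hg _ _).mp hvv
    induction hvv with
    | refl => rfl
    | @tail s s' hvs hss ih =>
      rw [ih hss.1 ((hg v s).mpr hvs)]
      have n1 : g s ≠ g w := by rwa [← (hg v s).mpr hvs]
      have n2 : g s' ≠ g w := by rwa [← (hg v s').mpr (hvs.tail hss)]
      have m1 : f s ≠ f w := fun h => n1 (hfg s hss.1 w hw h)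
      have m2 : f s' ≠ f w := fun h => n2 (hfg s' hss.2.1 w hw h)
      rcases hss.2.2 with h | ⟨h, h'⟩
      · exact hf s hss.1 s' hss.2.1 w hw h m1
      · have c1 : C s w ≠ c := fun h => n1 ((hg s w).mpr (.single ⟨hss.1, hw, .inr ⟨m1, h⟩⟩))
        have c2 : C s' w ≠ c := fun h => n2 ((hg s' w).mpr (.single ⟨hss.2.1, hw, .inr ⟨m2, h⟩⟩))
        have := hG s hss.1 s' hss.2.1 w hw (fun e => h (by rw [e])) (fun e => m2 (by rw [e]))
          (fun e => m1 (by rw [e]))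
        grind
  -- The parts of `x` and `y` are joined by `c`, hence merged, so the number of parts drops.
  have hlt : (A.image g).card < (A.image f).card := by
    have himg : A.image g = (A.image f).image (fun v => g (if h : ∃ a ∈ A, f a = v then h.choose
        else v)) := by
      rw [Finset.image_image]
      refine Finset.image_congr fun v hv => ?_
      have h : ∃ a ∈ A, f a = f v := ⟨v, hv, rfl⟩
      simp only [Function.comp_apply, dif_pos h]
      exact hfg v hv _ h.choose_spec.1 h.choose_spec.2.symm
    rw [himg]
    refine lt_of_le_of_ne Finset.card_image_le fun h => hxy ?_
    have hinj := Finset.card_image_iff.mp h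
    refine hinj (Finset.mem_coe.mpr (Finset.mem_image_of_mem f hx))
      (Finset.mem_coe.mpr (Finset.mem_image_of_mem f hy)) ?_
    have h1 : ∃ a ∈ A, f a = f x := ⟨x, hx, rfl⟩
    have h2 : ∃ a ∈ A, f a = f y := ⟨y, hy, rfl⟩
    simp only [dif_pos h1, dif_pos h2]
    rw [hfg _ h1.choose_spec.1 x hx h1.choose_spec.2, hfg _ h2.choose_spec.1 y hy h2.choose_spec.2]
    exact (hg x y).mpr (.single ⟨hx, hy, .inr ⟨hxy, rfl⟩⟩)
  exact Nat.find_min hex (hfn ▸ hlt) ⟨g, hgm, ⟨p, hp, q, hq, fun h => hpq ((hg p q).mp h)⟩, rfl⟩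

theorem ModulePartition.exists_cross_adj {f : V → V}
    (hS : ∀ p ∈ A, ∀ q ∈ A, Relation.ReflTransGen (PartAdj C c A f) p q)
    (hf : ModulePartition C A f) (h2 : ∃ x ∈ A, ∃ y ∈ A, f x ≠ f y) :
    ∀ x ∈ A, ∃ y ∈ A, f x ≠ f y ∧ C x y = c := by
  intro x hx
  have : ∃ y ∈ A, f x ≠ f y := by
    obtain ⟨a, ha, b, hb, hab⟩ := h2
    by_cases h : f x = f a
    · exact ⟨b, hb, by rwa [h]⟩
    · exact ⟨a, ha, h⟩
  obtain ⟨y, hy, hxy⟩ := this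
  have := hS x hx y hy
  revert hx
  induction this using Relation.ReflTransGen.head_induction_on with
  | refl => exact absurd rfl hxy
  | @head p q hpq _ ih =>
    intro hp
    rcases hpq.2.2 with h | h
    · obtain ⟨w, hw, hqw, hc⟩ := ih (by rwa [← h]) hpq.2.1
      refine ⟨w, hw, by rwa [h], ?_⟩
      rw [hf p hp q hpq.2.1 w hw h (by rwa [h])]
      exact hc
    · exact ⟨q, hpq.2.1, h⟩

/-- Vertices of one part are linked through a common neighbour in another part, so connectedness of
the parts lifts to the vertices. -/
theorem ModulePartition.colorConnected (hC : ∀ x y, C x y = C y x) {f : V → V}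
    (hS : ∀ p ∈ A, ∀ q ∈ A, Relation.ReflTransGen (PartAdj C c A f) p q)
    (hf : ModulePartition C A f) (h2 : ∃ x ∈ A, ∃ y ∈ A, f x ≠ f y) : ColorConnected C c A := by
  intro p hp q hq
  have := hS p hp q hq
  induction this with
  | refl => exact .refl
  | @tail s s' _ hss ih =>
    refine (ih hss.1).trans ?_
    rcases hss.2.2 with h | h
    · obtain ⟨w, hw, hsw, hc⟩ := hf.exists_cross_adj hS h2 s hss.1
      refine (Relation.ReflTransGen.single ⟨hss.1, hw, fun e => hsw (by rw [e]), hc⟩).tail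
        ⟨hw, hss.2.1, fun e => hsw (by rw [h, e]), ?_⟩
      rw [hC, ← hf s hss.1 s' hss.2.1 w hw h hsw]
      exact hc
    · exact .single ⟨hss.1, hss.2.1, fun e => h.1 (by rw [e]), h.2⟩

/-- Representatives of the fibres of `f` on `A`. -/
theorem exists_transversal (A : Finset V) (f : V → V) : ∃ g : V → V, (∀ x ∈ A, g x ∈ A) ∧
    (∀ x ∈ A, f (g x) = f x) ∧ ∀ x ∈ A, ∀ y ∈ A, f x = f y → g x = g y := by
  refine ⟨fun x => if h : ∃ a ∈ A, f a = f x then h.choose else x, ?_, ?_, ?_⟩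
  · intro x hx
    have h : ∃ a ∈ A, f a = f x := ⟨x, hx, rfl⟩
    simp only [dif_pos h]
    exact h.choose_spec.1
  · intro x hx
    have h : ∃ a ∈ A, f a = f x := ⟨x, hx, rfl⟩
    simp only [dif_pos h]
    exact h.choose_spec.2
  · intro x _ y hy h
    have h' : ∃ a ∈ A, f a = f y := ⟨y, hy, rfl⟩
    simp only [h, dif_pos h']

/-- Gallai's theorem on colourings without rainbow triangles. -/
theorem gallai_partition (hC : ∀ x y, C x y = C y x) (hG : NoRainbow C A) (hA : 2 ≤ A.card) :
    ∃ f, ModulePartition C A f ∧ (∃ x ∈ A, ∃ y ∈ A, f x ≠ f y) ∧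
      ((∃ r, ∀ x ∈ A, ∀ y ∈ A, f x ≠ f y → C x y = r) ∨
        ∃ r b, r ≠ b ∧ (∀ x ∈ A, ∀ y ∈ A, f x ≠ f y → C x y = r ∨ C x y = b) ∧
          ColorConnected C r A ∧ ColorConnected C b A ∧
          (∀ x ∈ A, ∃ y ∈ A, f x ≠ f y ∧ C x y = r) ∧
          ∀ x ∈ A, ∃ y ∈ A, f x ≠ f y ∧ C x y = b) := by
  obtain ⟨f, hf, h2, hS⟩ := exists_minimal_modulePartition hC hG hA
  refine ⟨f, hf, h2, ?_⟩
  obtain ⟨x, hx, y, hy, hxy⟩ := h2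
  by_cases h : ∀ z ∈ A, ∀ w ∈ A, f z ≠ f w → C z w = C x y
  · exact .inl ⟨_, h⟩
  push Not at h
  obtain ⟨z, hz, w, hw, hzw, hne⟩ := h
  have h2 : ∃ x ∈ A, ∃ y ∈ A, f x ≠ f y := ⟨x, hx, y, hy, hxy⟩
  refine .inr ⟨C x y, C z w, hne.symm, ?_, hf.colorConnected hC (hS x hx y hy hxy) h2,
    hf.colorConnected hC (hS z hz w hw hzw) h2, hf.exists_cross_adj (hS x hx y hy hxy) h2,
    hf.exists_cross_adj (hS z hz w hw hzw) h2⟩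
  intro p hp q hq hpq
  by_contra hcon
  push Not at hcon
  obtain ⟨g, hgA, hgf, hg⟩ := exists_transversal A f
  set T := A.image g with hT
  have hTA : T ⊆ A := by
    intro v hv
    obtain ⟨a, ha, rfl⟩ := Finset.mem_image.mp hv
    exact hgA a ha
  have hgT : ∀ v ∈ T, g v = v := by
    intro v hv
    obtain ⟨a, ha, rfl⟩ := Finset.mem_image.mp hv
    exact hg _ (hgA a ha) _ ha (hgf a ha)
  -- On one representative per part, each colour occurring between parts is connected, and three
  -- such colours are impossible.
  have conn : ∀ a ∈ A, ∀ b ∈ A, f a ≠ f b → ColorConnected C (C a b) T := by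
    intro a ha b hb hab v hv v' hv'
    have key : ∀ s s', Relation.ReflTransGen (PartAdj C (C a b) A f) s s' →
        Relation.ReflTransGen (ColorAdj C (C a b) T) (g s) (g s') := by
      intro s s' h
      induction h with
      | refl => exact .refl
      | @tail t t' _ htt ih =>
        rcases htt.2.2 with h | h
        · rwa [← hg t htt.1 t' htt.2.1 h]
        · refine ih.tail ⟨Finset.mem_image_of_mem g htt.1, Finset.mem_image_of_mem g htt.2.1, ?_, ?_⟩
          · intro e
            apply h.1
            rw [← hgf t htt.1, e, hgf t' htt.2.1]
          · rw [← h.2]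
            exact hf.color_eq hC (hgA t htt.1) htt.1 (hgA t' htt.2.1) htt.2.1 (hgf t htt.1)
              (hgf t' htt.2.1) (by rw [hgf t htt.1, hgf t' htt.2.1]; exact h.1)
    have := key v v' (hS a ha b hb hab v (hTA hv) v' (hTA hv'))
    rwa [hgT v hv, hgT v' hv'] at this
  have hTcard : 2 ≤ T.card := by
    refine Finset.one_lt_card.mpr ⟨g x, Finset.mem_image_of_mem g hx, g y,
      Finset.mem_image_of_mem g hy, fun e => hxy ?_⟩
    rw [← hgf x hx, e, hgf y hy]
  exact not_three_connected hC hne hcon.2.symm hcon.1.symm (T.card - 2) T (by omega) (hG.mono hTA)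
    (conn z hz w hw hzw) (conn x hx y hy hxy) (conn p hp q hq hpq)

end

/-! ### Ramsey for triangles, even splittings, depth-first search -/

noncomputable section
open scoped Classical

variable {V κ : Type} {C : V → V → κ} {c : κ} {A : Finset V}

theorem ColorConnected.exists_crossing (h : ColorConnected C c A) {S : Finset V} {p q : V}
    (hpS : p ∈ S) (hqS : q ∉ S) (hp : p ∈ A) (hq : q ∈ A) :
    ∃ a ∈ S, ∃ b, b ∉ S ∧ ColorAdj C c A a b := by
  have := h p hp q hq
  induction this with
  | refl => exact absurd hpS hqS
  | @tail s s' _ hss ih =>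
    by_cases hs : s ∈ S
    · exact ⟨s, hs, s', hqS, hss⟩
    · exact ih hs hss.1

/-- If the graph of colour `c` is disconnected, then that of the other colour is connected. -/
theorem connected_or_connected (hC : ∀ x y, C x y = C y x) {r b : κ}
    (hrb : ∀ x ∈ A, ∀ y ∈ A, x ≠ y → C x y = r ∨ C x y = b) :
    ColorConnected C r A ∨ ColorConnected C b A := by
  by_contra hcon
  push Not at hcon
  obtain ⟨hr, hb⟩ := hcon
  apply hb
  unfold ColorConnected at hr
  push Not at hr
  obtain ⟨p, hp, q, hq, hpq⟩ := hr
  have hcut : ∀ v ∈ A, ∀ w ∈ A, Relation.ReflTransGen (ColorAdj C r A) p v →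
      ¬ Relation.ReflTransGen (ColorAdj C r A) p w → ColorAdj C b A v w := by
    intro v hv w hw h1 h2
    have hvw : v ≠ w := by rintro rfl; exact h2 h1
    refine ⟨hv, hw, hvw, (hrb v hv w hw hvw).resolve_left fun h => h2 (h1.tail ⟨hv, hw, hvw, h⟩)⟩
  have hsymm := colorAdj_symm (c := b) (A := A) hC
  have hpq' := hcut p hp q hq .refl hpq
  have key : ∀ v ∈ A, Relation.ReflTransGen (ColorAdj C b A) p v := by
    intro v hv
    by_cases h : Relation.ReflTransGen (ColorAdj C r A) p v
    · exact (Relation.ReflTransGen.single hpq').tail (hsymm _ _ (hcut v hv q hq h hpq))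
    · exact .single (hcut p hp v hv .refl h)
  exact fun v hv w hw => (reflTransGen_symm hsymm (key v hv)).trans (key w hw)

/-- The Ramsey number of two triangles is at most six. -/
theorem exists_mono_triangle_of_card {r b : κ} (hA : 6 ≤ A.card)
    (hrb : ∀ x ∈ A, ∀ y ∈ A, x ≠ y → C x y = r ∨ C x y = b) :
    ∃ x ∈ A, ∃ y ∈ A, ∃ z ∈ A, x ≠ y ∧ x ≠ z ∧ y ≠ z ∧
      ((C x y = r ∧ C x z = r ∧ C y z = r) ∨ (C x y = b ∧ C x z = b ∧ C y z = b)) := by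
  obtain ⟨v, hv⟩ := Finset.card_pos.mp (show 0 < A.card by omega)
  have key : ∀ r b : κ, (∀ x ∈ A, ∀ y ∈ A, x ≠ y → C x y = r ∨ C x y = b) →
      3 ≤ ((A.erase v).filter fun w => C v w = r).card →
      ∃ x ∈ A, ∃ y ∈ A, ∃ z ∈ A, x ≠ y ∧ x ≠ z ∧ y ≠ z ∧
        ((C x y = r ∧ C x z = r ∧ C y z = r) ∨ (C x y = b ∧ C x z = b ∧ C y z = b)) := by
    intro r b hrb h
    obtain ⟨T, hT, hT3⟩ := Finset.exists_subset_card_eq h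
    obtain ⟨x, y, z, hxy, hxz, hyz, rfl⟩ := Finset.card_eq_three.mp hT3
    have h1 := hT (show x ∈ _ by simp)
    have h2 := hT (show y ∈ _ by simp)
    have h3 := hT (show z ∈ _ by simp)
    simp only [Finset.mem_filter, Finset.mem_erase] at h1 h2 h3
    by_cases c1 : C x y = r
    · exact ⟨v, hv, x, h1.1.2, y, h2.1.2, h1.1.1.symm, h2.1.1.symm, hxy, .inl ⟨h1.2, h2.2, c1⟩⟩
    by_cases c2 : C x z = r
    · exact ⟨v, hv, x, h1.1.2, z, h3.1.2, h1.1.1.symm, h3.1.1.symm, hxz, .inl ⟨h1.2, h3.2, c2⟩⟩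
    by_cases c3 : C y z = r
    · exact ⟨v, hv, y, h2.1.2, z, h3.1.2, h2.1.1.symm, h3.1.1.symm, hyz, .inl ⟨h2.2, h3.2, c3⟩⟩
    exact ⟨x, h1.1.2, y, h2.1.2, z, h3.1.2, hxy, hxz, hyz, .inr
      ⟨(hrb x h1.1.2 y h2.1.2 hxy).resolve_left c1, (hrb x h1.1.2 z h3.1.2 hxz).resolve_left c2,
        (hrb y h2.1.2 z h3.1.2 hyz).resolve_left c3⟩⟩
  have hunion : A.erase v ⊆ ((A.erase v).filter fun w => C v w = r) ∪
      (A.erase v).filter fun w => C v w = b := by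
    intro w hw
    have := hrb v hv w (Finset.mem_of_mem_erase hw) (Finset.ne_of_mem_erase hw).symm
    simp only [Finset.mem_union, Finset.mem_filter]
    tauto
  have h1 := (Finset.card_le_card hunion).trans (Finset.card_union_le _ _)
  rw [Finset.card_erase_of_mem hv] at h1
  by_cases h : 3 ≤ ((A.erase v).filter fun w => C v w = r).card
  · exact key r b hrb h
  · obtain ⟨x, hx, y, hy, z, hz, h1, h2, h3, h4⟩ := key b r
      (fun x hx y hy hxy => (hrb x hx y hy hxy).symm) (by omega)
    exact ⟨x, hx, y, hy, z, hz, h1, h2, h3, h4.symm⟩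

theorem exists_mono_triangle_of_parts {r b : κ} {f : V → V}
    (hrb : ∀ x ∈ A, ∀ y ∈ A, f x ≠ f y → C x y = r ∨ C x y = b) (hf : 6 ≤ (A.image f).card) :
    ∃ x ∈ A, ∃ y ∈ A, ∃ z ∈ A, x ≠ y ∧ x ≠ z ∧ y ≠ z ∧
      ((C x y = r ∧ C x z = r ∧ C y z = r) ∨ (C x y = b ∧ C x z = b ∧ C y z = b)) := by
  obtain ⟨g, hgA, hgf, hg⟩ := exists_transversal A f
  have hsub : A.image g ⊆ A := Finset.image_subset_iff.mpr hgA
  have himg : A.image f = (A.image g).image f := by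
    rw [Finset.image_image]
    exact Finset.image_congr fun v hv => (hgf v hv).symm
  have hcard : 6 ≤ (A.image g).card := by
    rw [himg] at hf
    exact hf.trans Finset.card_image_le
  obtain ⟨x, hx, y, hy, z, hz, h⟩ := exists_mono_triangle_of_card (A := A.image g) hcard
    (r := r) (b := b) (by
      intro x hx y hy hxy
      refine hrb x (hsub hx) y (hsub hy) fun e => hxy ?_
      obtain ⟨a, ha, rfl⟩ := Finset.mem_image.mp hx
      obtain ⟨d, hd, rfl⟩ := Finset.mem_image.mp hy
      exact hg a ha d hd (by rw [← hgf a ha, e, hgf d hd]))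
  exact ⟨x, hsub hx, y, hsub hy, z, hsub hz, h⟩

/-- A set that is partitioned into small parts splits evenly along the partition. -/
theorem exists_split_of_small_parts {N : Finset V} {f : V → V} {s : ℕ}
    (hs : ∀ v, (N.filter fun w => f w = v).card ≤ s) (hN : 3 * s + 1 ≤ N.card) :
    ∃ X Y : Finset V, X ⊆ N ∧ Y ⊆ N ∧ s + 1 ≤ X.card ∧ s + 1 ≤ Y.card ∧
      ∀ x ∈ X, ∀ y ∈ Y, f x ≠ f y := by
  -- Parts are added one at a time. The first union exceeding `s` has at most `2 * s` vertices, and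
  -- so leaves at least `s + 1`.
  have key : ∀ Q : Finset V, (N.filter fun w => f w ∈ Q).card ≤ s ∨
      ∃ P : Finset V, s + 1 ≤ (N.filter fun w => f w ∈ P).card ∧
        (N.filter fun w => f w ∈ P).card ≤ 2 * s := by
    intro Q
    induction Q using Finset.induction_on with
    | empty => simp
    | insert v Q _ ih =>
      rcases ih with ih | ih
      · have : (N.filter fun w => f w ∈ insert v Q) ⊆
            (N.filter fun w => f w = v) ∪ N.filter fun w => f w ∈ Q := by
          intro w
          simp only [Finset.mem_filter, Finset.mem_union, Finset.mem_insert]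
          tauto
        have h1 := (Finset.card_le_card this).trans (Finset.card_union_le _ _)
        have h2 := hs v
        by_cases h : (N.filter fun w => f w ∈ insert v Q).card ≤ s
        · exact .inl h
        · exact .inr ⟨insert v Q, by omega, by omega⟩
      · exact .inr ih
  rcases key (N.image f) with h | ⟨P, h1, h2⟩
  · rw [Finset.filter_true_of_mem fun w hw => Finset.mem_image_of_mem f hw] at h
    omega
  · have h3 := Finset.card_filter_add_card_filter_not (s := N) (fun w => f w ∈ P)
    refine ⟨_, _, Finset.filter_subset (fun w => f w ∈ P) N,
      Finset.filter_subset (fun w => ¬ f w ∈ P) N, h1, by omega, ?_⟩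
    intro x hx y hy e
    rw [Finset.mem_filter] at hx hy
    exact hy.2 (e ▸ hx.2)

/-- One move of the search: visit an unvisited neighbour of the free end, or retire the free end. A
bare triangle is never retired: by connectedness some `c`-edge enters `U`, it cannot start in `D`,
so it starts in the triangle, which may be reordered to make that vertex the free end. -/
theorem TailList.exists_step (hC : ∀ x y, C x y = C y x) (hconn : ColorConnected C c A)
    {L : List V} (hL : TailList C c A L) {D U : Finset V} (hDU : Disjoint D U)
    (hLD : Disjoint L.toFinset D) (hLU : Disjoint L.toFinset U) (hA : L.toFinset ∪ D ∪ U = A)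
    (hsep : ∀ d ∈ D, ∀ w ∈ U, C d w ≠ c) (hU : U.Nonempty) :
    (∃ w ∈ U, ∃ L', TailList C c A (w :: L') ∧ L'.toFinset = L.toFinset ∧ L'.length = L.length) ∨
      ∃ w L', L = w :: L' ∧ TailList C c A L' ∧ ∀ v ∈ U, C w v ≠ c := by
  have hUA : U ⊆ A := hA ▸ Finset.subset_union_right
  have hpush : ∀ w l, TailList C c A (w :: l) → (w :: l).toFinset = L.toFinset →
      (w :: l).length = L.length → (∃ v ∈ U, C w v = c) →
      ∃ w ∈ U, ∃ L', TailList C c A (w :: L') ∧ L'.toFinset = L.toFinset ∧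
        L'.length = L.length := by
    rintro w l hl h1 h2 ⟨v, hv, hwv⟩
    refine ⟨v, hv, w :: l, .cons hl (hUA hv) ?_ (by rw [hC]; exact hwv), h1, h2⟩
    intro hvl
    rw [← List.mem_toFinset, h1] at hvl
    exact Finset.disjoint_left.mp hLU hvl hv
  cases hL with
  | @cons w w' l hl hw' hmem hc =>
    by_cases h : ∃ v ∈ U, C w' v = c
    · exact .inl (hpush w' _ (.cons hl hw' hmem hc) rfl rfl h)
    · push Not at h
      exact .inr ⟨w', _, rfl, hl, h⟩
  | @tri x y z hx hy hz hxy hxz hyz cxy cxz cyz =>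
    left
    obtain ⟨q, hq⟩ := hU
    have hqn : q ∉ [z, y, x].toFinset ∪ D := by
      intro h
      rcases Finset.mem_union.mp h with h | h
      · exact Finset.disjoint_left.mp hLU h hq
      · exact Finset.disjoint_left.mp hDU h hq
    obtain ⟨a, ha, b, hb, hab⟩ := hconn.exists_crossing (S := [z, y, x].toFinset ∪ D) (p := x)
      (by simp) hqn hx (hUA hq)
    have hbU : b ∈ U := by
      have := hab.2.1
      rw [← hA] at this
      exact (Finset.mem_union.mp this).resolve_left hb
    rcases Finset.mem_union.mp ha with ha | ha
    · simp only [List.toFinset_cons, List.toFinset_nil, Finset.mem_insert,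
        Finset.notMem_empty, or_false] at ha
      rcases ha with rfl | rfl | rfl
      · exact hpush a _ (.tri hx hy hz hxy hxz hyz cxy cxz cyz) rfl rfl ⟨b, hbU, hab.2.2.2⟩
      · exact hpush a _ (.tri hx hz hy hxz hxy hyz.symm cxz cxy (by rw [hC]; exact cyz))
          (by ext; simp; tauto) rfl ⟨b, hbU, hab.2.2.2⟩
      · exact hpush a _ (.tri hz hy hx hyz.symm hxz.symm hxy.symm (by rw [hC]; exact cyz)
          (by rw [hC]; exact cxz) (by rw [hC]; exact cxy))
          (by ext; simp; tauto) rfl ⟨b, hbU, hab.2.2.2⟩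
    · exact absurd hab.2.2.2 (hsep a ha b hbU)

/-- Depth-first search from a triangle of colour `c`, with `D` the finished and `U` the unvisited
vertices: a property `Φ` that holds at the beginning and fails at the end is lost in some step. -/
theorem exists_search_step (hC : ∀ x y, C x y = C y x) (hconn : ColorConnected C c A) {u : ℕ}
    (hu : ¬ TriTail C c A (u + 1)) (Φ : Finset V → Finset V → Prop)
    (hend : ∀ D, A.card ≤ D.card + u → ¬ Φ D ∅) (n : ℕ) :
    ∀ (L : List V) (D U : Finset V), TailList C c A L → Disjoint D U → Disjoint L.toFinset D →
      Disjoint L.toFinset U → L.toFinset ∪ D ∪ U = A → (∀ d ∈ D, ∀ w ∈ U, C d w ≠ c) →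
      2 * U.card + L.length ≤ n → Φ D U →
      ∃ D U w, D ⊆ A ∧ U ⊆ A ∧ w ∈ A ∧ w ∉ D ∧ Disjoint D U ∧ Φ D U ∧
        ((w ∉ U ∧ ¬ Φ (insert w D) U ∧ A.card + 1 ≤ (insert w D).card + U.card + u ∧
            ∀ d ∈ insert w D, ∀ v ∈ U, C d v ≠ c) ∨
          (w ∈ U ∧ ¬ Φ D (U.erase w) ∧ A.card ≤ D.card + (U.erase w).card + u ∧
            ∀ d ∈ D, ∀ v ∈ U.erase w, C d v ≠ c)) := by
  have hlen : ∀ L, TailList C c A L → L.length ≤ u := by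
    intro L hL
    by_contra h
    exact hu ((hL.triTail hC).mono subset_rfl (by omega))
  have hcardA : ∀ (L : List V) (D U : Finset V), TailList C c A L → Disjoint D U →
      Disjoint L.toFinset D → Disjoint L.toFinset U → L.toFinset ∪ D ∪ U = A →
      A.card = L.length + D.card + U.card := by
    intro L D U hL hDU hLD hLU hA
    rw [← hA, Finset.card_union_of_disjoint (Finset.disjoint_union_left.mpr ⟨hLU, hDU⟩),
      Finset.card_union_of_disjoint hLD, List.toFinset_card_of_nodup hL.nodup]
  -- The measure drops in both moves: a visit lowers `2 * U.card` by two and lengthens the stack by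
  -- one, a retirement shortens the stack by one.
  induction n with
  | zero =>
    intro L D U hL _ _ _ _ _ h
    have := hL.three_le
    omega
  | succ n ih =>
    intro L D U hL hDU hLD hLU hA hsep hn hΦ
    have hcard := hcardA L D U hL hDU hLD hLU hA
    have hDA : D ⊆ A := by rw [← hA]; intro v hv; simp [hv]
    have hUA : U ⊆ A := by rw [← hA]; intro v hv; simp [hv]
    rcases U.eq_empty_or_nonempty with rfl | hU
    · have := hlen L hL
      exact absurd hΦ (hend D (by simp at hcard; omega))
    rcases hL.exists_step hC hconn hDU hLD hLU hA hsep hU with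
      ⟨w, hw, L', hL', hLL, hll⟩ | ⟨w, L', rfl, hL', hw⟩
    · have hwU := Finset.card_erase_of_mem hw
      have hUpos := Finset.card_pos.mpr hU
      have hwD : w ∉ D := fun h => Finset.disjoint_left.mp hDU h hw
      have hsep' : ∀ d ∈ D, ∀ v ∈ U.erase w, C d v ≠ c :=
        fun d hd v hv => hsep d hd v (Finset.mem_of_mem_erase hv)
      have h1 := hlen _ hL'
      simp only [List.length_cons] at h1
      by_cases hΦ' : Φ D (U.erase w)
      · refine ih (w :: L') D (U.erase w) hL'
          (Finset.disjoint_of_subset_right (Finset.erase_subset _ _) hDU) ?_ ?_ ?_ hsep' ?_ hΦ'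
        · rw [List.toFinset_cons, hLL, Finset.disjoint_insert_left]
          exact ⟨hwD, hLD⟩
        · rw [List.toFinset_cons, hLL, Finset.disjoint_insert_left]
          exact ⟨by simp, Finset.disjoint_of_subset_right (Finset.erase_subset _ _) hLU⟩
        · rw [← hA, List.toFinset_cons, hLL]
          ext v
          simp only [Finset.mem_union, Finset.mem_insert, Finset.mem_erase]
          by_cases hv : v = w
          · simp [hv, hw]
          · simp [hv]
        · simp only [List.length_cons]
          omega
      · exact ⟨D, U, w, hDA, hUA, hUA hw, hwD, hDU, hΦ, .inr ⟨hw, hΦ', by omega, hsep'⟩⟩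
    · have hwA : w ∈ A := by rw [← hA]; simp
      have hwD : w ∉ D := fun h => Finset.disjoint_left.mp hLD (by simp) h
      have hwU : w ∉ U := fun h => Finset.disjoint_left.mp hLU (by simp) h
      have hwL : w ∉ L' := (List.nodup_cons.mp hL.nodup).1
      have hsep' : ∀ d ∈ insert w D, ∀ v ∈ U, C d v ≠ c := by
        intro d hd v hv
        rcases Finset.mem_insert.mp hd with rfl | hd
        · exact hw v hv
        · exact hsep d hd v hv
      have hcD := Finset.card_insert_of_notMem hwD
      have h1 := hlen _ hL
      simp only [List.length_cons] at h1 hcard hn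
      by_cases hΦ' : Φ (insert w D) U
      · rw [List.toFinset_cons] at hLD hLU hA
        rw [Finset.disjoint_insert_left] at hLD hLU
        refine ih L' (insert w D) U hL' (by rw [Finset.disjoint_insert_left]; exact ⟨hwU, hDU⟩) ?_
          hLU.2 ?_ hsep' (by omega) hΦ'
        · rw [Finset.disjoint_insert_right]
          exact ⟨by simpa, hLD.2⟩
        · rw [← hA]
          ext v
          simp only [Finset.mem_union, Finset.mem_insert]
          tauto
      · exact ⟨D, U, w, hDA, hUA, hwA, hwD, hDU, hΦ, .inl ⟨hwU, hΦ', by omega, hsep'⟩⟩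

end

/-! ### Two colours, on vertices or between small parts -/

noncomputable section
open scoped Classical

variable {V κ : Type} {C : V → V → κ} {c : κ} {A : Finset V}

/-- Some vertex of `A` lies in a triangle of colour `c` inside `W`. -/
def MeetsTriangle (C : V → V → κ) (c : κ) (W A : Finset V) : Prop :=
  ∃ x ∈ A, ∃ y ∈ W, ∃ z ∈ W, x ≠ y ∧ x ≠ z ∧ y ≠ z ∧ C x y = c ∧ C x z = c ∧ C y z = c

theorem MeetsTriangle.tailList (h : MeetsTriangle C c A A) :
    ∃ L, TailList C c A L ∧ L.length = 3 := by
  obtain ⟨x, hx, y, hy, z, hz, hxy, hxz, hyz, cxy, cxz, cyz⟩ := h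
  exact ⟨_, .tri hx hy hz hxy hxz hyz cxy cxz cyz, rfl⟩

/-- The form in which the bipartite construction is used from here on: a large complete pair in a
connected colour excludes all triangles of that colour touching `A`, even those with two vertices
outside `A`. -/
theorem Good.not_meetsTriangle {K : Finset κ} {W : Finset V} {t s : ℕ} (h : Good C K W t)
    (hs : 1 ≤ s) (hst : t ≤ 2 * s + 2) (hA : A ⊆ W) (hconn : ColorConnected C c A) {X Y : Finset V}
    (hXA : X ⊆ A) (hYA : Y ⊆ A) (hd : Disjoint X Y) (hXY : Complete C c X Y)
    (hX : s + 1 ≤ X.card) (hY : s + 1 ≤ Y.card) : ¬ MeetsTriangle C c W A := by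
  rintro ⟨x, hx, y, hy, z, hz, hxy, hxz, hyz, cxy, cxz, cyz⟩
  obtain ⟨k, hk⟩ := Finset.card_pos.mp (show 0 < X.card by omega)
  have hr : Relation.ReflTransGen (ColorAdj C c W) x k :=
    Relation.ReflTransGen.lift (p := ColorAdj C c W) id (fun a b hab => ⟨hA hab.1, hA hab.2.1, hab.2.2⟩)
      x k (hconn x hx k (hXA hk))
  refine h.free c ((triTail_of_complete_of_triangle h.symm hd hXY (hXA.trans hA) (hYA.trans hA) hs
    hX hY hy hz hyz hxy.symm hxz.symm cyz ?_ ?_ (Finset.mem_union_left _ hk) hr).mono subset_rfl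
    hst)
  · rw [h.symm]; exact cxy
  · rw [h.symm]; exact cxz

/-- Stop the search when `D` reaches `s + 1` vertices. The stack then has fewer than `u`, so at
least `u + 1 - s ≥ s + 1` vertices are unvisited, and all pairs between `D` and `U` have colour `b`.
-/
theorem exists_complete_of_two_colors (hC : ∀ x y, C x y = C y x) {r b : κ} {u s : ℕ}
    (hsu : 2 * s ≤ u) (hA : 2 * u + 1 ≤ A.card) (hconn : ColorConnected C r A)
    (hu : ¬ TriTail C r A (u + 1)) (hrb : ∀ x ∈ A, ∀ y ∈ A, x ≠ y → C x y = r ∨ C x y = b)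
    (ht : MeetsTriangle C r A A) :
    ∃ X Y : Finset V, X ⊆ A ∧ Y ⊆ A ∧ Disjoint X Y ∧ Complete C b X Y ∧ s + 1 ≤ X.card ∧
      s + 1 ≤ Y.card := by
  obtain ⟨L, hL, -⟩ := ht.tailList
  have hLA : L.toFinset ⊆ A := fun v hv => hL.mem v (List.mem_toFinset.mp hv)
  obtain ⟨D, U, w, hDA, hUA, hw, hwD, hDU, hΦ, h | h⟩ := exists_search_step hC hconn hu
    (fun D _ => D.card ≤ s) (fun D hD => by omega) _ L ∅ (A \ L.toFinset) hL (by simp) (by simp)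
    Finset.disjoint_sdiff (by simpa using hLA) (by simp) le_rfl (by simp)
  · have hcD := Finset.card_insert_of_notMem hwD
    have hd : Disjoint (insert w D) U := by rw [Finset.disjoint_insert_left]; exact ⟨h.1, hDU⟩
    have hDA' : insert w D ⊆ A := Finset.insert_subset hw hDA
    have h2 := h.2.1
    refine ⟨insert w D, U, hDA', hUA, hd, ?_, by omega, by omega⟩
    intro x hx y hy
    have hxy : x ≠ y := fun e => Finset.disjoint_left.mp hd hx (e ▸ hy)
    exact (hrb x (hDA' hx) y (hUA hy) hxy).resolve_left (h.2.2.2 x hx y hy)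
  · exact absurd hΦ h.2.1

/-- A vertex of `r`-degree below `u` has at least `u + 1` neighbours in colour `b`. If it lies in no
`b`-triangle, they form a complete graph of colour `r` on more than `u` vertices. Hence all
`r`-degrees are at least `u`, and the tail grows greedily. -/
theorem Good.false_of_degree_or {r b : κ} {K : Finset κ} {u : ℕ} (h : Good C K A (u + 1))
    (hu : 3 ≤ u) (hA : 2 * u + 1 ≤ A.card)
    (hrb : ∀ x ∈ A, ∀ y ∈ A, x ≠ y → C x y = r ∨ C x y = b) (ht : MeetsTriangle C r A A)
    (hdeg : ∀ v ∈ A, u ≤ (A.filter fun w => w ≠ v ∧ C v w = r).card ∨ ¬ MeetsTriangle C b A {v}) :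
    False := by
  obtain ⟨x, hx, y, hy, z, hz, hxy, hxz, hyz, cxy, cxz, cyz⟩ := ht
  refine h.free r (triTail_of_degree hx hy hz hxy hxz hyz cxy cxz cyz h.symm (by omega) ?_)
  intro v hv
  by_contra hlt
  have hn := (hdeg v hv).resolve_left hlt
  set N := A.filter fun w => w ≠ v ∧ C v w = b with hN
  have hNA : N ⊆ A := Finset.filter_subset _ _
  have hsub : A.erase v ⊆ (A.filter fun w => w ≠ v ∧ C v w = r) ∪ N := by
    intro w hw
    have := hrb v hv w (Finset.mem_of_mem_erase hw) (Finset.ne_of_mem_erase hw).symm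
    rw [Finset.mem_erase] at hw
    simp only [Finset.mem_union, hN, Finset.mem_filter]
    tauto
  have h1 := (Finset.card_le_card hsub).trans (Finset.card_union_le _ _)
  rw [Finset.card_erase_of_mem hv] at h1
  have hN1 : u + 1 ≤ N.card := by omega
  have hr : ∀ x ∈ N, ∀ y ∈ N, x ≠ y → C x y = r := by
    intro x hx y hy hxy
    refine (hrb x (hNA hx) y (hNA hy) hxy).resolve_right fun hb => hn ?_
    rw [hN, Finset.mem_filter] at hx hy
    exact ⟨v, by simp, x, hx.1, y, hy.1, hx.2.1.symm, hy.2.1.symm, hxy, hx.2.2, hy.2.2, hb⟩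
  obtain ⟨T, hT, hT3⟩ := Finset.exists_subset_card_eq (show 3 ≤ N.card by omega)
  obtain ⟨x, y, z, hxy, hxz, hyz, rfl⟩ := Finset.card_eq_three.mp hT3
  have hx := hT (show x ∈ _ by simp)
  have hy := hT (show y ∈ _ by simp)
  have hz := hT (show z ∈ _ by simp)
  refine h.free r ((triTail_of_degree hx hy hz hxy hxz hyz (hr x hx y hy hxy) (hr x hx z hz hxz)
    (hr y hy z hz hyz) h.symm (u := u) (by omega) ?_).mono hNA le_rfl)
  intro w hw
  have : N.erase w ⊆ N.filter fun a => a ≠ w ∧ C w a = r := by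
    intro a ha
    rw [Finset.mem_erase] at ha
    exact Finset.mem_filter.mpr ⟨ha.2, ha.1, hr w hw a ha.2 ha.1.symm⟩
  have := Finset.card_le_card this
  rw [Finset.card_erase_of_mem hw] at this
  omega

/-- When `r` is connected and has a triangle, the search gives a large complete pair in `b`. A
vertex joined to it by a `b`-path lies in no `b`-triangle; any other vertex sends `r` to the whole
pair and has `r`-degree at least `2 * s + 2`. So the degree criterion applies. One of the two
colours is connected, and if only one colour has triangles the criterion applies at once. -/
theorem Good.card_le_of_two_colors {K : Finset κ} {u s : ℕ} (h : Good C K A (u + 1)) (hu : 3 ≤ u)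
    (hs : 1 ≤ s) (hsu : 2 * s ≤ u) (hus : u ≤ 2 * s + 1) {r b : κ}
    (hrb : ∀ x ∈ A, ∀ y ∈ A, x ≠ y → C x y = r ∨ C x y = b) : A.card ≤ 2 * u := by
  by_contra hA
  have hbr : ∀ x ∈ A, ∀ y ∈ A, x ≠ y → C x y = b ∨ C x y = r :=
    fun x hx y hy hxy => (hrb x hx y hy hxy).symm
  have hsing : ∀ {c : κ} {v : V}, v ∈ A → MeetsTriangle C c A {v} → MeetsTriangle C c A A := by
    rintro c v hv ⟨x, hx, h⟩
    rw [Finset.mem_singleton] at hx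
    exact ⟨x, hx ▸ hv, h⟩
  have key : ∀ r b : κ, (∀ x ∈ A, ∀ y ∈ A, x ≠ y → C x y = r ∨ C x y = b) →
      MeetsTriangle C r A A → ColorConnected C r A → False := by
    intro r b hrb ht hconn
    obtain ⟨X, Y, hXA, hYA, hd, hXY, hX, hY⟩ := exists_complete_of_two_colors h.symm hsu
      (by omega) hconn (h.free r) hrb ht
    refine h.false_of_degree_or hu (by omega) hrb ht fun v hv => ?_
    by_cases hv' : ∃ k ∈ X ∪ Y, Relation.ReflTransGen (ColorAdj C b A) v k
    · right
      rintro ⟨x, hx, y, hy, z, hz, hxy, hxz, hyz, cxy, cxz, cyz⟩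
      rw [Finset.mem_singleton] at hx
      obtain ⟨k, hk, hr⟩ := hv'
      rw [← hx] at hr
      exact h.free b ((triTail_of_complete_of_triangle h.symm hd hXY hXA hYA hs
        hX hY hy hz hyz hxy.symm hxz.symm cyz (by rw [h.symm]; exact cxy)
        (by rw [h.symm]; exact cxz) hk hr).mono subset_rfl (by omega))
    · left
      push Not at hv'
      have hsub : X ∪ Y ⊆ A.filter fun w => w ≠ v ∧ C v w = r := by
        intro w hw
        have hwA := Finset.union_subset hXA hYA hw
        have hwv : w ≠ v := by rintro rfl; exact hv' w hw .refl
        exact Finset.mem_filter.mpr ⟨hwA, hwv, (hrb v hv w hwA hwv.symm).resolve_right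
          fun hc => hv' w hw (.single ⟨hv, hwA, hwv.symm, hc⟩)⟩
      have := Finset.card_le_card hsub
      rw [Finset.card_union_of_disjoint hd] at this
      omega
  have h6 : MeetsTriangle C r A A ∨ MeetsTriangle C b A A := by
    obtain ⟨x, hx, y, hy, z, hz, hxy, hxz, hyz, h1 | h1⟩ :=
      exists_mono_triangle_of_card (A := A) (by omega) hrb
    · exact .inl ⟨x, hx, y, hy, z, hz, hxy, hxz, hyz, h1⟩
    · exact .inr ⟨x, hx, y, hy, z, hz, hxy, hxz, hyz, h1⟩
  by_cases hr : MeetsTriangle C r A A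
  · by_cases hb : MeetsTriangle C b A A
    · rcases connected_or_connected h.symm hrb with hc | hc
      · exact key r b hrb hr hc
      · exact key b r hbr hb hc
    · exact h.false_of_degree_or hu (by omega) hrb hr fun v hv => .inr fun h => hb (hsing hv h)
  · exact h.false_of_degree_or hu (by omega) hbr (h6.resolve_left hr)
      fun v hv => .inr fun h => hr (hsing hv h)

theorem card_filter_eq_sum_parts {D : Finset V} (hD : D ⊆ A) (f : V → V) (P : V → Prop) [DecidablePred P] :
    (D.filter fun x => P (f x)).card =
      ∑ v ∈ A.image f, if P v then (D.filter fun x => f x = v).card else 0 := by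
  rw [Finset.card_eq_sum_card_fiberwise (f := f) (t := A.image f)]
  · refine Finset.sum_congr rfl fun v _ => ?_
    rw [Finset.filter_filter]
    split_ifs with h
    · congr 1
      ext x
      simp only [Finset.mem_filter, and_congr_right_iff]
      intro _
      constructor
      · exact fun h => h.2
      · rintro rfl; exact ⟨h, rfl⟩
    · rw [Finset.card_eq_zero, Finset.filter_eq_empty_iff]
      rintro x _ ⟨h1, rfl⟩
      exact h h1
  · intro x hx
    exact Finset.mem_coe.mpr (Finset.mem_image_of_mem f (hD (Finset.filter_subset _ _ hx)))

/-- The vertices of `D` in the fibres of `f` that meet `D` at least as much as `U`. -/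
def heavyPart (f : V → V) (D U : Finset V) : Finset V :=
  D.filter fun x => (U.filter fun y => f y = f x).card ≤ (D.filter fun y => f y = f x).card

/-- The vertices of `U` in the fibres of `f` that meet `D` less than `U`. -/
def lightPart (f : V → V) (D U : Finset V) : Finset V :=
  U.filter fun x => ¬ (U.filter fun y => f y = f x).card ≤ (D.filter fun y => f y = f x).card

/-- Each fibre contributes the larger of its two intersections with `D` and `U`, hence at least half
of their sum. -/
theorem card_le_heavyPart_add_lightPart {D U : Finset V} (hD : D ⊆ A) (hU : U ⊆ A) (f : V → V) :
    D.card + U.card ≤ 2 * ((heavyPart f D U).card + (lightPart f D U).card) := by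
  have h1 := card_filter_eq_sum_parts hD f fun v =>
    (U.filter fun y => f y = v).card ≤ (D.filter fun y => f y = v).card
  have h2 := card_filter_eq_sum_parts hU f fun v =>
    ¬ (U.filter fun y => f y = v).card ≤ (D.filter fun y => f y = v).card
  have h3 := card_filter_eq_sum_parts hD f fun _ => True
  have h4 := card_filter_eq_sum_parts hU f fun _ => True
  simp only [Finset.filter_true, if_true] at h3 h4
  rw [heavyPart, lightPart, h1, h2, h3, h4, ← Finset.sum_add_distrib, ← Finset.sum_add_distrib,
    Finset.mul_sum]
  refine Finset.sum_le_sum fun v _ => ?_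
  split_ifs <;> omega

/-- A search move affects only the fibre of `w`, so the change of the heavy part is the change of
that single contribution. -/
theorem heavyPart_step {D U D' U' : Finset V} (hD : D ⊆ A) (hD' : D' ⊆ A) {f : V → V} {w : V}
    (hw : w ∈ A)
    (hDD : ∀ v, v ≠ f w → (D'.filter fun y => f y = v) = D.filter fun y => f y = v)
    (hUU : ∀ v, v ≠ f w → (U'.filter fun y => f y = v) = U.filter fun y => f y = v) :
    (heavyPart f D' U').card +
        (if (U.filter fun y => f y = f w).card ≤ (D.filter fun y => f y = f w).card then
          (D.filter fun y => f y = f w).card else 0) =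
      (heavyPart f D U).card +
        if (U'.filter fun y => f y = f w).card ≤ (D'.filter fun y => f y = f w).card then
          (D'.filter fun y => f y = f w).card else 0 := by
  have h1 := card_filter_eq_sum_parts hD f fun v =>
    (U.filter fun y => f y = v).card ≤ (D.filter fun y => f y = v).card
  have h2 := card_filter_eq_sum_parts hD' f fun v =>
    (U'.filter fun y => f y = v).card ≤ (D'.filter fun y => f y = v).card
  have hmem : f w ∈ A.image f := Finset.mem_image_of_mem f hw
  rw [heavyPart, heavyPart, h1, h2, ← Finset.add_sum_erase _ _ hmem,
    ← Finset.add_sum_erase _ _ hmem]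
  have : ∀ v ∈ (A.image f).erase (f w),
      (if (U'.filter fun y => f y = v).card ≤ (D'.filter fun y => f y = v).card then
          (D'.filter fun y => f y = v).card else 0) =
        if (U.filter fun y => f y = v).card ≤ (D.filter fun y => f y = v).card then
          (D.filter fun y => f y = v).card else 0 := by
    intro v hv
    rw [hDD v (Finset.ne_of_mem_erase hv), hUU v (Finset.ne_of_mem_erase hv)]
  rw [Finset.sum_congr rfl this]
  omega

/-- Pairs between `D` and `U` avoid `r` but need not have colour `b` inside a part. Passing to the
heavy part of `D` and the light part of `U` puts the two sides into different parts. The search is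
stopped when the heavy part exceeds `s`: a fibre turns heavy when it is nearly balanced, so the jump
is at most about `s / 2`, and the bound on `A.card` leaves a light part of at least `s + 1`
vertices. -/
theorem exists_complete_of_parts (hC : ∀ x y, C x y = C y x) {r b : κ} {u s : ℕ} {f : V → V}
    (hu3 : 3 ≤ u) (hsu : 2 * s ≤ u) (hA : 5 * u + 1 ≤ A.card + 3 * s)
    (hconn : ColorConnected C r A) (hu : ¬ TriTail C r A (u + 1))
    (hrb : ∀ x ∈ A, ∀ y ∈ A, f x ≠ f y → C x y = r ∨ C x y = b)
    (hf : ∀ v, (A.filter fun w => f w = v).card ≤ s) (ht : MeetsTriangle C r A A) :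
    ∃ X Y : Finset V, X ⊆ A ∧ Y ⊆ A ∧ Disjoint X Y ∧ Complete C b X Y ∧ s + 1 ≤ X.card ∧
      s + 1 ≤ Y.card := by
  have key : ∀ D U : Finset V, D ⊆ A → U ⊆ A → Disjoint D U → (∀ d ∈ D, ∀ w ∈ U, C d w ≠ r) →
      s + 1 ≤ (heavyPart f D U).card → s + 1 ≤ (lightPart f D U).card →
      ∃ X Y : Finset V, X ⊆ A ∧ Y ⊆ A ∧ Disjoint X Y ∧ Complete C b X Y ∧ s + 1 ≤ X.card ∧
      s + 1 ≤ Y.card := by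
    intro D U hD hU hDU hsep h1 h2
    refine ⟨_, _, (Finset.filter_subset _ _).trans hD, (Finset.filter_subset _ _).trans hU,
      Finset.disjoint_of_subset_left (Finset.filter_subset _ _)
        (Finset.disjoint_of_subset_right (Finset.filter_subset _ _) hDU), ?_, h1, h2⟩
    intro x hx y hy
    rw [Finset.mem_filter] at hx hy
    refine (hrb x (hD hx.1) y (hU hy.1) fun e => hy.2 ?_).resolve_left (hsep x hx.1 y hy.1)
    rw [← e]
    exact hx.2
  have hfib : ∀ D U : Finset V, D ⊆ A → U ⊆ A → Disjoint D U → ∀ v,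
      (D.filter fun y => f y = v).card + (U.filter fun y => f y = v).card ≤ s := by
    intro D U hD hU hDU v
    rw [← Finset.card_union_of_disjoint (Finset.disjoint_of_subset_left (Finset.filter_subset _ _)
        (Finset.disjoint_of_subset_right (Finset.filter_subset _ _) hDU)), ← Finset.filter_union]
    exact (Finset.card_le_card (Finset.filter_subset_filter _ (Finset.union_subset hD hU))).trans
      (hf v)
  obtain ⟨L, hL, -⟩ := ht.tailList
  have hLA : L.toFinset ⊆ A := fun v hv => hL.mem v (List.mem_toFinset.mp hv)
  obtain ⟨D, U, w, hDA, hUA, hw, hwD, hDU, hΦ, h | h⟩ := exists_search_step hC hconn hu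
    (fun D U => (heavyPart f D U).card ≤ s)
    (fun D hD => by
      have : heavyPart f D ∅ = D := by
        rw [heavyPart, Finset.filter_true_of_mem]
        intro x _
        simp
      rw [this]
      omega)
    _ L ∅ (A \ L.toFinset) hL (by simp) (by simp)
    Finset.disjoint_sdiff (by simpa using hLA) (by simp) le_rfl (by simp [heavyPart])
  · obtain ⟨hwU, hΦ', hcard, hsep⟩ := h
    have hd : Disjoint (insert w D) U := by rw [Finset.disjoint_insert_left]; exact ⟨hwU, hDU⟩
    have hDA' : insert w D ⊆ A := Finset.insert_subset hw hDA
    have h1 := heavyPart_step (U := U) (U' := U) hDA hDA' (f := f) hw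
      (fun v hv => by rw [Finset.filter_insert, if_neg hv.symm]) (fun _ _ => rfl)
    have h2 := card_le_heavyPart_add_lightPart hDA' hUA f
    have h3 := hfib _ _ hDA' hUA hd (f w)
    have h4 : ((insert w D).filter fun y => f y = f w).card =
        (D.filter fun y => f y = f w).card + 1 := by
      rw [Finset.filter_insert, if_pos rfl, Finset.card_insert_of_notMem]
      simp [hwD]
    refine key _ _ hDA' hUA hd hsep (by omega) ?_
    rw [h4] at h1 h3
    split_ifs at h1 <;> omega
  · obtain ⟨hwU, hΦ', hcard, hsep⟩ := h
    have hd : Disjoint D (U.erase w) := Finset.disjoint_of_subset_right (Finset.erase_subset _ _) hDU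
    have hUA' : U.erase w ⊆ A := (Finset.erase_subset _ _).trans hUA
    have h1 := heavyPart_step (U := U) (U' := U.erase w) hDA hDA (f := f) hw (fun _ _ => rfl)
      (fun v hv => by
        ext y
        simp only [Finset.mem_filter, Finset.mem_erase]
        constructor
        · exact fun h => ⟨h.1.2, h.2⟩
        · rintro ⟨h, rfl⟩
          exact ⟨⟨fun e => hv (by rw [e]), h⟩, rfl⟩)
    have h2 := card_le_heavyPart_add_lightPart hDA hUA' f
    have h3 := hfib _ _ hDA hUA hDU (f w)
    have h4 : (U.filter fun y => f y = f w).card =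
        ((U.erase w).filter fun y => f y = f w).card + 1 := by
      rw [Finset.filter_erase, Finset.card_erase_add_one]
      simp [hwU]
    refine key _ _ hDA hUA' hd hsep (by omega) ?_
    rw [h4] at h1 h3
    split_ifs at h1 <;> omega

/-- A large coloured complete graph with two colours between small parts. -/
theorem Good.false_of_small_parts {K : Finset κ} {W : Finset V} {u s : ℕ}
    (h : Good C K W (u + 1)) (hu : 3 ≤ u) (hs : 1 ≤ s) (hsu : 2 * s ≤ u) (hus : u ≤ 2 * s + 1)
    (hAW : A ⊆ W) {r b : κ} {f : V → V} (hA : 5 * u + 1 ≤ A.card + 3 * s)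
    (hr : ColorConnected C r A) (hb : ColorConnected C b A)
    (hrb : ∀ x ∈ A, ∀ y ∈ A, f x ≠ f y → C x y = r ∨ C x y = b)
    (hf : ∀ v, (A.filter fun w => f w = v).card ≤ s) (ht : MeetsTriangle C r A A) : False := by
  have hG := h.mono hAW
  obtain ⟨X, Y, hXA, hYA, hd, hXY, hX, hY⟩ := exists_complete_of_parts h.symm hu hsu hA hr
    (hG.free r) hrb hf ht
  have hnb := hG.not_meetsTriangle hs (by omega) subset_rfl hb hXA hYA hd hXY hX hY
  -- No `b`-triangle meets `A`, so different parts inside a `b`-neighbourhood are joined by `r`. A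
  -- neighbourhood larger than `3 * s` would split into a complete pair in `r`, contradicting the
  -- `r`-triangle. Therefore all `r`-degrees are at least `A.card - 4 * s ≥ u`.
  have hN : ∀ v ∈ A, (A.filter fun w => f v ≠ f w ∧ C v w = b).card ≤ 3 * s := by
    intro v hv
    by_contra hlt
    obtain ⟨X, Y, hXN, hYN, hX, hY, hXY⟩ := exists_split_of_small_parts (f := f) (s := s)
      (fun p => (Finset.card_le_card (Finset.filter_subset_filter _ (Finset.filter_subset
        (fun w => f v ≠ f w ∧ C v w = b) A))).trans (hf p)) (by omega)
    have hdis : Disjoint X Y := Finset.disjoint_left.mpr fun x hx hy => hXY x hx x hy rfl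
    refine hG.not_meetsTriangle hs (by omega) subset_rfl hr (hXN.trans (Finset.filter_subset _ _))
      (hYN.trans (Finset.filter_subset _ _)) hdis (c := r) ?_ hX hY ht
    intro x hx y hy
    have hxy := hXY x hx y hy
    have hx := Finset.mem_filter.mp (hXN hx)
    have hy := Finset.mem_filter.mp (hYN hy)
    refine (hrb x hx.1 y hy.1 hxy).resolve_right fun hc => hnb ?_
    exact ⟨v, hv, x, hx.1, y, hy.1, fun e => hx.2.1 (by rw [e]), fun e => hy.2.1 (by rw [e]),
      fun e => hxy (by rw [e]), hx.2.2, hy.2.2, hc⟩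
  obtain ⟨x, hx, y, hy, z, hz, hxy, hxz, hyz, cxy, cxz, cyz⟩ := ht
  refine hG.free r (triTail_of_degree hx hy hz hxy hxz hyz cxy cxz cyz h.symm (by omega) ?_)
  intro v hv
  have hsub : A ⊆ (A.filter fun w => w ≠ v ∧ C v w = r) ∪ (A.filter fun w => f w = f v) ∪
      A.filter fun w => f v ≠ f w ∧ C v w = b := by
    intro w hw
    simp only [Finset.mem_union, Finset.mem_filter]
    by_cases hfw : f w = f v
    · tauto
    · have h1 := hrb v hv w hw (Ne.symm hfw)
      have h2 : w ≠ v := fun e => hfw (by rw [e])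
      have h3 := Ne.symm hfw
      tauto
  have h1 := (Finset.card_le_card hsub).trans ((Finset.card_union_le _ _).trans
    (Nat.add_le_add_right (Finset.card_union_le _ _) _))
  have h2 := hN v hv
  have h3 := hf (f v)
  omega

end

/-! ### Absorbing leftover vertices by recolouring -/

noncomputable section
open scoped Classical

variable {V κ : Type} {C : V → V → κ} {c : κ} {A : Finset V}

/-- Edges of a path whose colour has been changed are replaced by detours through `Z`. -/
theorem ColorPath.reroute {C' : V → V → κ} (hC : ∀ x y, C x y = C y x) {W W' E : Finset V}
    (hW : W' ⊆ W) (hE : ∀ a ∈ W', ∀ d ∈ W', a ≠ d → C' a d = c → C a d ≠ c → a ∈ E ∧ d ∈ E)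
    (l : List V) : ∀ (x : V) (Z : Finset V), Z ⊆ W → (∀ z ∈ Z, ∀ e ∈ E, C e z = c) →
      ColorPath C' c W' (x :: l) → (∀ z ∈ Z, z ∉ x :: l) → (E ∩ l.toFinset).card ≤ Z.card →
      ∃ l', ColorPath C c W (x :: l') ∧ l.length ≤ l'.length ∧ ∀ v ∈ l', v ∈ l ∨ v ∈ Z := by
  induction l with
  | nil =>
    intro x Z _ _ hp _ _
    exact ⟨[], colorPath_singleton.mpr (hW (hp.mem x (by simp))), le_rfl, by simp⟩
  | cons y l ih =>
    intro x Z hZW hZE hp hZ hcard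
    rw [colorPath_cons_cons] at hp
    obtain ⟨hx, hxl, hxy, hp⟩ := hp
    have hy := hp.mem y (by simp)
    have hyl : y ∉ l := (List.nodup_cons.mp hp.1).1
    have hne : x ≠ y := fun e => hxl (by simp [e])
    rw [List.toFinset_cons] at hcard
    by_cases hc : C x y = c
    · obtain ⟨l', hl', hlen, hsub⟩ := ih y Z hZW hZE hp
        (fun z hz h => hZ z hz (List.mem_cons_of_mem _ h))
        ((Finset.card_le_card (Finset.inter_subset_inter_left (Finset.subset_insert _ _))).trans
          hcard)
      refine ⟨y :: l', ?_, by simpa using hlen, ?_⟩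
      · rw [colorPath_cons_cons]
        refine ⟨hW hx, fun h => ?_, hc, hl'⟩
        rcases List.mem_cons.mp h with h | h
        · exact hne h
        · rcases hsub x h with h | h
          · exact hxl (List.mem_cons_of_mem _ h)
          · exact hZ x h (by simp)
      · intro v hv
        rcases List.mem_cons.mp hv with rfl | hv
        · simp
        · rcases hsub v hv with h | h
          · exact .inl (List.mem_cons_of_mem _ h)
          · exact .inr h
    · obtain ⟨hxE, hyE⟩ := hE x hx y hy hne hxy hc
      rw [Finset.inter_insert_of_mem hyE, Finset.card_insert_of_notMem (by simp [hyl])] at hcard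
      obtain ⟨z, hz⟩ := Finset.card_pos.mp (show 0 < Z.card by omega)
      have hzl := hZ z hz
      obtain ⟨l', hl', hlen, hsub⟩ := ih y (Z.erase z) ((Finset.erase_subset _ _).trans hZW)
        (fun a ha => hZE a (Finset.mem_of_mem_erase ha)) hp
        (fun a ha h => hZ a (Finset.mem_of_mem_erase ha) (List.mem_cons_of_mem _ h))
        (by rw [Finset.card_erase_of_mem hz]; omega)
      refine ⟨z :: y :: l', ?_, by simp only [List.length_cons]; omega, ?_⟩
      · rw [colorPath_cons_cons, colorPath_cons_cons]
        refine ⟨hW hx, fun h => ?_, hZE z hz x hxE, hZW hz, fun h => ?_,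
          by rw [hC]; exact hZE z hz y hyE, hl'⟩
        · rcases List.mem_cons.mp h with h | h
          · exact hzl (by simp [h])
          rcases List.mem_cons.mp h with h | h
          · exact hne h
          · rcases hsub x h with h | h
            · exact hxl (List.mem_cons_of_mem _ h)
            · exact hZ x (Finset.mem_of_mem_erase h) (by simp)
        · rcases List.mem_cons.mp h with h | h
          · exact hzl (by simp [h])
          · rcases hsub z h with h | h
            · exact hzl (by simp [h])
            · simp at h
      · intro v hv
        rcases List.mem_cons.mp hv with rfl | hv
        · exact .inr hz
        rcases List.mem_cons.mp hv with rfl | hv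
        · simp
        · rcases hsub v hv with h | h
          · exact .inl (List.mem_cons_of_mem _ h)
          · exact .inr (Finset.mem_of_mem_erase h)

theorem ColorPath.take {z : V} {l : List V} (h : ColorPath C c A (z :: l)) (n : ℕ) :
    ColorPath C c A (z :: l.take n) := by
  have hsub : (z :: l.take n).Sublist (z :: l) := (List.take_sublist n l).cons_cons z
  refine ⟨h.1.sublist hsub, fun v hv => h.mem v (hsub.subset hv), ?_⟩
  have := h.2.2.take (n + 1)
  simpa using this

theorem TriTail.exists_exact {m : ℕ} (h : TriTail C c A m) (hm : 3 ≤ m) :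
    ∃ x y z l, ColorPath C c A (z :: l) ∧ x ∈ A ∧ y ∈ A ∧ x ≠ y ∧ x ∉ z :: l ∧ y ∉ z :: l ∧
      C x y = c ∧ C x z = c ∧ C y z = c ∧ l.length + 3 = m := by
  obtain ⟨x, y, z, l, hp, hx, hy, hxy, hxl, hyl, cxy, cxz, cyz, hlen⟩ := h
  have hsub : ∀ v, v ∈ z :: l.take (m - 3) → v ∈ z :: l := fun v hv =>
    ((List.take_sublist (m - 3) l).cons_cons z).subset hv
  exact ⟨x, y, z, l.take (m - 3), hp.take _, hx, hy, hxy, fun h => hxl (hsub x h),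
    fun h => hyl (hsub y h), cxy, cxz, cyz, by rw [List.length_take]; omega⟩

/-- The colouring in which each vertex `v` of `B` sends colour `γ v` to all vertices outside `B`
and to the vertices of `B` with the same value of `γ`. -/
def recolor (C : V → V → κ) (B : Finset V) (γ : V → κ) (x y : V) : κ :=
  if x ∈ B then if y ∈ B then if γ x = γ y then γ x else C x y else γ x
  else if y ∈ B then γ y else C x y

/-- The situation in which the vertices of `B` can be made part of `A₁ ∪ X` by recolouring. -/
structure Absorbing (C : V → V → κ) (K' : Finset κ) (A₁ A₂ X B : Finset V) (γ : V → κ) (b : κ)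
    (s t : ℕ) : Prop where
  disj_A : Disjoint A₁ A₂
  disj_AX : Disjoint A₁ X
  disj_XA : Disjoint X A₂
  disj_B : Disjoint B (A₁ ∪ A₂ ∪ X)
  mem : ∀ x ∈ A₁ ∪ X, ∀ y ∈ A₁ ∪ X, x ≠ y → C x y ∈ K'
  mem_B : ∀ v ∈ B, γ v ∈ K'
  B_A : ∀ v ∈ B, ∀ a ∈ A₁ ∪ A₂, C v a = γ v
  B_X : ∀ v ∈ B, γ v ≠ b → ∀ x ∈ X, C v x = γ v
  X_A : Complete C b X A₁
  card_le : ∀ c, ((B.filter fun v => γ v = c) ∪ if c = b then X else ∅).card ≤ s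
  card_A₂ : s + 1 ≤ A₂.card
  spare : X = ∅ ∨ t ≤ A₁.card
  edge : ∀ v ∈ B, ∃ p ∈ A₂, ∃ q ∈ A₂, p ≠ q ∧ C p q = γ v

variable {K K' : Finset κ} {A₁ A₂ X B W : Finset V} {γ : V → κ} {b : κ} {s t : ℕ}

theorem Absorbing.color_B (H : Absorbing C K' A₁ A₂ X B γ b s t)
    (hG : NoRainbow C W) (hA₂ : A₂ ⊆ W) (hB : B ⊆ W) {x y : V} (hx : x ∈ B) (hy : y ∈ B)
    (hxy : x ≠ y) (hγ : γ x ≠ γ y) : C x y = γ x ∨ C x y = γ y := by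
  obtain ⟨a, ha⟩ := Finset.card_pos.mp (show 0 < A₂.card by have := H.card_A₂; omega)
  have h1 := H.B_A x hx a (Finset.mem_union_right _ ha)
  have h2 := H.B_A y hy a (Finset.mem_union_right _ ha)
  have hdis : ∀ v ∈ B, v ≠ a := fun v hv e => Finset.disjoint_left.mp H.disj_B hv (by simp [e, ha])
  have := hG x (hB hx) y (hB hy) a (hA₂ ha) hxy (hdis y hy) (hdis x hx)
  grind

/-- An edge that acquires colour `c` has both ends in a set of at most `s` vertices which sends `c`
to all of `A₁`, and one end is in `B` with label `c`. -/
theorem Absorbing.bad_edge (H : Absorbing C K' A₁ A₂ X B γ b s t) (hC : ∀ x y, C x y = C y x)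
    {x y : V} (hx : x ∈ A₁ ∪ X ∪ B) (hy : y ∈ A₁ ∪ X ∪ B) (h1 : recolor C B γ x y = c)
    (h2 : C x y ≠ c) : (x ∈ (B.filter fun v => γ v = c) ∪ (if c = b then X else ∅) ∧
      y ∈ (B.filter fun v => γ v = c) ∪ (if c = b then X else ∅)) ∧
      ((x ∈ B ∧ γ x = c) ∨ (y ∈ B ∧ γ y = c)) := by
  have h3 : ∀ x y, x ∈ B → y ∈ A₁ ∪ X → C x y ≠ γ x → γ x = b ∧ y ∈ X := by
    intro x y hx hy hne
    rcases Finset.mem_union.mp hy with hy | hy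
    · exact absurd (H.B_A x hx y (Finset.mem_union_left _ hy)) hne
    · exact ⟨by by_contra h; exact hne (H.B_X x hx h y hy), hy⟩
  unfold recolor at h1
  by_cases hxB : x ∈ B
  · by_cases hyB : y ∈ B
    · simp only [hxB, hyB, if_true] at h1
      split_ifs at h1 with h
      · simp [hxB, hyB, h1, ← h]
      · exact absurd h1 h2
    · simp only [hxB, hyB, if_true, if_false] at h1
      obtain ⟨h4, h5⟩ := h3 x y hxB ((Finset.mem_union.mp hy).resolve_right hyB) (by rwa [h1])
      simp [hxB, h1, h5, ← h4]
  · by_cases hyB : y ∈ B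
    · simp only [hxB, hyB, if_true, if_false] at h1
      obtain ⟨h4, h5⟩ := h3 y x hyB ((Finset.mem_union.mp hx).resolve_right hxB)
        (by rwa [h1, hC])
      simp [hyB, h1, h5, ← h4]
    · simp only [hxB, hyB, if_false] at h1
      exact absurd h1 h2

/-- A forbidden triangle with tail in the new colouring is turned into one in the old colouring.
Changed edges on the tail are bypassed through spare vertices. If a triangle vertex `v` lies in `B`
with label `c`, the triangle is replaced by `v` and an edge of colour `c` in `A₂`; otherwise no
triangle edge was changed. -/
theorem Absorbing.free (H : Absorbing C K' A₁ A₂ X B γ b s t) (hC : ∀ x y, C x y = C y x)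
    (hW₁ : A₁ ∪ X ∪ B ⊆ W) (hW₂ : A₂ ⊆ W) (ht : 3 ≤ t) (hfree : ¬ TriTail C c W t) :
    ¬ TriTail (recolor C B γ) c (A₁ ∪ X ∪ B) t := by
  intro hT
  obtain ⟨x, y, z, l, hp, hx, hy, hxy, hxl, hyl, cxy, cxz, cyz, hlen⟩ := hT.exists_exact ht
  set C' := recolor C B γ with hC'
  set Q := A₁ ∪ X ∪ B with hQ
  set E := (B.filter fun v => γ v = c) ∪ (if c = b then X else ∅) with hE
  have hzQ : z ∈ Q := hp.mem z (by simp)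
  have hA₂Q : ∀ v ∈ A₂, v ∉ Q := by
    intro v hv h
    rw [hQ, Finset.mem_union, Finset.mem_union] at h
    rcases h with (h | h) | h
    · exact Finset.disjoint_left.mp H.disj_A h hv
    · exact Finset.disjoint_left.mp H.disj_XA h hv
    · exact Finset.disjoint_left.mp H.disj_B h (by simp [hv])
  have hEA₁ : Disjoint A₁ E := by
    rw [Finset.disjoint_left]
    intro v hv h
    rw [hE, Finset.mem_union, Finset.mem_filter] at h
    rcases h with h | h
    · exact Finset.disjoint_left.mp H.disj_B h.1 (by simp [hv])
    · split_ifs at h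
      · exact Finset.disjoint_left.mp H.disj_AX hv h
      · simp at h
  have hEs : E.card ≤ s := H.card_le c
  have hEA : ∀ e ∈ E, ∀ a ∈ A₁, C e a = c := by
    intro e he a ha
    rw [hE, Finset.mem_union, Finset.mem_filter] at he
    rcases he with he | he
    · rw [← he.2]; exact H.B_A e he.1 a (by simp [ha])
    · split_ifs at he with h
      · rw [h]; exact H.X_A e he a ha
      · simp at he
  set L : List V := x :: y :: z :: l with hL
  have hLnd : L.Nodup := by
    rw [hL, List.nodup_cons, List.nodup_cons]
    exact ⟨by simp only [List.mem_cons] at hxl ⊢; tauto, hyl, hp.1⟩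
  have hLQ : ∀ v ∈ L, v ∈ Q := by
    intro v hv
    rcases List.mem_cons.mp hv with rfl | hv
    · exact hx
    rcases List.mem_cons.mp hv with rfl | hv
    · exact hy
    · exact hp.mem v hv
  -- If `X` is empty, `A₂` serves as the reservoir, disjoint from the old configuration. If `A₁` has
  -- at least `t` vertices, those off the configuration suffice, because `E` and `A₁` are disjoint
  -- and the configuration has exactly `t` vertices.
  have hspare : ∀ F : Finset V, F ⊆ A₂ → ∃ Z ⊆ W, (∀ v ∈ Z, ∀ e ∈ E, C e v = c) ∧
      (∀ v ∈ Z, v ∉ L ∧ v ∉ F) ∧ ∀ G ⊆ L.toFinset, (E ∩ G).card + F.card ≤ s + 1 →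
        (E ∩ G).card ≤ Z.card := by
    intro F hF
    rcases H.spare with hX | hA₁
    · refine ⟨A₂ \ F, Finset.sdiff_subset.trans hW₂, ?_, ?_, ?_⟩
      · intro v hv e he
        rw [hE, hX, ite_self, Finset.union_empty, Finset.mem_filter] at he
        rw [← he.2]
        exact H.B_A e he.1 v (by simp [(Finset.mem_sdiff.mp hv).1])
      · intro v hv
        rw [Finset.mem_sdiff] at hv
        exact ⟨fun h => hA₂Q v hv.1 (hLQ v h), hv.2⟩
      · intro G _ h
        rw [Finset.card_sdiff_of_subset hF]
        have := H.card_A₂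
        omega
    · refine ⟨A₁ \ L.toFinset, fun v hv => hW₁ ?_, ?_, ?_, ?_⟩
      · simp [(Finset.mem_sdiff.mp hv).1, hQ]
      · intro v hv e he
        exact hEA e he v (Finset.mem_sdiff.mp hv).1
      · intro v hv
        rw [Finset.mem_sdiff, List.mem_toFinset] at hv
        exact ⟨hv.2, fun h => Finset.disjoint_left.mp H.disj_A hv.1 (hF h)⟩
      · intro G hG _
        have h1 := Finset.card_le_card (Finset.inter_subset_inter_left hG : E ∩ G ⊆ E ∩ L.toFinset)
        have h2 : (A₁ ∩ L.toFinset).card + (E ∩ L.toFinset).card ≤ L.toFinset.card := by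
          rw [← Finset.card_union_of_disjoint (Finset.disjoint_of_subset_left
            Finset.inter_subset_left (Finset.disjoint_of_subset_right Finset.inter_subset_left
              hEA₁))]
          exact Finset.card_le_card (Finset.union_subset Finset.inter_subset_right
            Finset.inter_subset_right)
        have h3 := Finset.card_sdiff_add_card_inter A₁ L.toFinset
        have h4 : L.toFinset.card = l.length + 3 := by
          rw [List.toFinset_card_of_nodup hLnd]
          simp [hL]
        omega
  have hbad : ∀ a ∈ Q, ∀ d ∈ Q, a ≠ d → C' a d = c → C a d ≠ c → a ∈ E ∧ d ∈ E :=
    fun a ha d hd _ h1 h2 => (H.bad_edge hC ha hd h1 h2).1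
  -- The new triangle takes `p` and `q` from the reservoir, but `v` itself is in `E` and starts the
  -- path, so at most `s - 1` detours remain to be served.
  have key : ∀ v m, ColorPath C' c Q (v :: m) → v ∈ B → γ v = c → (∀ w ∈ v :: m, w ∈ L) →
      t ≤ m.length + 3 → False := by
    intro v m hm hv hγ hmL hlen
    obtain ⟨p, hpA, q, hqA, hpq, hpqc⟩ := H.edge v hv
    have hF : ({p, q} : Finset V) ⊆ A₂ := by
      intro w hw
      rcases Finset.mem_insert.mp hw with rfl | hw
      · exact hpA
      · rwa [Finset.mem_singleton.mp hw]
    obtain ⟨Z, hZW, hZE, hZL, hZc⟩ := hspare {p, q} hF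
    have hvE : v ∈ E := by simp [hE, hv, hγ]
    have hcard : (E ∩ m.toFinset).card ≤ Z.card := by
      refine hZc _ (fun w hw => List.mem_toFinset.mpr (hmL w (by simp_all))) ?_
      rw [Finset.card_pair hpq]
      have : (E ∩ m.toFinset) ⊆ E.erase v := by
        intro w hw
        rw [Finset.mem_inter, List.mem_toFinset] at hw
        refine Finset.mem_erase.mpr ⟨?_, hw.1⟩
        rintro rfl
        exact (List.nodup_cons.mp hm.1).1 hw.2
      have := Finset.card_le_card this
      rw [Finset.card_erase_of_mem hvE] at this
      have := Finset.card_pos.mpr ⟨v, hvE⟩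
      omega
    obtain ⟨l', hl', hl'len, hsub⟩ := hm.reroute hC hW₁ hbad m v Z hZW hZE
      (fun w hw h => (hZL w hw).1 (hmL w h)) hcard
    have hnot : ∀ w ∈ ({p, q} : Finset V), w ∉ v :: l' := by
      intro w hw h
      rcases List.mem_cons.mp h with h | h
      · exact hA₂Q w (hF hw) (h ▸ hm.mem v (by simp))
      · rcases hsub w h with h | h
        · exact hA₂Q w (hF hw) (hm.mem w (by simp [h]))
        · exact (hZL w h).2 hw
    exact hfree ⟨p, q, v, l', hl', hW₂ hpA, hW₂ hqA, hpq, hnot p (by simp), hnot q (by simp),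
      by rw [hpqc, hγ], by rw [hC, H.B_A v hv p (by simp [hpA]), hγ],
      by rw [hC, H.B_A v hv q (by simp [hqA]), hγ], by omega⟩
  have hzl : ∀ w ∈ z :: l, w ∈ L := fun w hw => by simp [hL] at hw ⊢; tauto
  have hpx : ColorPath C' c Q (x :: z :: l) := colorPath_cons_cons.mpr ⟨hx, hxl, cxz, hp⟩
  have hpy : ColorPath C' c Q (y :: z :: l) := colorPath_cons_cons.mpr ⟨hy, hyl, cyz, hp⟩
  have kx : x ∈ B ∧ γ x = c → False := fun h => key x (z :: l) hpx h.1 h.2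
    (fun w hw => by simp [hL] at hw ⊢; tauto) (by simp only [List.length_cons]; omega)
  have ky : y ∈ B ∧ γ y = c → False := fun h => key y (z :: l) hpy h.1 h.2
    (fun w hw => by simp [hL] at hw ⊢; tauto) (by simp only [List.length_cons]; omega)
  have kz : z ∈ B ∧ γ z = c → False := fun h => key z l hp h.1 h.2 hzl (by omega)
  have exy : C x y = c := by
    by_contra h
    exact (H.bad_edge hC hx hy cxy h).2.elim kx ky
  have exz : C x z = c := by
    by_contra h
    exact (H.bad_edge hC hx hzQ cxz h).2.elim kx kz
  have eyz : C y z = c := by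
    by_contra h
    exact (H.bad_edge hC hy hzQ cyz h).2.elim ky kz
  obtain ⟨Z, hZW, hZE, hZL, hZc⟩ := hspare ∅ (by simp)
  obtain ⟨l', hl', hl'len, hsub⟩ := hp.reroute hC hW₁ hbad l z Z hZW hZE
    (fun w hw h => (hZL w hw).1 (hzl w h))
    (hZc _ (fun w hw => List.mem_toFinset.mpr (hzl w (by simp_all))) (by
      have := Finset.card_le_card (Finset.inter_subset_left : E ∩ l.toFinset ⊆ E)
      simp
      omega))
  have hnot : ∀ w ∈ L, w ∉ z :: l → w ∉ z :: l' := by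
    intro w hwL hw h
    rcases List.mem_cons.mp h with h | h
    · exact hw (by simp [h])
    · rcases hsub w h with h | h
      · exact hw (by simp [h])
      · exact (hZL w h).1 hwL
  exact hfree ⟨x, y, z, l', hl', hW₁ hx, hW₁ hy, hxy, hnot x (by simp [hL]) hxl,
    hnot y (by simp [hL]) hyl, exy, exz, eyz, by omega⟩

/-- Inside `B`, edges between different labels carry one of the two labels, since `A₂` would
otherwise complete a rainbow triangle. Hence the recolouring stays within `K'` and remains free of
rainbow triangles. -/
theorem Absorbing.good (H : Absorbing C K' A₁ A₂ X B γ b s t) (h : Good C K W t)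
    (hW₁ : A₁ ∪ X ∪ B ⊆ W) (hW₂ : A₂ ⊆ W) (ht : 3 ≤ t) :
    Good (recolor C B γ) K' (A₁ ∪ X ∪ B) t := by
  have hBW : B ⊆ W := fun v hv => hW₁ (by simp [hv])
  have hcB : ∀ x ∈ B, ∀ y ∈ B, x ≠ y → γ x ≠ γ y → C x y = γ x ∨ C x y = γ y :=
    fun x hx y hy hxy hγ => H.color_B h.gallai hW₂ hBW hx hy hxy hγ
  have hcore : ∀ x ∈ A₁ ∪ X ∪ B, x ∉ B → x ∈ A₁ ∪ X :=
    fun x hx hxB => (Finset.mem_union.mp hx).resolve_right hxB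
  refine ⟨?_, ?_, ?_, fun c => H.free h.symm hW₁ hW₂ ht (h.free c)⟩
  · intro x y
    unfold recolor
    have := h.symm x y
    split_ifs <;> simp_all
  · intro x hx y hy hxy
    unfold recolor
    split_ifs with h1 h2 h3 h4
    · exact H.mem_B x h1
    · rcases hcB x h1 y h2 hxy h3 with e | e
      · rw [e]; exact H.mem_B x h1
      · rw [e]; exact H.mem_B y h2
    · exact H.mem_B x h1
    · exact H.mem_B y h4
    · exact H.mem x (hcore x hx h1) y (hcore y hy h4) hxy
  · intro x hx y hy z hz hxy hyz hxz
    have g := h.gallai x (hW₁ hx) y (hW₁ hy) z (hW₁ hz) hxy hyz hxz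
    have e1 := fun hx hy => hcB x hx y hy hxy
    have e2 := fun hy hz => hcB y hy z hz hyz
    have e3 := fun hx hz => hcB x hx z hz hxz
    clear hcB hcore H h
    unfold recolor
    grind

end

/-! ### Extremal numbers, small cuts, and two large joined sets -/

noncomputable section
open scoped Classical

variable {V κ : Type} {C : V → V → κ} {c : κ} {A : Finset V}

/-- The largest order of a colouring with `k` colours without rainbow triangles and without
monochromatic triangles with a tail on `u + 1` vertices. -/
def maxOrder (u : ℕ) : ℕ → ℕ
  | 0 => 1
  | 1 => u
  | 2 => 2 * u
  | k + 3 => 5 * maxOrder u (k + 1)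

theorem two_mul_maxOrder_le {u : ℕ} (hu : 3 ≤ u) (k : ℕ) :
    2 * maxOrder u k ≤ maxOrder u (k + 1) := by
  induction k using maxOrder.induct with
  | case1 => simp only [maxOrder]; omega
  | case2 => simp only [maxOrder]; omega
  | case3 => simp only [maxOrder]; omega
  | case4 k ih => simp only [maxOrder] at ih ⊢; omega

/-- Equality holds except for `k = 0`, where `5 ≤ 2 * u` needs `3 ≤ u`. -/
theorem five_mul_maxOrder_le {u : ℕ} (hu : 3 ≤ u) (k : ℕ) :
    5 * maxOrder u k ≤ maxOrder u (k + 2) := by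
  cases k with
  | zero => simp only [maxOrder]; omega
  | succ k => simp only [maxOrder]; omega

theorem le_maxOrder_succ {u : ℕ} (hu : 3 ≤ u) (k : ℕ) : u ≤ maxOrder u (k + 1) := by
  induction k with
  | zero => simp [maxOrder]
  | succ k ih =>
    have := two_mul_maxOrder_le hu (k + 1)
    omega

theorem maxOrder_add_mul_le {u s : ℕ} (hu : 3 ≤ u) (hs : 2 * s ≤ u) (k : ℕ) :
    maxOrder u k + (k + 1) * s ≤ maxOrder u (k + 1) := by
  induction k using maxOrder.induct with
  | case1 => simp only [maxOrder]; omega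
  | case2 => simp only [maxOrder]; omega
  | case3 => simp only [maxOrder]; omega
  | case4 k ih =>
    simp only [maxOrder] at ih ⊢
    linarith [Nat.zero_le (k * s)]

/-- The slack used when absorption fails: one large piece then misses a further colour, or is tiny,
and at most `s` leftover vertices per colour can be paid for directly. -/
theorem maxOrder_add_maxOrder_add_mul_le {u s : ℕ} (hs : 2 * s ≤ u) (k : ℕ) :
    maxOrder u (k + 2) + maxOrder u (k + 1) + (k + 4) * s ≤ maxOrder u (k + 3) := by
  induction k using Nat.twoStepInduction with
  | zero => simp only [maxOrder]; omega
  | one => simp only [maxOrder]; omega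
  | more k ih _ =>
    simp only [maxOrder] at ih ⊢
    linarith [Nat.zero_le (k * s)]

theorem five_mul_add_mul_le_maxOrder {u s : ℕ} (hu : 3 ≤ u) (hs : 2 * s ≤ u) (k : ℕ) :
    5 * u + k * s ≤ maxOrder u (k + 3) := by
  induction k with
  | zero => simp [maxOrder]
  | succ k ih =>
    have h1 := two_mul_maxOrder_le hu (k + 3)
    linarith [Nat.zero_le (k * s)]

/-- The vertices of `W` outside `A` that send colour `c` to all of `A`. -/
def colorNbrs (C : V → V → κ) (c : κ) (W A : Finset V) : Finset V :=
  (W \ A).filter fun v => ∀ a ∈ A, C v a = c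

/-- `A` is a nonempty module of `W` with few outside neighbours in each colour. -/
structure SmallCut (C : V → V → κ) (s : ℕ) (W A : Finset V) : Prop where
  subset : A ⊆ W
  nonempty : A.Nonempty
  module : ∀ v ∈ W, v ∉ A → ∀ a ∈ A, ∀ a' ∈ A, C v a = C v a'
  card_le : ∀ c, (colorNbrs C c W A).card ≤ s

/-- The induction step for `k + 3` colours. -/
structure StepSetting (C : V → V → κ) (K : Finset κ) (W : Finset V) (u s k : ℕ) : Prop where
  three_le : 3 ≤ u
  one_le : 1 ≤ s
  two_mul_le : 2 * s ≤ u
  le_two_mul : u ≤ 2 * s + 1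
  good : Good C K W (u + 1)
  card : K.card = k + 3
  ih : ∀ (C' : V → V → κ) (K' : Finset κ) (A' : Finset V), K'.card < k + 3 →
    Good C' K' A' (u + 1) → A'.card ≤ maxOrder u K'.card

theorem Good.erase {K : Finset κ} {t : ℕ} (h : Good C K A t) (r : κ)
    (hr : ∀ x ∈ A, ∀ y ∈ A, x ≠ y → C x y ≠ r) : Good C (K.erase r) A t where
  symm := h.symm
  mem x hx y hy hxy := Finset.mem_erase.mpr ⟨hr x hx y hy hxy, h.mem x hx y hy hxy⟩
  gallai := h.gallai
  free := h.free

theorem color_ne_of_not_meetsTriangle {W : Finset V} (h : ¬ MeetsTriangle C c W A) {a x y : V}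
    (ha : a ∈ A) (hx : x ∈ W) (hy : y ∈ W) (hax : a ≠ x) (hay : a ≠ y) (hxy : x ≠ y)
    (h1 : C a x = c) (h2 : C a y = c) : C x y ≠ c :=
  fun h3 => h ⟨a, ha, x, hx, y, hy, hax, hay, hxy, h1, h2, h3⟩

variable {K : Finset κ} {W : Finset V} {u s k : ℕ}

theorem SmallCut.card_sdiff_le (h : SmallCut C s W A) {K' : Finset κ}
    (hK : ∀ v ∈ W, v ∉ A → ∀ a ∈ A, C v a ∈ K') : (W \ A).card ≤ K'.card * s := by
  obtain ⟨a, ha⟩ := h.nonempty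
  rw [mul_comm]
  refine Finset.card_le_mul_card_image_of_maps_to (f := fun v => C v a) (fun v hv => ?_) s
    fun c _ => ?_
  · rw [Finset.mem_sdiff] at hv
    exact hK v hv.1 hv.2 a ha
  · refine (Finset.card_le_card ?_).trans (h.card_le c)
    intro v hv
    rw [Finset.mem_filter] at hv
    have hv' := Finset.mem_sdiff.mp hv.1
    exact Finset.mem_filter.mpr ⟨hv.1, fun a' ha' => by
      rw [h.module v hv'.1 hv'.2 a' ha' a ha]; exact hv.2⟩

/-- If `A'` had more than `s` neighbours in colour `c`, some would be inside `A` and some outside.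
An outside one sends `c` to all of `A`, hence to an inside one, giving an edge within a side of a
large complete pair. -/
theorem SmallCut.card_colorNbrs_le (h : SmallCut C s W A) (hS : StepSetting C K W u s k)
    {A' : Finset V} (hA' : A' ⊆ A) (hcard : s + 1 ≤ A'.card)
    (hc : ((A \ A').filter fun v => ∀ a ∈ A', C v a = c).card ≤ s) :
    (colorNbrs C c W A').card ≤ s := by
  by_contra hlt
  set P := (A \ A').filter fun v => ∀ a ∈ A', C v a = c with hP
  obtain ⟨a0, ha0⟩ := Finset.card_pos.mp (show 0 < A'.card by omega)
  have hsub : colorNbrs C c W A' ⊆ P ∪ colorNbrs C c W A := by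
    intro v hv
    simp only [colorNbrs, hP, Finset.mem_filter, Finset.mem_sdiff, Finset.mem_union] at hv ⊢
    by_cases hvA : v ∈ A
    · exact .inl ⟨⟨hvA, hv.1.2⟩, hv.2⟩
    · refine .inr ⟨⟨hv.1.1, hvA⟩, fun a ha => ?_⟩
      rw [h.module v hv.1.1 hvA a ha a0 (hA' ha0)]
      exact hv.2 a0 ha0
  have h1 := h.card_le c
  have h2 : ∃ p ∈ colorNbrs C c W A', p ∈ P := by
    by_contra hcon
    push Not at hcon
    have : colorNbrs C c W A' ⊆ colorNbrs C c W A := fun v hv =>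
      (Finset.mem_union.mp (hsub hv)).resolve_left (hcon v hv)
    have := Finset.card_le_card this
    omega
  have h3 : ∃ q ∈ colorNbrs C c W A', q ∈ colorNbrs C c W A := by
    by_contra hcon
    push Not at hcon
    have : colorNbrs C c W A' ⊆ P := fun v hv =>
      (Finset.mem_union.mp (hsub hv)).resolve_right (hcon v hv)
    have := Finset.card_le_card this
    omega
  obtain ⟨p, hp, hpP⟩ := h2
  obtain ⟨q, hq, hqA⟩ := h3
  simp only [hP, colorNbrs, Finset.mem_filter, Finset.mem_sdiff] at hpP hqA
  refine hS.good.free c ((triTail_of_edge_in_side hS.good.symm (X := colorNbrs C c W A') (Y := A')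
    ?_ ?_ ((Finset.filter_subset _ _).trans Finset.sdiff_subset) (hA'.trans h.subset) hS.one_le
    (by omega) hcard hq hp ?_ (hqA.2 p hpP.1.1)).mono subset_rfl (by have := hS.le_two_mul; omega))
  · exact Finset.disjoint_of_subset_left (Finset.filter_subset _ _) Finset.sdiff_disjoint
  · intro x hx a ha
    exact (Finset.mem_filter.mp hx).2 a ha
  · rintro rfl
    exact hqA.1.2 hpP.1.1

theorem SmallCut.peel (h : SmallCut C s W A) (hS : StepSetting C K W u s k)
    {A' : Finset V} (hA' : A' ⊆ A) (hcard : s + 1 ≤ A'.card)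
    (hmod : ∀ v ∈ A, v ∉ A' → ∀ a ∈ A', ∀ a' ∈ A', C v a = C v a')
    (hc : ∀ c, ((A \ A').filter fun v => ∀ a ∈ A', C v a = c).card ≤ s) : SmallCut C s W A' where
  subset := hA'.trans h.subset
  nonempty := Finset.card_pos.mp (by omega)
  module v hv hvA a ha a' ha' := by
    by_cases hvA' : v ∈ A
    · exact hmod v hvA' hvA a ha a' ha'
    · exact h.module v hv hvA' a (hA' ha) a' (hA' ha')
  card_le c := h.card_colorNbrs_le hS hA' hcard (hc c)

theorem StepSetting.card_le_of_ne (hS : StepSetting C K W u s k) {S : Finset V} (hSW : S ⊆ W)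
    {r : κ} (hrK : r ∈ K) (hr : ∀ x ∈ S, ∀ y ∈ S, x ≠ y → C x y ≠ r) :
    S.card ≤ maxOrder u (k + 2) := by
  have h1 : (K.erase r).card = k + 2 := by rw [Finset.card_erase_of_mem hrK, hS.card]; omega
  have h2 := hS.ih C (K.erase r) S (by omega) ((hS.good.mono hSW).erase r hr)
  rwa [h1] at h2

theorem StepSetting.card_le_of_ne_of_ne (hS : StepSetting C K W u s k) {S : Finset V} (hSW : S ⊆ W)
    {r b : κ} (hrK : r ∈ K) (hbK : b ∈ K) (hrb : r ≠ b)
    (hr : ∀ x ∈ S, ∀ y ∈ S, x ≠ y → C x y ≠ r) (hb : ∀ x ∈ S, ∀ y ∈ S, x ≠ y → C x y ≠ b) :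
    S.card ≤ maxOrder u (k + 1) := by
  have h1 : ((K.erase r).erase b).card = k + 1 := by
    rw [Finset.card_erase_of_mem (by simp [hbK, hrb.symm]), Finset.card_erase_of_mem hrK, hS.card]
    omega
  have h2 := hS.ih C _ S (by omega) (((hS.good.mono hSW).erase r hr).erase b hb)
  rwa [h1] at h2

set_option maxHeartbeats 1000000 in
/-- Two large sets joined by a colour that does not close triangles. -/
theorem StepSetting.card_le_of_pair (hS : StepSetting C K W u s k) (hA : SmallCut C s W A)
    {r b : κ} (hrb : r ≠ b) (hrK : r ∈ K) (hnr : ¬ MeetsTriangle C r W A) {A₁ A₂ : Finset V}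
    (h1 : A₁ ⊆ A) (h2 : A₂ ⊆ A) (hd : Disjoint A₁ A₂) (h12 : Complete C r A₁ A₂)
    (c1 : s + 1 ≤ A₁.card) (c2 : s + 1 ≤ A₂.card)
    (hN1 : ∀ v ∈ A, v ∉ A₁ → (∀ a ∈ A₁, C v a = r) ∨ ∀ a ∈ A₁, C v a = b)
    (hN2 : ∀ v ∈ A, v ∉ A₂ → (∀ a ∈ A₂, C v a = r) ∨ ∀ a ∈ A₂, C v a = b)
    (hM1 : ((A \ A₁).filter fun v => ∀ a ∈ A₁, C v a = b).card ≤ s)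
    (hM2 : ((A \ A₂).filter fun v => ∀ a ∈ A₂, C v a = b).card ≤ s) :
    W.card ≤ maxOrder u (k + 3) := by
  have hC := hS.good.symm
  have h21 := h12.symm hC
  have hdl : ∀ v ∈ A₁, v ∉ A₂ := fun v hv => Finset.disjoint_left.mp hd hv
  obtain ⟨a1, ha1⟩ := Finset.card_pos.mp (show 0 < A₁.card by omega)
  obtain ⟨a2, ha2⟩ := Finset.card_pos.mp (show 0 < A₂.card by omega)
  set M1 := (A \ A₁).filter fun v => ∀ a ∈ A₁, C v a = b with hM1d
  set M2 := (A \ A₂).filter fun v => ∀ a ∈ A₂, C v a = b with hM2d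
  have m1 : ∀ v, v ∈ M1 ↔ (v ∈ A ∧ v ∉ A₁) ∧ ∀ a ∈ A₁, C v a = b := by
    intro v; rw [hM1d, Finset.mem_filter, Finset.mem_sdiff]
  have m2 : ∀ v, v ∈ M2 ↔ (v ∈ A ∧ v ∉ A₂) ∧ ∀ a ∈ A₂, C v a = b := by
    intro v; rw [hM2d, Finset.mem_filter, Finset.mem_sdiff]
  have hM1A2 : ∀ v ∈ M1, v ∉ A₂ := by
    intro v hv hv2
    exact hrb ((h21 v hv2 a1 ha1).symm.trans (((m1 v).mp hv).2 a1 ha1))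
  have hM2A1 : ∀ v ∈ M2, v ∉ A₁ := by
    intro v hv hv2
    exact hrb ((h12 v hv2 a2 ha2).symm.trans (((m2 v).mp hv).2 a2 ha2))
  have hX : ∀ v ∈ M1, v ∉ M2 → ∀ a ∈ A₂, C v a = r := by
    intro v hv hv2
    have hvA := ((m1 v).mp hv).1.1
    exact (hN2 v hvA (hM1A2 v hv)).resolve_right fun h => hv2 ((m2 v).mpr ⟨⟨hvA, hM1A2 v hv⟩, h⟩)
  have hX' : ∀ v ∈ M2, v ∉ M1 → ∀ a ∈ A₁, C v a = r := by
    intro v hv hv2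
    have hvA := ((m2 v).mp hv).1.1
    exact (hN1 v hvA (hM2A1 v hv)).resolve_right fun h => hv2 ((m1 v).mpr ⟨⟨hvA, hM2A1 v hv⟩, h⟩)
  -- A vertex sending `r` to both `A₁` and `A₂` would close an `r`-triangle.
  have hcover : ∀ v ∈ A, v ∈ A₁ ∨ v ∈ A₂ ∨ v ∈ M1 ∨ v ∈ M2 := by
    intro v hv
    by_contra hcon
    push Not at hcon
    obtain ⟨n1, n2, n3, n4⟩ := hcon
    have e1 := (hN1 v hv n1).resolve_right fun h => n3 ((m1 v).mpr ⟨⟨hv, n1⟩, h⟩)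
    have e2 := (hN2 v hv n2).resolve_right fun h => n4 ((m2 v).mpr ⟨⟨hv, n2⟩, h⟩)
    refine color_ne_of_not_meetsTriangle hnr hv (hA.subset (h1 ha1)) (hA.subset (h2 ha2)) ?_ ?_ ?_
      (e1 a1 ha1) (e2 a2 ha2) (h12 a1 ha1 a2 ha2)
    · rintro rfl; exact n1 ha1
    · rintro rfl; exact n2 ha2
    · rintro rfl; exact hdl _ ha1 ha2
  have hout : ∀ v ∈ W, v ∉ A → ∀ a ∈ A, C v a ≠ r := by
    intro v hv hvA a ha h
    have e1 : C v a1 = r := by rw [hA.module v hv hvA a1 (h1 ha1) a ha, h]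
    have e2 : C v a2 = r := by rw [hA.module v hv hvA a2 (h2 ha2) a ha, h]
    refine color_ne_of_not_meetsTriangle hnr (h1 ha1) (hA.subset (h2 ha2)) hv ?_ ?_ ?_
      (h12 a1 ha1 a2 ha2) (by rw [hC, e1]) (by rw [hC, e2])
    · rintro rfl; exact hdl _ ha1 ha2
    · rintro rfl; exact hvA (h1 ha1)
    · rintro rfl; exact hvA (h2 ha2)
  have hnoA2 : ∀ S : Finset V, S ⊆ A → (∀ v ∈ S, ∀ a ∈ A₂, C v a = r) →
      (∀ v ∈ S, v ∉ A₂) → ∀ x ∈ S, ∀ y ∈ S, x ≠ y → C x y ≠ r := by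
    intro S hSA hSr hS2 x hx y hy hxy
    refine color_ne_of_not_meetsTriangle hnr (h2 ha2) (hA.subset (hSA hx)) (hA.subset (hSA hy))
      ?_ ?_ hxy (by rw [hC]; exact hSr x hx a2 ha2) (by rw [hC]; exact hSr y hy a2 ha2)
    · rintro rfl; exact hS2 _ hx ha2
    · rintro rfl; exact hS2 _ hy ha2
  have hnoA1 : ∀ S : Finset V, S ⊆ A → (∀ v ∈ S, ∀ a ∈ A₁, C v a = r) →
      (∀ v ∈ S, v ∉ A₁) → ∀ x ∈ S, ∀ y ∈ S, x ≠ y → C x y ≠ r := by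
    intro S hSA hSr hS2 x hx y hy hxy
    refine color_ne_of_not_meetsTriangle hnr (h1 ha1) (hA.subset (hSA hx)) (hA.subset (hSA hy))
      ?_ ?_ hxy (by rw [hC]; exact hSr x hx a1 ha1) (by rw [hC]; exact hSr y hy a1 ha1)
    · rintro rfl; exact hS2 _ hx ha1
    · rintro rfl; exact hS2 _ hy ha1
  have hKr : (K.erase r).card = k + 2 := by rw [Finset.card_erase_of_mem hrK, hS.card]; omega
  have houtK : ∀ v ∈ W, v ∉ A → ∀ a ∈ A, C v a ∈ K.erase r := by
    intro v hv hvA a ha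
    refine Finset.mem_erase.mpr ⟨hout v hv hvA a ha, hS.good.mem v hv a (hA.subset ha) ?_⟩
    rintro rfl
    exact hvA ha
  have hWA := hA.card_sdiff_le houtK
  rw [hKr] at hWA
  have hWsub : W ⊆ A₁ ∪ A₂ ∪ M1 ∪ M2 ∪ (W \ A) := by
    intro v hv
    simp only [Finset.mem_union, Finset.mem_sdiff]
    by_cases hvA : v ∈ A
    · rcases hcover v hvA with h | h | h | h <;> simp [h]
    · simp [hv, hvA]
  have hWcard : W.card ≤ A₁.card + A₂.card + 2 * s + (k + 2) * s := by
    have e1 := Finset.card_le_card hWsub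
    have e2 := Finset.card_union_le (A₁ ∪ A₂ ∪ M1 ∪ M2) (W \ A)
    have e3 := Finset.card_union_le (A₁ ∪ A₂ ∪ M1) M2
    have e4 := Finset.card_union_le (A₁ ∪ A₂) M1
    have e5 := Finset.card_union_le A₁ A₂
    omega
  have hA1c := hS.card_le_of_ne (h1.trans hA.subset) hrK (hnoA2 A₁ h1 h12 hdl)
  have hA2r := hnoA1 A₂ h2 h21 (fun v hv hv' => hdl v hv' hv)
  have hA2c := hS.card_le_of_ne (h2.trans hA.subset) hrK hA2r
  have hnum := maxOrder_add_maxOrder_add_mul_le hS.two_mul_le k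
  have hnum2 := le_maxOrder_succ hS.three_le k
  -- These vertices send one and the same colour, different from `r`, to all of `A₁ ∪ A₂`; they are
  -- to be absorbed into `A₁ ∪ (M1 \ M2)`.
  set B := (W \ A) ∪ (M1 ∩ M2) with hB
  set γ : V → κ := fun v => C v a1 with hγ
  have hBmem : ∀ v ∈ B, (v ∈ W ∧ v ∉ A) ∨ v ∈ M1 ∧ v ∈ M2 := by
    intro v hv
    simpa [hB] using hv
  have hBγ : ∀ v ∈ B, γ v ∈ K.erase r := by
    intro v hv
    rcases hBmem v hv with h | h
    · exact houtK v h.1 h.2 a1 (h1 ha1)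
    · have hv1 := (m1 v).mp h.1
      have e : γ v = b := hv1.2 a1 ha1
      have : γ v ∈ K := hS.good.mem v (hA.subset hv1.1.1) a1 (hA.subset (h1 ha1))
        (fun e => hv1.1.2 (e ▸ ha1))
      exact Finset.mem_erase.mpr ⟨by rw [e]; exact hrb.symm, this⟩
  -- If a label is missing on the edges of `A₂`, then `A₂` lacks two colours and the crude bound on
  -- `W.card` suffices. The same bound works when `A₁` has at most `u` vertices.
  by_cases hedge : ∀ v ∈ B, ∃ p ∈ A₂, ∃ q ∈ A₂, p ≠ q ∧ C p q = γ v
  swap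
  · push Not at hedge
    obtain ⟨v, hv, hvc⟩ := hedge
    have hγv := Finset.mem_erase.mp (hBγ v hv)
    have := hS.card_le_of_ne_of_ne (h2.trans hA.subset) hrK hγv.2 hγv.1.symm hA2r hvc
    linarith
  by_cases hspare : M1 \ M2 = ∅ ∨ u + 1 ≤ A₁.card
  swap
  · push Not at hspare
    have := hspare.2
    linarith
  have hXr : ∀ v ∈ A₁ ∪ (M1 \ M2), ∀ a ∈ A₂, C v a = r := by
    intro v hv
    rcases Finset.mem_union.mp hv with hv | hv
    · exact h12 v hv
    · rw [Finset.mem_sdiff] at hv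
      exact hX v hv.1 hv.2
  have hXA : A₁ ∪ (M1 \ M2) ⊆ A := Finset.union_subset h1 fun v hv =>
    ((m1 v).mp (Finset.mem_sdiff.mp hv).1).1.1
  have hXr' : ∀ v ∈ A₂ ∪ (M2 \ M1), ∀ a ∈ A₁, C v a = r := by
    intro v hv
    rcases Finset.mem_union.mp hv with hv | hv
    · exact h21 v hv
    · rw [Finset.mem_sdiff] at hv
      exact hX' v hv.1 hv.2
  have hXA' : A₂ ∪ (M2 \ M1) ⊆ A := Finset.union_subset h2 fun v hv =>
    ((m2 v).mp (Finset.mem_sdiff.mp hv).1).1.1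
  have hXr2 : ∀ x ∈ A₁ ∪ (M1 \ M2), ∀ y ∈ A₁ ∪ (M1 \ M2), x ≠ y → C x y ≠ r := by
    refine hnoA2 _ hXA hXr fun v hv => ?_
    rcases Finset.mem_union.mp hv with hv | hv
    · exact hdl v hv
    · exact hM1A2 v (Finset.mem_sdiff.mp hv).1
  -- For the label `b`, both `M1` and the outside `b`-neighbours of `A` count; together they are
  -- `b`-neighbours of `A₁` in `W`, still at most `s`.
  have hE : (colorNbrs C b W A₁).card ≤ s := hA.card_colorNbrs_le hS h1 c1 hM1
  have H : Absorbing C (K.erase r) A₁ A₂ (M1 \ M2) B γ b s (u + 1) := by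
    refine ⟨hd, ?_, ?_, ?_, ?_, hBγ, ?_, ?_, ?_, ?_, c2, hspare, hedge⟩
    · rw [Finset.disjoint_left]
      intro v hv hv'
      exact ((m1 v).mp (Finset.mem_sdiff.mp hv').1).1.2 hv
    · rw [Finset.disjoint_left]
      intro v hv hv'
      exact hM1A2 v (Finset.mem_sdiff.mp hv).1 hv'
    · rw [Finset.disjoint_left]
      intro v hv hv'
      simp only [Finset.mem_union, Finset.mem_sdiff] at hv'
      rcases hBmem v hv with h | h
      · rcases hv' with (h' | h') | h'
        · exact h.2 (h1 h')
        · exact h.2 (h2 h')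
        · exact h.2 ((m1 v).mp h'.1).1.1
      · rcases hv' with (h' | h') | h'
        · exact hM2A1 v h.2 h'
        · exact hM1A2 v h.1 h'
        · exact h'.2 h.2
    · intro x hx y hy hxy
      exact Finset.mem_erase.mpr ⟨hXr2 x hx y hy hxy, hS.good.mem x (hA.subset (hXA hx)) y
        (hA.subset (hXA hy)) hxy⟩
    · intro v hv a ha
      rcases hBmem v hv with h | h
      · exact hA.module v h.1 h.2 a (Finset.union_subset h1 h2 ha) a1 (h1 ha1)
      · have e : γ v = b := ((m1 v).mp h.1).2 a1 ha1
        rw [e]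
        rcases Finset.mem_union.mp ha with ha | ha
        · exact ((m1 v).mp h.1).2 a ha
        · exact ((m2 v).mp h.2).2 a ha
    · intro v hv hvb x hx
      rcases hBmem v hv with h | h
      · exact hA.module v h.1 h.2 x (hXA (Finset.mem_union_right _ hx)) a1 (h1 ha1)
      · exact absurd (((m1 v).mp h.1).2 a1 ha1) hvb
    · intro x hx a ha
      exact ((m1 x).mp (Finset.mem_sdiff.mp hx).1).2 a ha
    · intro c
      by_cases hcb : c = b
      · subst hcb
        refine (Finset.card_le_card ?_).trans hE
        rw [if_pos rfl]
        intro v hv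
        rw [colorNbrs, Finset.mem_filter, Finset.mem_sdiff]
        have hm1 : v ∈ M1 → (v ∈ W ∧ v ∉ A₁) ∧ ∀ a ∈ A₁, C v a = c := by
          intro h
          have := (m1 v).mp h
          exact ⟨⟨hA.subset this.1.1, this.1.2⟩, this.2⟩
        rcases Finset.mem_union.mp hv with hv | hv
        · rw [Finset.mem_filter] at hv
          rcases hBmem v hv.1 with h | h
          · refine ⟨⟨h.1, fun h' => h.2 (h1 h')⟩, fun a ha => ?_⟩
            rw [hA.module v h.1 h.2 a (h1 ha) a1 (h1 ha1)]
            exact hv.2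
          · exact hm1 h.1
        · exact hm1 (Finset.mem_sdiff.mp hv).1
      · refine (Finset.card_le_card ?_).trans (hA.card_le c)
        rw [if_neg hcb, Finset.union_empty]
        intro v hv
        rw [Finset.mem_filter] at hv
        rcases hBmem v hv.1 with h | h
        · rw [colorNbrs, Finset.mem_filter, Finset.mem_sdiff]
          refine ⟨h, fun a ha => ?_⟩
          rw [hA.module v h.1 h.2 a ha a1 (h1 ha1)]
          exact hv.2
        · exact absurd (hv.2.symm.trans (((m1 v).mp h.1).2 a1 ha1)) hcb
  have hBW : B ⊆ W := by
    intro v hv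
    rcases hBmem v hv with h | h
    · exact h.1
    · exact hA.subset ((m1 v).mp h.1).1.1
  have hg := H.good hS.good (Finset.union_subset (hXA.trans hA.subset) hBW) (h2.trans hA.subset)
    (by have := hS.three_le; omega)
  have e1 := hS.ih _ _ _ (by omega) hg
  rw [hKr] at e1
  have e2 := hS.card_le_of_ne (hXA'.trans hA.subset) hrK (hnoA1 _ hXA' hXr' (by
    intro v hv
    rcases Finset.mem_union.mp hv with hv | hv
    · exact fun hv' => hdl v hv' hv
    · exact hM2A1 v (Finset.mem_sdiff.mp hv).1))
  -- `W` is covered by two pieces without colour `r`, the first after recolouring, so it has at most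
  -- `2 * maxOrder u (k + 2)` vertices.
  have hWsub2 : W ⊆ (A₁ ∪ (M1 \ M2) ∪ B) ∪ (A₂ ∪ (M2 \ M1)) := by
    intro v hv
    have := hWsub hv
    simp only [hB, Finset.mem_union, Finset.mem_sdiff, Finset.mem_inter] at this ⊢
    tauto
  have e3 := (Finset.card_le_card hWsub2).trans (Finset.card_union_le _ _)
  have e4 : 2 * maxOrder u (k + 2) ≤ maxOrder u (k + 3) := two_mul_maxOrder_le hS.three_le (k + 2)
  omega

end

/-! ### The induction step through Gallai partitions -/

noncomputable section
open scoped Classical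

variable {V κ : Type} {C : V → V → κ} {c : κ} {A : Finset V}

/-- A module partition whose parts are joined by two colours, both of them connected. -/
structure PrimePartition (C : V → V → κ) (A : Finset V) (f : V → V) (r b : κ) : Prop where
  ne : r ≠ b
  module : ModulePartition C A f
  cross : ∀ x ∈ A, ∀ y ∈ A, f x ≠ f y → C x y = r ∨ C x y = b
  conn_left : ColorConnected C r A
  conn_right : ColorConnected C b A
  adj_left : ∀ x ∈ A, ∃ y ∈ A, f x ≠ f y ∧ C x y = r
  adj_right : ∀ x ∈ A, ∃ y ∈ A, f x ≠ f y ∧ C x y = b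

variable {f : V → V} {r b : κ}

theorem PrimePartition.symm (h : PrimePartition C A f r b) : PrimePartition C A f b r where
  ne := h.ne.symm
  module := h.module
  cross x hx y hy hxy := (h.cross x hx y hy hxy).symm
  conn_left := h.conn_right
  conn_right := h.conn_left
  adj_left := h.adj_right
  adj_right := h.adj_left

variable {K : Finset κ} {W : Finset V} {u s k : ℕ}

theorem PrimePartition.left_mem (h : PrimePartition C A f r b) (hS : StepSetting C K W u s k)
    (hA : SmallCut C s W A) : r ∈ K := by
  obtain ⟨x, hx⟩ := hA.nonempty
  obtain ⟨y, hy, hxy, hc⟩ := h.adj_left x hx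
  rw [← hc]
  exact hS.good.mem x (hA.subset hx) y (hA.subset hy) fun e => hxy (by rw [e])

/-- Every part has an `r`-neighbour in another part, so an `r`-edge inside a part would lie in an
`r`-triangle. -/
theorem PrimePartition.ne_left_of_same (h : PrimePartition C A f r b)
    (hC : ∀ x y, C x y = C y x) (hA : SmallCut C s W A) (hr : ¬ MeetsTriangle C r W A) {x y : V}
    (hx : x ∈ A) (hy : y ∈ A) (hxy : x ≠ y) (hf : f x = f y) : C x y ≠ r := by
  obtain ⟨z, hz, hxz, hc⟩ := h.adj_left x hx
  refine color_ne_of_not_meetsTriangle hr hz (hA.subset hx) (hA.subset hy) (fun e => hxz (by rw [e]))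
    (fun e => hxz (by rw [e, hf])) hxy (by rw [hC, hc]) ?_
  rw [hC, ← h.module x hx y hy z hz hf hxz, hc]

theorem PrimePartition.outside_ne_left (h : PrimePartition C A f r b)
    (hC : ∀ x y, C x y = C y x) (hA : SmallCut C s W A) (hr : ¬ MeetsTriangle C r W A) {v a : V}
    (hv : v ∈ W) (hvA : v ∉ A) (ha : a ∈ A) : C v a ≠ r := by
  intro hc
  obtain ⟨x, hx, hax, hc'⟩ := h.adj_left a ha
  refine color_ne_of_not_meetsTriangle hr ha hv (hA.subset hx) (fun e => hvA (e ▸ ha))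
    (fun e => hax (by rw [e])) (fun e => hvA (e ▸ hx)) (by rw [hC, hc]) hc' ?_
  rw [hA.module v hv hvA x hx a ha, hc]

theorem card_image_le_five (hA : SmallCut C s W A)
    (h : PrimePartition C A f r b) (hr : ¬ MeetsTriangle C r W A)
    (hb : ¬ MeetsTriangle C b W A) : (A.image f).card ≤ 5 := by
  by_contra hlt
  obtain ⟨x, hx, y, hy, z, hz, hxy, hxz, hyz, hc | hc⟩ :=
    exists_mono_triangle_of_parts h.cross (by omega)
  · exact hr ⟨x, hx, y, hA.subset hy, z, hA.subset hz, hxy, hxz, hyz, hc⟩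
  · exact hb ⟨x, hx, y, hA.subset hy, z, hA.subset hz, hxy, hxz, hyz, hc⟩

/-- At most five parts, two of them large, joined by two colours that do not close triangles. -/
theorem StepSetting.card_le_of_triangle_free (hS : StepSetting C K W u s k)
    (hA : SmallCut C s W A) (h : PrimePartition C A f r b) (hr : ¬ MeetsTriangle C r W A)
    (hb : ¬ MeetsTriangle C b W A) {p q : V} (hp : p ∈ A) (hq : q ∈ A) (hpq : f p ≠ f q)
    (cq : s + 1 ≤ (A.filter fun w => f w = f q).card) :
    W.card ≤ maxOrder u (k + 3) := by
  have hC := hS.good.symm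
  have hrK := h.left_mem hS hA
  have hbK := h.symm.left_mem hS hA
  have sr : ∀ x ∈ A, ∀ y ∈ A, x ≠ y → f x = f y → C x y ≠ r := fun x hx y hy hxy hf =>
    h.ne_left_of_same hC hA hr hx hy hxy hf
  have sb : ∀ x ∈ A, ∀ y ∈ A, x ≠ y → f x = f y → C x y ≠ b := fun x hx y hy hxy hf =>
    h.symm.ne_left_of_same hC hA hb hx hy hxy hf
  set K' := (K.erase r).erase b with hK'
  have hKc : K'.card = k + 1 := by
    rw [Finset.card_erase_of_mem (by simp [hbK, h.ne.symm]), Finset.card_erase_of_mem hrK, hS.card]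
    omega
  have houtK : ∀ v ∈ W, v ∉ A → ∀ a ∈ A, C v a ∈ K' := by
    intro v hv hvA a ha
    refine Finset.mem_erase.mpr ⟨h.symm.outside_ne_left hC hA hb hv hvA ha, Finset.mem_erase.mpr
      ⟨h.outside_ne_left hC hA hr hv hvA ha, hS.good.mem v hv a (hA.subset ha) ?_⟩⟩
    rintro rfl
    exact hvA ha
  have hWA := hA.card_sdiff_le houtK
  rw [hKc] at hWA
  have hfib : ∀ v, (A.filter fun w => f w = v) ⊆ A := fun v => Finset.filter_subset _ _
  have hfr : ∀ v, ∀ x ∈ (A.filter fun w => f w = v), ∀ y ∈ (A.filter fun w => f w = v), x ≠ y →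
      C x y ≠ r := by
    intro v x hx y hy hxy
    rw [Finset.mem_filter] at hx hy
    exact sr x hx.1 y hy.1 hxy (by rw [hx.2, hy.2])
  have hfb : ∀ v, ∀ x ∈ (A.filter fun w => f w = v), ∀ y ∈ (A.filter fun w => f w = v), x ≠ y →
      C x y ≠ b := by
    intro v x hx y hy hxy
    rw [Finset.mem_filter] at hx hy
    exact sb x hx.1 y hy.1 hxy (by rw [hx.2, hy.2])
  have hpart : ∀ v, (A.filter fun w => f w = v).card ≤ maxOrder u (k + 1) := fun v =>
    hS.card_le_of_ne_of_ne ((hfib v).trans hA.subset) hrK hbK h.ne (hfr v) (hfb v)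
  have himg := card_image_le_five hA h hr hb
  have hpI : f p ∈ A.image f := Finset.mem_image_of_mem f hp
  have hqI : f q ∈ (A.image f).erase (f p) :=
    Finset.mem_erase.mpr ⟨hpq.symm, Finset.mem_image_of_mem f hq⟩
  have hrest : (A.filter fun w => f w ≠ f p ∧ f w ≠ f q).card ≤ maxOrder u (k + 1) * 3 := by
    have e : (((A.image f).erase (f p)).erase (f q)).card ≤ 3 := by
      rw [Finset.card_erase_of_mem hqI, Finset.card_erase_of_mem hpI]
      omega
    refine (Finset.card_le_mul_card_image_of_maps_to (f := f)
      (t := ((A.image f).erase (f p)).erase (f q)) ?_ (maxOrder u (k + 1)) ?_).trans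
      (Nat.mul_le_mul_left _ e)
    · intro w hw
      rw [Finset.mem_filter] at hw
      simp only [Finset.mem_erase]
      exact ⟨hw.2.2, hw.2.1, Finset.mem_image_of_mem f hw.1⟩
    · intro v _
      exact (Finset.card_le_card (Finset.filter_subset_filter _ (Finset.filter_subset _ _))).trans
        (hpart v)
  set A₁ := A.filter fun w => f w = f p with hA₁
  set A₂ := A.filter fun w => f w = f q with hA₂
  have hcover : W ⊆ ((A₁ ∪ (W \ A)) ∪ A₂) ∪ A.filter fun w => f w ≠ f p ∧ f w ≠ f q := by
    intro v hv
    simp only [hA₁, hA₂, Finset.mem_union, Finset.mem_filter, Finset.mem_sdiff]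
    tauto
  have hWc : W.card ≤ (A₁ ∪ (W \ A)).card + A₂.card + maxOrder u (k + 1) * 3 := by
    have e1 := Finset.card_le_card hcover
    have e2 := Finset.card_union_le ((A₁ ∪ (W \ A)) ∪ A₂)
      (A.filter fun w => f w ≠ f p ∧ f w ≠ f q)
    have e3 := Finset.card_union_le (A₁ ∪ (W \ A)) A₂
    omega
  have hnum := five_mul_maxOrder_le hS.three_le (k + 1)
  have hp1 : A₁.card ≤ maxOrder u (k + 1) := hpart (f p)
  have hq1 : A₂.card ≤ maxOrder u (k + 1) := hpart (f q)
  have hpA₁ : p ∈ A₁ := by simp [hA₁, hp]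
  have hBγ : ∀ v ∈ W \ A, C v p ∈ K' := by
    intro v hv
    rw [Finset.mem_sdiff] at hv
    exact houtK v hv.1 hv.2 p hp
  -- Each part lacks both `r` and `b`. If `W \ A` can be absorbed into `A₁`, there are at most five
  -- pieces of at most `maxOrder u (k + 1)` vertices. If not, `A₂` lacks a third colour, and the
  -- gain `maxOrder u (k + 1) - maxOrder u k` pays for `W \ A`.
  by_cases hedge : ∀ v ∈ W \ A, ∃ x ∈ A₂, ∃ y ∈ A₂, x ≠ y ∧ C x y = C v p
  · have H : Absorbing C K' A₁ A₂ ∅ (W \ A) (fun v => C v p) b s (u + 1) := by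
      refine ⟨?_, by simp, by simp, ?_, ?_, hBγ, ?_, by simp, ?_, ?_, cq, .inl rfl, hedge⟩
      · rw [Finset.disjoint_left]
        intro v hv hv'
        rw [hA₁, Finset.mem_filter] at hv
        rw [hA₂, Finset.mem_filter] at hv'
        exact hpq (hv.2.symm.trans hv'.2)
      · rw [Finset.union_empty, Finset.disjoint_left]
        intro v hv hv'
        exact (Finset.mem_sdiff.mp hv).2 (Finset.union_subset (hfib _) (hfib _) hv')
      · rw [Finset.union_empty]
        intro x hx y hy hxy
        exact Finset.mem_erase.mpr ⟨hfb _ x hx y hy hxy, Finset.mem_erase.mpr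
          ⟨hfr _ x hx y hy hxy, hS.good.mem x (hA.subset (hfib _ hx)) y (hA.subset (hfib _ hy))
            hxy⟩⟩
      · intro v hv a ha
        rw [Finset.mem_sdiff] at hv
        exact hA.module v hv.1 hv.2 a (Finset.union_subset (hfib _) (hfib _) ha) p hp
      · intro x hx
        simp at hx
      · intro c
        rw [ite_self, Finset.union_empty]
        refine (Finset.card_le_card ?_).trans (hA.card_le c)
        intro v hv
        rw [Finset.mem_filter] at hv
        have hv' := Finset.mem_sdiff.mp hv.1
        refine Finset.mem_filter.mpr ⟨hv.1, fun a ha => ?_⟩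
        rw [hA.module v hv'.1 hv'.2 a ha p hp]
        exact hv.2
    have hg := H.good hS.good (by
      rw [Finset.union_empty]
      exact Finset.union_subset ((hfib _).trans hA.subset) Finset.sdiff_subset)
      ((hfib _).trans hA.subset) (by have := hS.three_le; omega)
    have e1 := hS.ih _ _ _ (by omega) hg
    rw [hKc, Finset.union_empty] at e1
    have hnum' : 5 * maxOrder u (k + 1) ≤ maxOrder u (k + 3) := hnum
    omega
  · push Not at hedge
    obtain ⟨v, hv, hvc⟩ := hedge
    have hvK := hBγ v hv
    have e1 : (K'.erase (C v p)).card = k := by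
      rw [Finset.card_erase_of_mem hvK, hKc]; omega
    have e2 := hS.ih C (K'.erase (C v p)) A₂ (by omega)
      ((((hS.good.mono ((hfib _).trans hA.subset)).erase r (hfr _)).erase b (hfb _)).erase _ hvc)
    rw [e1] at e2
    have e3 := maxOrder_add_mul_le hS.three_le hS.two_mul_le k
    have e4 := Finset.card_union_le A₁ (W \ A)
    have hnum' : 5 * maxOrder u (k + 1) ≤ maxOrder u (k + 3) := hnum
    omega

/-- Exactly one part is large. -/
theorem StepSetting.card_le_of_one_large (hS : StepSetting C K W u s k)
    (hA : SmallCut C s W A) (h : PrimePartition C A f r b) {p : V} (hp : p ∈ A)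
    (cp : s + 1 ≤ (A.filter fun w => f w = f p).card)
    (hsmall : ∀ v, v ≠ f p → (A.filter fun w => f w = v).card ≤ s)
    (hN : s + 1 ≤ (A.filter fun w => f w ≠ f p ∧ C p w = r).card) :
    W.card ≤ maxOrder u (k + 3) := by
  have hC := hS.good.symm
  have hrK := h.left_mem hS hA
  have hbK := h.symm.left_mem hS hA
  have hus := hS.le_two_mul
  have hfib : ∀ v, (A.filter fun w => f w = v) ⊆ A := fun v => Finset.filter_subset _ _
  set A₁ := A.filter fun w => f w = f p with hA₁
  have hnbr : ∀ c, Complete C c A₁ (A.filter fun w => f w ≠ f p ∧ C p w = c) := by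
    intro c x hx y hy
    rw [hA₁, Finset.mem_filter] at hx
    rw [Finset.mem_filter] at hy
    rw [h.module x hx.1 p hp y hy.1 hx.2 (by rw [hx.2]; exact hy.2.1.symm)]
    exact hy.2.2
  have hdis : ∀ c, Disjoint A₁ (A.filter fun w => f w ≠ f p ∧ C p w = c) := by
    intro c
    rw [Finset.disjoint_left]
    intro v hv hv'
    rw [hA₁, Finset.mem_filter] at hv
    rw [Finset.mem_filter] at hv'
    exact hv'.2.1 hv.2
  set N := A.filter fun w => f w ≠ f p ∧ C p w = r with hNdef
  set M := A.filter fun w => f w ≠ f p ∧ C p w = b with hMdef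
  have hr : ¬ MeetsTriangle C r W A := hS.good.not_meetsTriangle hS.one_le (by omega) hA.subset
    h.conn_left (hfib _) (Finset.filter_subset _ _) (hdis r) (hnbr r) cp hN
  have hrA₁ : ∀ x ∈ A₁, ∀ y ∈ A₁, x ≠ y → C x y ≠ r := by
    intro x hx y hy hxy
    rw [hA₁, Finset.mem_filter] at hx hy
    exact h.ne_left_of_same hC hA hr hx.1 hy.1 hxy (by rw [hx.2, hy.2])
  have houtK : ∀ v ∈ W, v ∉ A → ∀ a ∈ A, C v a ∈ K.erase r := by
    intro v hv hvA a ha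
    refine Finset.mem_erase.mpr
      ⟨h.outside_ne_left hC hA hr hv hvA ha, hS.good.mem v hv a (hA.subset ha) ?_⟩
    rintro rfl
    exact hvA ha
  have hWA := hA.card_sdiff_le houtK
  rw [Finset.card_erase_of_mem hrK, hS.card] at hWA
  have hWA' : (W \ A).card ≤ (k + 2) * s := hWA
  have hnum := maxOrder_add_maxOrder_add_mul_le hS.two_mul_le k
  have hnum1 := le_maxOrder_succ hS.three_le k
  have hnum2 : 2 * maxOrder u (k + 1) ≤ maxOrder u (k + 2) := two_mul_maxOrder_le hS.three_le (k + 1)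
  have h2s := hS.two_mul_le
  have hWc : W.card ≤ A.card + (W \ A).card := by
    rw [Finset.card_sdiff_of_subset hA.subset]
    have := Finset.card_le_card hA.subset
    omega
  -- A `b`-triangle bounds the `b`-neighbourhood of the large part by `s` and, by an even splitting,
  -- its `r`-neighbourhood by `3 * s`. Without `b`-triangles there are at most five parts, four of
  -- them small.
  by_cases hb : MeetsTriangle C b W A
  · have hM : M.card ≤ s := by
      by_contra hlt
      exact hS.good.not_meetsTriangle hS.one_le (by omega) hA.subset h.conn_right (hfib _)
        (Finset.filter_subset _ _) (hdis b) (hnbr b) cp (Nat.lt_of_not_le hlt) hb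
    have hN3 : N.card ≤ 3 * s := by
      by_contra hlt
      obtain ⟨X, Y, hXN, hYN, hX, hY, hXY⟩ := exists_split_of_small_parts (N := N) (f := f) (s := s)
        (fun v => by
          by_cases hv : v = f p
          · rw [Finset.card_eq_zero.mpr]
            · omega
            · rw [Finset.filter_eq_empty_iff]
              intro w hw
              rw [hNdef, Finset.mem_filter] at hw
              rw [hv]
              exact hw.2.1
          · exact (Finset.card_le_card (Finset.filter_subset_filter _
              (Finset.filter_subset _ _))).trans (hsmall v hv)) (by omega)
      refine hS.good.not_meetsTriangle hS.one_le (by omega) hA.subset h.conn_right (X := X) (Y := Y)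
        (hXN.trans (Finset.filter_subset _ _)) (hYN.trans (Finset.filter_subset _ _))
        (Finset.disjoint_left.mpr fun v hv hv' => hXY v hv v hv' rfl) ?_ hX hY hb
      intro x hx y hy
      have hxy := hXY x hx y hy
      have hx := Finset.mem_filter.mp (hXN hx)
      have hy := Finset.mem_filter.mp (hYN hy)
      refine (h.cross x hx.1 y hy.1 hxy).resolve_left ?_
      exact color_ne_of_not_meetsTriangle hr hp (hA.subset hx.1) (hA.subset hy.1)
        (fun e => hx.2.1 (by rw [e])) (fun e => hy.2.1 (by rw [e])) (fun e => hxy (by rw [e]))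
        hx.2.2 hy.2.2
    have hcover : A ⊆ A₁ ∪ N ∪ M := by
      intro v hv
      simp only [hA₁, hNdef, hMdef, Finset.mem_union, Finset.mem_filter]
      by_cases hf : f v = f p
      · simp [hv, hf]
      · have := h.cross p hp v hv (Ne.symm hf)
        tauto
    have e1 := Finset.card_le_card hcover
    have e2 := Finset.card_union_le (A₁ ∪ N) M
    have e3 := Finset.card_union_le A₁ N
    have e4 := hS.card_le_of_ne ((hfib (f p)).trans hA.subset) hrK hrA₁
    have e5 : A₁.card ≤ maxOrder u (k + 2) := e4
    linarith
  · have hbA₁ : ∀ x ∈ A₁, ∀ y ∈ A₁, x ≠ y → C x y ≠ b := by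
      intro x hx y hy hxy
      rw [hA₁, Finset.mem_filter] at hx hy
      exact h.symm.ne_left_of_same hC hA hb hx.1 hy.1 hxy (by rw [hx.2, hy.2])
    have e4 : A₁.card ≤ maxOrder u (k + 1) :=
      hS.card_le_of_ne_of_ne ((hfib (f p)).trans hA.subset) hrK hbK h.ne hrA₁ hbA₁
    have himg := card_image_le_five hA h hr hb
    have hrest : (A.filter fun w => ¬ f w = f p).card ≤ s * 4 := by
      have e : ((A.image f).erase (f p)).card ≤ 4 := by
        rw [Finset.card_erase_of_mem (Finset.mem_image_of_mem f hp)]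
        omega
      refine (Finset.card_le_mul_card_image_of_maps_to (f := f)
        (t := (A.image f).erase (f p)) ?_ s ?_).trans (Nat.mul_le_mul_left _ e)
      · intro w hw
        rw [Finset.mem_filter] at hw
        exact Finset.mem_erase.mpr ⟨hw.2, Finset.mem_image_of_mem f hw.1⟩
      · intro v hv
        exact (Finset.card_le_card (Finset.filter_subset_filter _ (Finset.filter_subset _ _))).trans
          (hsmall v (Finset.ne_of_mem_erase hv))
    have e5 := Finset.card_filter_add_card_filter_not (s := A) (fun w => f w = f p)
    have e6 : A₁.card + (A.filter fun w => ¬ f w = f p).card = A.card := e5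
    linarith

theorem exists_minimal_smallCut (hW : W.Nonempty) :
    ∃ A, SmallCut C s W A ∧ ∀ A', SmallCut C s W A' → A.card ≤ A'.card := by
  have hex : ∃ n, ∃ A, SmallCut C s W A ∧ A.card = n :=
    ⟨_, W, ⟨subset_rfl, hW, fun v hv hv' => absurd hv hv', fun c => by simp [colorNbrs]⟩, rfl⟩
  obtain ⟨A, hA, hAn⟩ := Nat.find_spec hex
  exact ⟨A, hA, fun A' hA' => hAn ▸ Nat.find_min' hex ⟨A', hA', rfl⟩⟩

/-- Grouping the parts into one and the rest gives two sides joined by `r`. By minimality of `A`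
both exceed `s`, for otherwise the other side alone would be a smaller cut. Any second colour can
play the role of `b`, with no `b`-neighbours present. -/
theorem StepSetting.card_le_of_joined (hS : StepSetting C K W u s k) (hA : SmallCut C s W A)
    (hmin : ∀ A', SmallCut C s W A' → A.card ≤ A'.card) (hAc : 2 * s + 1 ≤ A.card)
    (h2 : ∃ x ∈ A, ∃ y ∈ A, f x ≠ f y) (hr : ∀ x ∈ A, ∀ y ∈ A, f x ≠ f y → C x y = r) :
    W.card ≤ maxOrder u (k + 3) := by
  have hC := hS.good.symm
  have hus := hS.le_two_mul
  obtain ⟨p, hp, q, hq, hpq⟩ := h2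
  set A₁ := A.filter fun w => f w = f p with hA₁
  set A₂ := A.filter fun w => ¬ f w = f p with hA₂
  have m1 : ∀ v, v ∈ A₁ ↔ v ∈ A ∧ f v = f p := fun v => Finset.mem_filter
  have m2 : ∀ v, v ∈ A₂ ↔ v ∈ A ∧ ¬ f v = f p := fun v => Finset.mem_filter
  have s1 : A₁ ⊆ A := Finset.filter_subset _ _
  have s2 : A₂ ⊆ A := Finset.filter_subset _ _
  have hp1 : p ∈ A₁ := (m1 p).mpr ⟨hp, rfl⟩
  have hq2 : q ∈ A₂ := (m2 q).mpr ⟨hq, Ne.symm hpq⟩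
  have hd : Disjoint A₁ A₂ := Finset.disjoint_filter_filter_not _ _ _
  have hcard : A₁.card + A₂.card = A.card := Finset.card_filter_add_card_filter_not _
  have hd1 : A \ A₁ = A₂ := by
    ext v; rw [Finset.mem_sdiff, m1, m2]; tauto
  have hd2 : A \ A₂ = A₁ := by
    ext v; rw [Finset.mem_sdiff, m1, m2]; tauto
  have h12 : Complete C r A₁ A₂ := by
    intro x hx y hy
    rw [m1] at hx
    rw [m2] at hy
    exact hr x hx.1 y hy.1 (by rw [hx.2]; exact Ne.symm hy.2)
  have h21 := h12.symm hC
  have hp1c := Finset.card_pos.mpr ⟨p, hp1⟩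
  have hq2c := Finset.card_pos.mpr ⟨q, hq2⟩
  have c1 : s + 1 ≤ A₁.card := by
    by_contra hlt
    have := hmin A₂ (hA.peel hS s2 (by omega)
      (fun v hv hv2 a ha a' ha' => by
        have hv1 : v ∈ A₁ := hd2 ▸ Finset.mem_sdiff.mpr ⟨hv, hv2⟩
        rw [h12 v hv1 a ha, h12 v hv1 a' ha'])
      (fun c => (Finset.card_filter_le _ _).trans (by rw [hd2]; omega)))
    omega
  have c2 : s + 1 ≤ A₂.card := by
    by_contra hlt
    have := hmin A₁ (hA.peel hS s1 (by omega)
      (fun v hv hv1 a ha a' ha' => by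
        have hv2 : v ∈ A₂ := hd1 ▸ Finset.mem_sdiff.mpr ⟨hv, hv1⟩
        rw [h21 v hv2 a ha, h21 v hv2 a' ha'])
      (fun c => (Finset.card_filter_le _ _).trans (by rw [hd1]; omega)))
    omega
  have hrK : r ∈ K := by
    rw [← h12 p hp1 q hq2]
    exact hS.good.mem p (hA.subset hp) q (hA.subset hq) fun e => hpq (by rw [e])
  have hconn : ColorConnected C r A := by
    have hadj : ∀ x ∈ A₁, ∀ y ∈ A₂, ColorAdj C r A x y := fun x hx y hy =>
      ⟨s1 hx, s2 hy, fun e => Finset.disjoint_left.mp hd hx (e ▸ hy), h12 x hx y hy⟩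
    have hsymm := colorAdj_symm (c := r) (A := A) hC
    have key : ∀ x ∈ A, Relation.ReflTransGen (ColorAdj C r A) p x := by
      intro x hx
      by_cases hx1 : f x = f p
      · exact (Relation.ReflTransGen.single (hadj p hp1 q hq2)).tail
          (hsymm _ _ (hadj x ((m1 x).mpr ⟨hx, hx1⟩) q hq2))
      · exact .single (hadj p hp1 x ((m2 x).mpr ⟨hx, hx1⟩))
    exact fun x hx y hy => (reflTransGen_symm hsymm (key x hx)).trans (key y hy)
  have hnr := hS.good.not_meetsTriangle hS.one_le (by omega) hA.subset hconn s1 s2 hd h12 c1 c2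
  have hKr : 0 < (K.erase r).card := by rw [Finset.card_erase_of_mem hrK, hS.card]; omega
  obtain ⟨b, hb⟩ := Finset.card_pos.mp hKr
  have hrb : r ≠ b := (Finset.ne_of_mem_erase hb).symm
  refine hS.card_le_of_pair hA hrb hrK hnr s1 s2 hd h12 c1 c2
    (fun v hv hv1 => .inl (h21 v (hd1 ▸ Finset.mem_sdiff.mpr ⟨hv, hv1⟩)))
    (fun v hv hv2 => .inl (h12 v (hd2 ▸ Finset.mem_sdiff.mpr ⟨hv, hv2⟩))) ?_ ?_
  · rw [hd1, Finset.filter_eq_empty_iff.mpr]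
    · simp
    · intro v hv hcon
      exact hrb ((h21 v hv p hp1).symm.trans (hcon p hp1))
  · rw [hd2, Finset.filter_eq_empty_iff.mpr]
    · simp
    · intro v hv hcon
      exact hrb ((h12 v hv q hq2).symm.trans (hcon q hq2))

/-- The two large parts exclude `r`-triangles. If `b`-triangles are excluded too, the five-part
bound applies; otherwise a `b`-triangle limits the `b`-neighbours of each large part to `s`, as the
pair argument requires. -/
theorem StepSetting.card_le_of_two_large (hS : StepSetting C K W u s k) (hA : SmallCut C s W A)
    (h : PrimePartition C A f r b) {p q : V} (hp : p ∈ A) (hq : q ∈ A) (hpq : f p ≠ f q)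
    (cp : s + 1 ≤ (A.filter fun w => f w = f p).card)
    (cq : s + 1 ≤ (A.filter fun w => f w = f q).card) (hc : C p q = r) :
    W.card ≤ maxOrder u (k + 3) := by
  have hC := hS.good.symm
  have hus := hS.le_two_mul
  have hfib : ∀ v, (A.filter fun w => f w = v) ⊆ A := fun v => Finset.filter_subset _ _
  have hd : Disjoint (A.filter fun w => f w = f p) (A.filter fun w => f w = f q) := by
    rw [Finset.disjoint_left]
    intro v hv hv'
    rw [Finset.mem_filter] at hv hv'
    exact hpq (hv.2.symm.trans hv'.2)
  have h12 : Complete C r (A.filter fun w => f w = f p) (A.filter fun w => f w = f q) := by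
    intro x hx y hy
    rw [Finset.mem_filter] at hx hy
    rw [h.module.color_eq hC hx.1 hp hy.1 hq hx.2 hy.2 (by rw [hx.2, hy.2]; exact hpq), hc]
  have hnr := hS.good.not_meetsTriangle hS.one_le (by omega) hA.subset h.conn_left (hfib _) (hfib _)
    hd h12 cp cq
  by_cases hb : MeetsTriangle C b W A
  swap
  · exact hS.card_le_of_triangle_free hA h hnr hb hp hq hpq cq
  have hmono : ∀ p ∈ A, ∀ v ∈ A, v ∉ (A.filter fun w => f w = f p) →
      (∀ a ∈ (A.filter fun w => f w = f p), C v a = r) ∨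
        ∀ a ∈ (A.filter fun w => f w = f p), C v a = b := by
    intro p hp v hv hvp
    have hvp' : f p ≠ f v := fun e => hvp (Finset.mem_filter.mpr ⟨hv, e.symm⟩)
    have key : ∀ a ∈ (A.filter fun w => f w = f p), C v a = C p v := by
      intro a ha
      rw [Finset.mem_filter] at ha
      rw [hC, h.module a ha.1 p hp v hv ha.2 (by rw [ha.2]; exact hvp')]
    rcases h.cross p hp v hv hvp' with e | e
    · exact .inl fun a ha => (key a ha).trans e
    · exact .inr fun a ha => (key a ha).trans e
  have hM : ∀ p, s + 1 ≤ (A.filter fun w => f w = f p).card →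
      ((A \ (A.filter fun w => f w = f p)).filter fun v =>
        ∀ a ∈ (A.filter fun w => f w = f p), C v a = b).card ≤ s := by
    intro p cp
    by_contra hlt
    refine hS.good.not_meetsTriangle hS.one_le (by omega) hA.subset h.conn_right
      ((Finset.filter_subset _ _).trans Finset.sdiff_subset) (hfib (f p)) ?_ ?_ (Nat.lt_of_not_le hlt) cp hb
    · exact Finset.disjoint_of_subset_left (Finset.filter_subset _ _) Finset.sdiff_disjoint
    · intro x hx a ha
      exact (Finset.mem_filter.mp hx).2 a ha
  exact hS.card_le_of_pair hA h.ne (h.left_mem hS hA) hnr (hfib _) (hfib _) hd h12 cp cq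
    (hmono p hp) (hmono q hq) (hM p cp) (hM q cq)

theorem StepSetting.card_le (hS : StepSetting C K W u s k) : W.card ≤ maxOrder u (k + 3) := by
  by_contra hlt
  have hC := hS.good.symm
  have hus := hS.le_two_mul
  have hsu := hS.two_mul_le
  have hu := hS.three_le
  obtain ⟨A, hA, hmin⟩ := exists_minimal_smallCut (C := C) (s := s) (W := W)
    (Finset.card_pos.mp (by omega))
  -- At most `(k + 3) * s` vertices lie outside `A`, and `maxOrder u (k + 3)` is at least `5 * u + k
  -- * s`.
  have hAc : 5 * u + 1 ≤ A.card + 3 * s := by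
    have h1 := hA.card_sdiff_le (K' := K) (fun v hv hvA a ha =>
      hS.good.mem v hv a (hA.subset ha) fun e => hvA (e ▸ ha))
    rw [Finset.card_sdiff_of_subset hA.subset, hS.card] at h1
    have h2 := five_mul_add_mul_le_maxOrder hu hsu k
    have h3 := Finset.card_le_card hA.subset
    rw [add_mul] at h1
    omega
  obtain ⟨f, hf, h2, ⟨r, hr⟩ | ⟨r, b, hrb, hcross, cr, cb, ar, ab⟩⟩ :=
    gallai_partition hC (hS.good.mono hA.subset).gallai (show 2 ≤ A.card by omega)
  · exact hlt (hS.card_le_of_joined hA hmin (by omega) h2 hr)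
  have h : PrimePartition C A f r b := ⟨hrb, hf, hcross, cr, cb, ar, ab⟩
  by_cases hl : ∃ p ∈ A, s + 1 ≤ (A.filter fun w => f w = f p).card
  swap
  · push Not at hl
    have hsmall : ∀ v, (A.filter fun w => f w = v).card ≤ s := by
      intro v
      by_cases hv : ∃ p ∈ A, f p = v
      · obtain ⟨p, hp, rfl⟩ := hv
        have := hl p hp
        omega
      · rw [Finset.filter_eq_empty_iff.mpr fun w hw e => hv ⟨w, hw, e⟩]
        simp
    -- Five parts of size at most `s` would be too few vertices, and six parts force a monochromatic
    -- triangle between parts.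
    have himg : 6 ≤ (A.image f).card := by
      by_contra h6
      have e1 := Finset.card_le_mul_card_image (f := f) A s fun v _ => hsmall v
      have e2 := Nat.mul_le_mul_left s (show (A.image f).card ≤ 5 by omega)
      omega
    obtain ⟨x, hx, y, hy, z, hz, hxy, hxz, hyz, hc | hc⟩ := exists_mono_triangle_of_parts hcross himg
    · exact hS.good.false_of_small_parts hu hS.one_le hsu hus hA.subset hAc cr cb hcross hsmall
        ⟨x, hx, y, hy, z, hz, hxy, hxz, hyz, hc⟩
    · exact hS.good.false_of_small_parts hu hS.one_le hsu hus hA.subset hAc cb cr h.symm.cross hsmall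
        ⟨x, hx, y, hy, z, hz, hxy, hxz, hyz, hc⟩
  obtain ⟨p, hp, cp⟩ := hl
  by_cases hl2 : ∃ q ∈ A, f p ≠ f q ∧ s + 1 ≤ (A.filter fun w => f w = f q).card
  · obtain ⟨q, hq, hpq, cq⟩ := hl2
    rcases hcross p hp q hq hpq with e | e
    · exact hlt (hS.card_le_of_two_large hA h hp hq hpq cp cq e)
    · exact hlt (hS.card_le_of_two_large hA h.symm hp hq hpq cp cq e)
  push Not at hl2
  have hsmall : ∀ v, v ≠ f p → (A.filter fun w => f w = v).card ≤ s := by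
    intro v hvp
    by_cases hv : ∃ q ∈ A, f q = v
    · obtain ⟨q, hq, rfl⟩ := hv
      have := hl2 q hq hvp.symm
      omega
    · rw [Finset.filter_eq_empty_iff.mpr fun w hw e => hv ⟨w, hw, e⟩]
      simp
  by_cases hNr : s + 1 ≤ (A.filter fun w => f w ≠ f p ∧ C p w = r).card
  · exact hlt (hS.card_le_of_one_large hA h hp cp hsmall hNr)
  by_cases hNb : s + 1 ≤ (A.filter fun w => f w ≠ f p ∧ C p w = b).card
  · exact hlt (hS.card_le_of_one_large hA h.symm hp cp hsmall hNb)
  have hkey : ∀ v ∈ A, v ∉ (A.filter fun w => f w = f p) → f v ≠ f p ∧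
      ∀ a ∈ (A.filter fun w => f w = f p), C v a = C p v := by
    intro v hv hvp
    have hvp' : f v ≠ f p := fun e => hvp (Finset.mem_filter.mpr ⟨hv, e⟩)
    refine ⟨hvp', fun a ha => ?_⟩
    rw [Finset.mem_filter] at ha
    rw [hC, hf a ha.1 p hp v hv ha.2 (by rw [ha.2]; exact hvp'.symm)]
  have hpm : p ∈ A.filter fun w => f w = f p := Finset.mem_filter.mpr ⟨hp, rfl⟩
  -- The only large part has at most `s` neighbours in `r` and in `b`, so it is itself a small cut.
  -- Minimality makes it all of `A`, although there are at least two parts.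
  have hcut : SmallCut C s W (A.filter fun w => f w = f p) := by
    refine hA.peel hS (Finset.filter_subset _ _) cp ?_ ?_
    · intro v hv hvp a ha a' ha'
      rw [(hkey v hv hvp).2 a ha, (hkey v hv hvp).2 a' ha']
    · intro c
      by_cases hc : c = r ∨ c = b
      · have hsub : ((A \ (A.filter fun w => f w = f p)).filter fun v =>
            ∀ a ∈ (A.filter fun w => f w = f p), C v a = c) ⊆
            A.filter fun w => f w ≠ f p ∧ C p w = c := by
          intro v hv
          rw [Finset.mem_filter, Finset.mem_sdiff] at hv
          have hk := hkey v hv.1.1 hv.1.2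
          refine Finset.mem_filter.mpr ⟨hv.1.1, hk.1, ?_⟩
          rw [← hk.2 p hpm]
          exact hv.2 p hpm
        have := Finset.card_le_card hsub
        rcases hc with rfl | rfl <;> omega
      · rw [Finset.filter_eq_empty_iff.mpr]
        · simp
        · intro v hv hcon
          rw [Finset.mem_sdiff] at hv
          have hk := hkey v hv.1 hv.2
          have e := hcon p hpm
          rw [hk.2 p hpm] at e
          exact hc (e ▸ hcross p hp v hv.1 hk.1.symm)
  have e1 := hmin _ hcut
  have e2 := Finset.eq_of_subset_of_card_le (Finset.filter_subset _ _) e1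
  obtain ⟨x, hx, y, hy, hxy⟩ := h2
  rw [← e2, Finset.mem_filter] at hx hy
  exact hxy (hx.2.trans hy.2.symm)

theorem Good.card_le {u : ℕ} (hu : 3 ≤ u) (n : ℕ) : ∀ (C : V → V → κ) (K : Finset κ)
    (A : Finset V), K.card = n → Good C K A (u + 1) → A.card ≤ maxOrder u n := by
  induction n using Nat.strong_induction_on with
  | _ n ih =>
    intro C K A hK h
    match n with
    | 0 =>
      by_contra hlt
      obtain ⟨x, hx, y, hy, hxy⟩ := Finset.one_lt_card.mp (not_le.mp hlt)
      have := h.mem x hx y hy hxy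
      rw [Finset.card_eq_zero.mp hK] at this
      simp at this
    | 1 =>
      by_contra hlt
      obtain ⟨c, rfl⟩ := Finset.card_eq_one.mp hK
      have hc : ∀ x ∈ A, ∀ y ∈ A, x ≠ y → C x y = c := fun x hx y hy hxy => by
        simpa using h.mem x hx y hy hxy
      simp only [maxOrder, not_le] at hlt
      obtain ⟨T, hT, hT3⟩ := Finset.exists_subset_card_eq (show 3 ≤ A.card by omega)
      obtain ⟨x, y, z, hxy, hxz, hyz, rfl⟩ := Finset.card_eq_three.mp hT3
      have hx := hT (show x ∈ _ by simp)
      have hy := hT (show y ∈ _ by simp)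
      have hz := hT (show z ∈ _ by simp)
      refine h.free c (triTail_of_degree hx hy hz hxy hxz hyz (hc x hx y hy hxy) (hc x hx z hz hxz)
        (hc y hy z hz hyz) h.symm (by omega) fun v hv => ?_)
      have : A.erase v ⊆ A.filter fun w => w ≠ v ∧ C v w = c := by
        intro w hw
        rw [Finset.mem_erase] at hw
        exact Finset.mem_filter.mpr ⟨hw.2, hw.1, hc v hv w hw.2 hw.1.symm⟩
      have := Finset.card_le_card this
      rw [Finset.card_erase_of_mem hv] at this
      omega
    | 2 =>
      obtain ⟨r, b, -, rfl⟩ := Finset.card_eq_two.mp hK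
      exact h.card_le_of_two_colors hu (s := u / 2) (by omega) (by omega) (by omega)
        (r := r) (b := b) fun x hx y hy hxy => by simpa using h.mem x hx y hy hxy
    | k + 3 =>
      exact StepSetting.card_le (C := C) (K := K) (W := A) (s := u / 2) ⟨hu, by omega, by omega,
        by omega, h, hK, fun C' K' A' hK' h' => ih _ hK' C' K' A' rfl h'⟩

end

/-! ### Lower bound by blow-ups -/

noncomputable section
open scoped Classical

variable {V κ : Type} {C : V → V → κ} {c : κ} {A : Finset V}

/-- The colouring of `V × Fin m` that agrees with `C` on each copy of `V` and joins different
copies of `V` by the colours of `D` shifted by `k`. -/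
def blowUp {m : ℕ} (C : V → V → ℕ) (k : ℕ) (D : Fin m → Fin m → ℕ) (x y : V × Fin m) : ℕ :=
  if x.2 = y.2 then C x.1 y.1 else k + D x.2 y.2

theorem blowUp_of_eq {m : ℕ} {C : V → V → ℕ} {k : ℕ} {D : Fin m → Fin m → ℕ} {x y : V × Fin m}
    (h : x.2 = y.2) : blowUp C k D x y = C x.1 y.1 := if_pos h

theorem blowUp_of_ne {m : ℕ} {C : V → V → ℕ} {k : ℕ} {D : Fin m → Fin m → ℕ} {x y : V × Fin m}
    (h : x.2 ≠ y.2) : blowUp C k D x y = k + D x.2 y.2 := if_neg h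

theorem snd_eq_of_blowUp_lt {m : ℕ} {C : V → V → ℕ} {k : ℕ} {D : Fin m → Fin m → ℕ}
    {x y : V × Fin m} (h : blowUp C k D x y < k) : x.2 = y.2 := by
  by_contra hne
  rw [blowUp_of_ne hne] at h
  omega

theorem ColorPath.of_blowUp [Fintype V] {m : ℕ} {C : V → V → ℕ} {k : ℕ} {D : Fin m → Fin m → ℕ}
    {c : ℕ} (hc : c < k) {l : List (V × Fin m)} : ∀ {z : V × Fin m},
    ColorPath (blowUp C k D) c Finset.univ (z :: l) →
      ColorPath C c Finset.univ (z.1 :: l.map Prod.fst) ∧ ∀ v ∈ l, v.2 = z.2 := by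
  induction l with
  | nil => exact fun _ => ⟨colorPath_singleton.mpr (Finset.mem_univ _), by simp⟩
  | cons w l ih =>
    intro z h
    obtain ⟨-, hz, hzw, hp⟩ := colorPath_cons_cons.mp h
    have he : z.2 = w.2 := snd_eq_of_blowUp_lt (hzw.trans_lt hc)
    rw [blowUp_of_eq he] at hzw
    obtain ⟨hp', hw⟩ := ih hp
    have hsnd : ∀ v ∈ w :: l, v.2 = z.2 := by
      intro v hv
      rcases List.mem_cons.mp hv with rfl | hv
      · exact he.symm
      · exact (hw v hv).trans he.symm
    refine ⟨colorPath_cons_cons.mpr ⟨Finset.mem_univ _, ?_, hzw, hp'⟩, hsnd⟩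
    rw [← List.map_cons]
    intro hm
    obtain ⟨v, hv, hvz⟩ := List.mem_map.mp hm
    exact hz ((Prod.ext hvz (hsnd v hv) : v = z) ▸ hv)

/-- An old colour never leaves a copy, so its configurations project to `C`; a new colour has no
triangle at all by `htri`. Three different copies see at most `j ≤ 2` colours, and a triangle
meeting two copies has two equal edges. -/
theorem Good.blowUp [Fintype V] {m j k t : ℕ} {C : V → V → ℕ} {D : Fin m → Fin m → ℕ}
    (h : Good C (Finset.range k) Finset.univ t) (hD : ∀ a b, D a b = D b a)
    (hlt : ∀ a b, D a b < j) (hj : j ≤ 2)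
    (htri : ∀ a b d, a ≠ b → a ≠ d → b ≠ d → ¬ (D a b = D a d ∧ D b d = D a d)) :
    Good (blowUp C k D) (Finset.range (k + j)) Finset.univ t := by
  have hlow : ∀ x y : V × Fin m, x ≠ y → x.2 = y.2 → _root_.blowUp C k D x y < k := by
    intro x y hxy he
    rw [blowUp_of_eq he]
    exact Finset.mem_range.mp (h.mem _ (Finset.mem_univ _) _ (Finset.mem_univ _)
      fun e => hxy (Prod.ext e he))
  constructor
  · intro x y
    simp only [_root_.blowUp, eq_comm (a := x.2), h.symm x.1, hD x.2]
  · intro x _ y _ hxy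
    rw [Finset.mem_range]
    by_cases he : x.2 = y.2
    · exact (hlow x y hxy he).trans_le (Nat.le_add_right _ _)
    · rw [blowUp_of_ne he]
      exact Nat.add_lt_add_left (hlt _ _) _
  · intro x _ y _ z _ hxy hyz hxz
    by_cases e1 : x.2 = y.2
    · by_cases e2 : y.2 = z.2
      · rw [blowUp_of_eq e1, blowUp_of_eq e2, blowUp_of_eq (e1.trans e2)]
        exact h.gallai _ (Finset.mem_univ _) _ (Finset.mem_univ _) _ (Finset.mem_univ _)
          (fun e => hxy (Prod.ext e e1)) (fun e => hyz (Prod.ext e e2))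
          fun e => hxz (Prod.ext e (e1.trans e2))
      · refine .inr (.inr ?_)
        rw [blowUp_of_ne e2, blowUp_of_ne (e1 ▸ e2), e1]
    · by_cases e2 : y.2 = z.2
      · refine .inr (.inl ?_)
        rw [blowUp_of_ne e1, blowUp_of_ne (e2 ▸ e1), e2]
      · by_cases e3 : x.2 = z.2
        · refine .inl ?_
          rw [blowUp_of_ne e1, blowUp_of_ne e2, e3, hD]
        · rw [blowUp_of_ne e1, blowUp_of_ne e2, blowUp_of_ne e3]
          have h1 := hlt x.2 y.2
          have h2 := hlt y.2 z.2
          have h3 := hlt x.2 z.2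
          omega
  · rintro c ⟨x, y, z, l, hp, -, -, hxy, hxl, hyl, cxy, cxz, cyz, hlen⟩
    have hxz : x ≠ z := fun e => hxl (by simp [e])
    have hyz : y ≠ z := fun e => hyl (by simp [e])
    by_cases hc : c < k
    · have exz := snd_eq_of_blowUp_lt (cxz.trans_lt hc)
      have eyz := snd_eq_of_blowUp_lt (cyz.trans_lt hc)
      have exy := exz.trans eyz.symm
      obtain ⟨hp', hl⟩ := hp.of_blowUp hc
      have hmem : ∀ v : V × Fin m, v.2 = z.2 → v.1 ∈ z.1 :: l.map Prod.fst → v ∈ z :: l := by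
        intro v hv hm
        rw [← List.map_cons] at hm
        obtain ⟨w, hw, hwv⟩ := List.mem_map.mp hm
        have hw2 : w.2 = z.2 := by
          rcases List.mem_cons.mp hw with rfl | hw
          · rfl
          · exact hl w hw
        exact (Prod.ext hwv (hw2.trans hv.symm) : w = v) ▸ hw
      rw [blowUp_of_eq exy] at cxy
      rw [blowUp_of_eq exz] at cxz
      rw [blowUp_of_eq eyz] at cyz
      exact h.free c ⟨x.1, y.1, z.1, l.map Prod.fst, hp', Finset.mem_univ _, Finset.mem_univ _,
        fun e => hxy (Prod.ext e exy), fun e => hxl (hmem x exz e), fun e => hyl (hmem y eyz e),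
        cxy, cxz, cyz, by rwa [List.length_map]⟩
    · have exy : x.2 ≠ y.2 := fun e => hc (cxy ▸ hlow x y hxy e)
      have exz : x.2 ≠ z.2 := fun e => hc (cxz ▸ hlow x z hxz e)
      have eyz : y.2 ≠ z.2 := fun e => hc (cyz ▸ hlow y z hyz e)
      rw [blowUp_of_ne exy] at cxy
      rw [blowUp_of_ne exz] at cxz
      rw [blowUp_of_ne eyz] at cyz
      exact htri _ _ _ exy exz eyz ⟨by omega, by omega⟩

theorem TriTail.le_card {m : ℕ} (h : TriTail C c A m) : m ≤ A.card := by
  obtain ⟨x, y, z, l, hp, hx, hy, hxy, hxl, hyl, -, -, -, hlen⟩ := h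
  have hn : (x :: y :: z :: l).Nodup := by
    rw [List.nodup_cons, List.nodup_cons, List.mem_cons]
    exact ⟨fun e => e.elim hxy hxl, hyl, hp.1⟩
  have hs : (x :: y :: z :: l).toFinset ⊆ A := by
    intro v hv
    rw [List.mem_toFinset, List.mem_cons, List.mem_cons] at hv
    rcases hv with rfl | rfl | hv
    · exact hx
    · exact hy
    · exact hp.mem v hv
  have := Finset.card_le_card hs
  rw [List.toFinset_card_of_nodup hn] at this
  simp only [List.length_cons] at this
  omega

/-- The colouring of the complete graph on five vertices by two pentagons. -/
def pentagon (i j : Fin 5) : ℕ := if j = i + 1 ∨ i = j + 1 then 0 else 1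

theorem exists_good_maxOrder (u k : ℕ) : ∃ (V : Type) (_ : Fintype V) (C : V → V → ℕ),
    Fintype.card V = maxOrder u (k + 1) ∧
      Good C (Finset.range (k + 1)) Finset.univ (u + 1) := by
  have hone : Good (V := Fin u) (fun _ _ => 0) (Finset.range 1) Finset.univ (u + 1) := by
    refine ⟨fun _ _ => rfl, fun _ _ _ _ _ => by simp, fun _ _ _ _ _ _ _ _ _ => .inl rfl,
      fun c hc => ?_⟩
    have := hc.le_card
    rw [Finset.card_univ, Fintype.card_fin] at this
    omega
  induction k using Nat.twoStepInduction with
  | zero => exact ⟨Fin u, inferInstance, _, by simp [maxOrder], hone⟩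
  | one =>
    refine ⟨Fin u × Fin 2, inferInstance, _, ?_, hone.blowUp (j := 1) (D := fun _ _ => 0)
      (fun _ _ => rfl) (fun _ _ => Nat.one_pos) (by omega) ?_⟩
    · simp only [Fintype.card_prod, Fintype.card_fin, maxOrder]
      omega
    · intro a b d
      omega
  | more k ih _ =>
    obtain ⟨V, hV, C, hcard, h⟩ := ih
    refine ⟨V × Fin 5, inferInstance, _, ?_, h.blowUp (j := 2) (D := pentagon) (by decide)
      (by decide) le_rfl (by decide)⟩
    simp only [Fintype.card_prod, Fintype.card_fin, maxOrder, hcard]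
    omega

/-! ### Translation to graph copies and conclusion -/

theorem ColorPath.map {W μ : Type} {D : W → W → μ} {d : μ} (g : V ↪ W)
    (hg : ∀ x y, x ≠ y → C x y = c → D (g x) (g y) = d) {l : List V} : ∀ {z : V},
    ColorPath C c A (z :: l) → ColorPath D d (A.map g) (g z :: l.map g) := by
  induction l with
  | nil =>
    intro z h
    exact colorPath_singleton.mpr (Finset.mem_map_of_mem g (colorPath_singleton.mp h))
  | cons w l ih =>
    intro z h
    obtain ⟨hzA, hz, hc, hp⟩ := colorPath_cons_cons.mp h
    refine colorPath_cons_cons.mpr ⟨Finset.mem_map_of_mem g hzA, ?_,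
      hg z w (fun e => hz (by simp [e])) hc, ih hp⟩
    rwa [← List.map_cons, List.mem_map_of_injective g.injective]

theorem TriTail.map {W μ : Type} {D : W → W → μ} {d : μ} {m : ℕ} (g : V ↪ W)
    (hg : ∀ x y, x ≠ y → C x y = c → D (g x) (g y) = d) (h : TriTail C c A m) :
    TriTail D d (A.map g) m := by
  obtain ⟨x, y, z, l, hp, hx, hy, hxy, hxl, hyl, cxy, cxz, cyz, hlen⟩ := h
  refine ⟨g x, g y, g z, l.map g, hp.map g hg, Finset.mem_map_of_mem g hx,
    Finset.mem_map_of_mem g hy, g.injective.ne hxy, ?_, ?_, hg _ _ hxy cxy,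
    hg _ _ (fun e => hxl (by simp [e])) cxz, hg _ _ (fun e => hyl (by simp [e])) cyz,
    by rwa [List.length_map]⟩
  · rwa [← List.map_cons, List.mem_map_of_injective g.injective]
  · rwa [← List.map_cons, List.mem_map_of_injective g.injective]

theorem pathPlus_adj {t : ℕ} (i j : Fin t) : (pathPlus t).Adj i j ↔
    (i.val + 1 = j.val ∨ j.val + 1 = i.val) ∨
      (i.val = 0 ∧ j.val = 2) ∨ (j.val = 0 ∧ i.val = 2) := by
  simp only [pathPlus, SimpleGraph.sup_adj, SimpleGraph.pathGraph_adj, SimpleGraph.fromRel_adj,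
    ne_eq, Fin.ext_iff]
  omega

theorem hasMonochromaticCopy_pathPlus_iff [Fintype V] {L : SimpleGraph.TopEdgeLabeling V κ}
    (hC : ∀ x y, C x y = C y x) (hL : ∀ x y h, L.get x y h = C x y) {t : ℕ} (ht : 3 ≤ t) :
    HasMonochromaticCopy L (pathPlus t) ↔ ∃ c, TriTail C c Finset.univ t := by
  have hadj : ∀ c x y, (L.labelGraph c).Adj x y ↔ x ≠ y ∧ C x y = c := by
    intro c x y
    rw [SimpleGraph.TopEdgeLabeling.labelGraph_adj]
    simp only [hL, exists_prop]
  refine exists_congr fun c => ⟨?_, ?_⟩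
  · rintro ⟨f⟩
    obtain ⟨n, rfl⟩ := Nat.exists_eq_add_of_le' ht
    have hf : ∀ i j, (pathPlus (n + 3)).Adj i j → C (f i) (f j) = c := fun i j h =>
      ((hadj c _ _).mp (f.toHom.map_adj h)).2
    have hinj := f.injective
    -- The images of `0` and `1` form the triangle with that of `2`, from which the remaining
    -- vertices run as the tail.
    let g : Fin (n + 1) → V := fun i => f ⟨i.val + 2, by omega⟩
    have hg : ∀ i : Fin (n + 3), i.val < 2 → f i ∉ List.ofFn g := by
      intro i hi hm
      obtain ⟨j, hj⟩ := List.mem_ofFn.mp hm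
      have := congrArg Fin.val (hinj hj)
      simp only at this
      omega
    have hcons : List.ofFn g = g 0 :: List.ofFn fun i : Fin n => g i.succ := List.ofFn_succ
    have hpath : ColorPath C c Finset.univ (List.ofFn g) := by
      refine ⟨List.nodup_ofFn.mpr fun i j hij => ?_, fun _ _ => Finset.mem_univ _, ?_⟩
      · have := congrArg Fin.val (hinj hij)
        simp only at this
        omega
      · rw [List.isChain_iff_getElem]
        intro i hi
        rw [List.getElem_ofFn, List.getElem_ofFn]
        exact hf _ _ ((pathPlus_adj _ _).mpr (.inl (.inl rfl)))
    have h0 := hg ⟨0, by omega⟩ (by simp)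
    have h1 := hg ⟨1, by omega⟩ (by simp)
    rw [hcons] at hpath h0 h1
    refine ⟨f ⟨0, by omega⟩, f ⟨1, by omega⟩, g 0, _, hpath, Finset.mem_univ _, Finset.mem_univ _,
      fun e => ?_, h0, h1, hf _ _ ((pathPlus_adj _ _).mpr (by simp)),
      hf _ _ ((pathPlus_adj _ _).mpr (by simp)), hf _ _ ((pathPlus_adj _ _).mpr (by simp)),
      by rw [List.length_ofFn]⟩
    simpa using hinj e
  · intro h
    obtain ⟨x, y, z, l, hp, -, -, hxy, hxl, hyl, cxy, cxz, cyz, hlen⟩ := h.exists_exact ht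
    have hn : (x :: y :: z :: l).Nodup := by
      rw [List.nodup_cons, List.nodup_cons, List.mem_cons]
      exact ⟨fun e => e.elim hxy hxl, hyl, hp.1⟩
    have hch : (x :: y :: z :: l).IsChain fun a b => C a b = c :=
      .cons_cons cxy (.cons_cons cyz hp.2.2)
    rw [List.isChain_iff_getElem] at hch
    have hlen' : (x :: y :: z :: l).length = t := by simpa using hlen
    generalize hM : x :: y :: z :: l = M at hn hch hlen'
    subst hlen'
    have hcol : ∀ i j : Fin M.length, (pathPlus M.length).Adj i j → C M[i] M[j] = c := by
      intro i j hij
      have hstep : ∀ i j : Fin M.length, i.val + 1 = j.val → C M[i] M[j] = c := by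
        rintro ⟨i, hi⟩ ⟨j, hj⟩ rfl
        exact hch i hj
      have hjump : ∀ i j : Fin M.length, i.val = 0 → j.val = 2 → C M[i] M[j] = c := by
        rintro ⟨i, hi⟩ ⟨j, hj⟩ rfl rfl
        subst hM
        exact cxz
      rcases (pathPlus_adj i j).mp hij with (h | h) | h | h
      · exact hstep i j h
      · rw [hC]; exact hstep j i h
      · exact hjump i j h.1 h.2
      · rw [hC]; exact hjump j i h.1 h.2
    have hinj : Function.Injective fun i : Fin M.length => M[i] :=
      List.nodup_iff_injective_get.mp hn
    exact ⟨⟨⟨fun i => M[i], fun {i j} hij => (hadj c _ _).mpr ⟨fun e => hij.ne (hinj e),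
      hcol i j hij⟩⟩, hinj⟩⟩

theorem hasRainbowCopy_top_iff [Fintype V] {L : SimpleGraph.TopEdgeLabeling V κ}
    (hC : ∀ x y, C x y = C y x) (hL : ∀ x y h, L.get x y h = C x y) :
    HasRainbowCopy L (⊤ : SimpleGraph (Fin 3)) ↔ ¬ NoRainbow C Finset.univ := by
  constructor
  · rintro ⟨f, hf⟩ hG
    have hinj := f.injective
    have hcol : ∀ i j (h : i ≠ j), L (f.toHom.mapEdgeSet ⟨s(i, j), h⟩) = C (f i) (f j) :=
      fun i j h => hL (f i) (f j) fun e => h (hinj e)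
    have key : ∀ i j a b (h : i ≠ j) (h' : a ≠ b), C (f i) (f j) = C (f a) (f b) →
        s(i, j) = s(a, b) := fun i j a b h h' e =>
      congrArg Subtype.val (@hf ⟨s(i, j), h⟩ ⟨s(a, b), h'⟩ (by simpa only [hcol] using e))
    rcases hG (f 0) (Finset.mem_univ _) (f 1) (Finset.mem_univ _) (f 2) (Finset.mem_univ _)
      (fun e => by simpa using hinj e) (fun e => by simpa using hinj e)
      (fun e => by simpa using hinj e) with e | e | e
    · exact absurd (key 0 1 1 2 (by decide) (by decide) e) (by decide)
    · exact absurd (key 0 1 0 2 (by decide) (by decide) e) (by decide)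
    · exact absurd (key 1 2 0 2 (by decide) (by decide) e) (by decide)
  · intro h
    simp only [NoRainbow, not_forall, not_or, Finset.mem_univ] at h
    obtain ⟨x, -, y, -, z, -, hxy, hyz, hxz, h1, h2, h3⟩ := h
    have hinj : Function.Injective ![x, y, z] := by
      intro i j
      fin_cases i <;> fin_cases j <;> simp [hxy, hyz, hxz, hxy.symm, hyz.symm, hxz.symm]
    let f : SimpleGraph.Copy (⊤ : SimpleGraph (Fin 3)) (⊤ : SimpleGraph V) :=
      ⟨⟨![x, y, z], fun {i j} hij e => hij (hinj e)⟩, hinj⟩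
    have hcol : ∀ i j (h : i ≠ j), L (f.toHom.mapEdgeSet ⟨s(i, j), h⟩) =
        C (![x, y, z] i) (![x, y, z] j) := fun i j h => hL _ _ fun e => h (hinj e)
    refine ⟨f, ?_⟩
    rintro ⟨e, he⟩ ⟨e', he'⟩
    induction e using Sym2.inductionOn with | _ i j
    induction e' using Sym2.inductionOn with | _ a b
    intro heq
    have hij : i ≠ j := he
    have hab : a ≠ b := he'
    have heq' : C (![x, y, z] i) (![x, y, z] j) = C (![x, y, z] a) (![x, y, z] b) :=
      (hcol i j hij).symm.trans (heq.trans (hcol a b hab))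
    rw [Subtype.mk.injEq]
    clear heq he he'
    have c1 := hC y x
    have c2 := hC z x
    have c3 := hC z y
    fin_cases i <;> fin_cases j <;> fin_cases a <;> fin_cases b <;>
      simp_all [Ne.symm]

theorem maxOrder_succ_eq (u k : ℕ) : maxOrder u (k + 1) =
    if Even (k + 1) then 2 * u * 5 ^ ((k + 1 - 2) / 2) else u * 5 ^ ((k + 1 - 1) / 2) := by
  induction k using Nat.twoStepInduction with
  | zero => simp [maxOrder]
  | one => simp [maxOrder]
  | more k ih _ =>
    have e : Even (k + 2 + 1) ↔ Even (k + 1) := by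
      rw [show k + 2 + 1 = k + 1 + 2 by omega, Nat.even_add]
      simp
    simp only [maxOrder, ih, e]
    split_ifs with hk
    · obtain ⟨a, ha⟩ := hk
      rw [show (k + 2 + 1 - 2) / 2 = (k + 1 - 2) / 2 + 1 by omega, pow_succ]
      ring
    · rw [show (k + 2 + 1 - 1) / 2 = (k + 1 - 1) / 2 + 1 by omega, pow_succ]
      ring

theorem isGallaiRamseyNumber_pathPlus {u : ℕ} (hu : 3 ≤ u) (k : ℕ) :
    IsGallaiRamseyNumber (k + 1) (⊤ : SimpleGraph (Fin 3)) (pathPlus (u + 1))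
      (maxOrder u (k + 1) + 1) := by
  constructor
  · intro L
    by_contra hno
    rw [not_or] at hno
    -- The value on the diagonal is arbitrary; every condition on the colouring concerns distinct
    -- vertices.
    let C : Fin (maxOrder u (k + 1) + 1) → Fin (maxOrder u (k + 1) + 1) → Fin (k + 1) :=
      fun x y => if h : x ≠ y then L.get x y h else 0
    have hL : ∀ x y h, L.get x y h = C x y := fun x y h => (dif_pos h).symm
    have hC : ∀ x y, C x y = C y x := by
      intro x y
      by_cases h : x = y
      · rw [h]
      · rw [← hL x y h, ← hL y x (Ne.symm (h : x ≠ y))]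
        exact L.get_comm y x h
    have hG := not_not.mp (mt (hasRainbowCopy_top_iff hC hL).mpr hno.1)
    have hT := mt (hasMonochromaticCopy_pathPlus_iff hC hL (t := u + 1) (by omega)).mpr hno.2
    have := Good.card_le hu (k + 1) C Finset.univ Finset.univ (by simp)
      ⟨hC, fun _ _ _ _ _ => Finset.mem_univ _, hG, not_exists.mp hT⟩
    rw [Finset.card_univ, Fintype.card_fin] at this
    omega
  · intro n hn
    by_contra hlt
    obtain ⟨V, hV, D, hcard, h⟩ := exists_good_maxOrder u k
    obtain ⟨g⟩ := Function.Embedding.nonempty_of_card_le (α := Fin n) (β := V)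
      (by rw [Fintype.card_fin]; omega)
    have hg : ∀ x y, x ≠ y → D (g x) (g y) < k + 1 := fun x y hxy => Finset.mem_range.mp
      (h.mem _ (Finset.mem_univ _) _ (Finset.mem_univ _) fun e => hxy (g.injective e))
    -- The extremal colouring is restricted along `g`. Reduction modulo `k + 1` changes nothing off
    -- the diagonal, where the colours are already below `k + 1`.
    let C : Fin n → Fin n → Fin (k + 1) := fun x y => Fin.ofNat (k + 1) (D (g x) (g y))
    have hval : ∀ x y, x ≠ y → (C x y).val = D (g x) (g y) := fun x y hxy =>
      Nat.mod_eq_of_lt (hg x y hxy)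
    have hC : ∀ x y, C x y = C y x := fun x y => by simp only [C, h.symm (g x)]
    let L : SimpleGraph.TopEdgeLabeling (Fin n) (Fin (k + 1)) :=
      SimpleGraph.EdgeLabeling.mk (fun x y _ => C x y) fun x y _ => hC y x
    have hL : ∀ x y h, L.get x y h = C x y := fun _ _ _ => rfl
    rcases hn L with hn | hn
    · refine (hasRainbowCopy_top_iff hC hL).mp hn fun x _ y _ z _ hxy hyz hxz => ?_
      rw [Fin.ext_iff, Fin.ext_iff, Fin.ext_iff, hval x y hxy, hval y z hyz, hval x z hxz]
      exact h.gallai _ (Finset.mem_univ _) _ (Finset.mem_univ _) _ (Finset.mem_univ _)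
        (g.injective.ne hxy) (g.injective.ne hyz) (g.injective.ne hxz)
    · obtain ⟨c, hc⟩ := (hasMonochromaticCopy_pathPlus_iff hC hL (by omega)).mp hn
      exact h.free c.val ((hc.map g fun x y hxy e => by rw [← hval x y hxy, e]).mono
        (Finset.subset_univ _) le_rfl)

end

theorem mainTheorem2 (t k : ℕ) (ht : 4 ≤ t) (hk : 1 ≤ k) :
    IsGallaiRamseyNumber k (⊤ : SimpleGraph (Fin 3)) (pathPlus t)
      (if Even k then 2 * (t - 1) * 5 ^ ((k - 2) / 2) + 1
        else (t - 1) * 5 ^ ((k - 1) / 2) + 1) := by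
  obtain ⟨u, rfl⟩ := Nat.exists_eq_add_of_le' (show 1 ≤ t by omega)
  obtain ⟨k, rfl⟩ := Nat.exists_eq_add_of_le' hk
  rw [← apply_ite (· + 1), Nat.add_sub_cancel u 1, ← maxOrder_succ_eq u k]
  exact isGallaiRamseyNumber_pathPlus (by omega) k
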